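/- Let $g\in\{2,3\}$ and let $C=(C_{-1},C_0,\dots,C_g)\in\mathbb R^{g+2}$ satisfy $C_{-1}>2C_0$, $C_i+C_{i+2}>2C_{i+1}$ for $0\le i\le g-2$, $C_{g-1}>2C_g$ and $C_g=0$. Put $\lambda_0=0$, $\lambda_i=C_{g-i}-C_{g-i+1}$ and $p_i=C_{-1}-2\sum_{j=1}^g\min(\lambda_i,\lambda_j)$ for $1\le i\le g$. Let $\tilde\Gamma\subset\mathbb R^2$ be the tropical curve consisting of the points $(X,Y)$ at which $$\min\bigl[2Y,\ (g+1)X+Y,\ gX+Y+C_g,\ \dots,\ X+Y+C_1,\ Y+C_0,\ C_{-1}\bigr]$$ is attained by at least two of the terms, and let $\Gamma$ be its compact part, obtained by removing the infinite edges. $\Gamma$ is a ladder: with $h_i=\sum_{j=1}^g\min(\lambda_i,\lambda_j)$, its vertices are $v_i=(\lambda_i,h_i)$ and $w_i=(\lambda_i,C_{-1}-h_i)$ for $0\le i\le g$, and its edges are the segments $v_iw_i$ $(0\le i\le g)$, $v_iv_{i+1}$ and $w_iw_{i+1}$ $(0\le i<g)$. Each edge $e$ has the length $w(e)=\|e\|/\|\xi_e\|$,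 where $\xi_e$ is its primitive integral tangent vector. Let $Q$ be the symmetric bilinear form on paths in $\Gamma$ for which $Q(\gamma,\gamma)$ is the length of $\gamma$ whenever $\gamma$ has no self-intersection, and let $\alpha_i$ be the counterclockwise cycle $v_{i-1}\to v_i\to w_i\to w_{i-1}\to v_{i-1}$ $(1\le i\le g)$. Let $K_{ij}=Q(\alpha_i,\alpha_j)$ and let $J(\Gamma)=\mathbb R^g/K\mathbb Z^g$ be the tropical Jacobian. For $P_0\in\Gamma$ let $\eta$ be the map that sends an effective divisor $P_1+\dots+P_g$ of degree $g$ on $\Gamma$ to the class of $\sum_{i=1}^g\bigl(Q(\gamma_i,\alpha_1),\dots,Q(\gamma_i,\alpha_g)\bigr)$ in $J(\Gamma)$, where $\gamma_i$ is a path in $\Gamma$ from $P_0$ to $P_i$. For $i\ne j$ let $\alpha_{ij}$ be $\alpha_i\cap\alpha_j$ without its end points, and let $\mathcal D^g(\Gamma)$ be the set of the divisors $P_1+\dots+P_g$ such that $P_i\in\alpha_i$ for all $i$ and at most one of the points (counted with multiplicity) lies on $\alpha_{ij}$, for all $i\neq j$. (1) For every $P_0\in\Gamma$, such paths exist, $\eta$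 does not depend on their choice, and $\eta|_{\mathcal D^g(\Gamma)}:\mathcal D^g(\Gamma)\to J(\Gamma)$ is bijective. For (2) and (3), let $\gamma_i$ be the path that runs along $\alpha_i$, in its direction, from a base point $S_i\in\alpha_i$ to $P_i$, where $S_1=S_2=v_1$ and (if $g=3$) $S_3=v_2$. Let $U\subset\mathbb R^g$ be the closure of the set of all sums $\sum_{i}(Q(\gamma_i,\alpha_j))_{j}$ for $P_1+\dots+P_g\in\mathcal D^g(\Gamma)$ with $P_i\in\alpha_i$ and no $P_i$ a vertex. A closed set $V\subset\mathbb R^g$ is called a fundamental domain of $K\mathbb Z^g$ if its translates by $K\mathbb Z^g$ cover $\mathbb R^g$ and have pairwise disjoint interiors. For vectors $a_1,\dots,a_k$ write $Z(a_1,\dots,a_k)=\{\sum_i t_ia_i : 0\le t_i\le 1\}$. (2) Let $g=2$ and $A_2=(-p_1,2p_1)\in K\mathbb Z^2$. Then $V=U-A_2$ is the hexagon $(p_1,-2p_1)+Z\bigl((C_{-1}+2\lambda_1,0),(p_1,-p_1),(0,p_1)\bigr)$; it has exactly six edges, is a union of three parallelograms with pairwise disjoint interiors, and is a fundamental domain of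 $K\mathbb Z^2$. (3) Let $g=3$. Then $U$ is a union of twelve parallelepipeds with pairwise disjoint interiors. Suitable translates of these twelve parallelepipeds by vectors of $K\mathbb Z^3$ again have pairwise disjoint interiors, and their union is the polytope $$V=(p_1,-p_1,0)+Z\bigl((C_{-1}+2\lambda_1,0,0),(p_1,-p_1,0),(0,-2(\lambda_2-\lambda_1),0),(0,-p_2,p_2),(0,0,p_2)\bigr),$$ which is a dodecahedron (it has exactly twelve facets) and a fundamental domain of $K\mathbb Z^3$. -/

import Mathlib

open Set

noncomputable section

namespace TropHyper

/-! ### The tropical hyperelliptic curve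

The parameters `C_{-1}, C_0, …, C_g` are given by a function `C : ℤ → ℝ`, of which only the values
at `-1, 0, …, g` are used. -/

/-- The condition `C_{-1} > 2 C_0`, `C_i + C_{i+2} > 2 C_{i+1}` for `0 ≤ i ≤ g - 2`,
`C_{g-1} > 2 C_g`, together with the normalization `C_g = 0`. -/
structure IsGeneric (g : ℕ) (C : ℤ → ℝ) : Prop where
  first : C (-1) > 2 * C 0
  convex : ∀ i : ℤ, 0 ≤ i → i ≤ (g : ℤ) - 2 → C i + C (i + 2) > 2 * C (i + 1)
  last : C ((g : ℤ) - 1) > 2 * C g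
  normalized : C g = 0

/-- The monomials `2Y`, `(g+1)X + Y`, `iX + Y + C_i` (`0 ≤ i ≤ g`) and `C_{-1}`. -/
inductive Monomial (g : ℕ) : Type
  | ySq : Monomial g
  | xTop : Monomial g
  | mid (i : Fin (g + 1)) : Monomial g
  | const : Monomial g

/-- The value of a monomial at `P = (X, Y)`. -/
def Monomial.val {g : ℕ} (C : ℤ → ℝ) : Monomial g → ℝ × ℝ → ℝ
  | .ySq, P => 2 * P.2
  | .xTop, P => ((g : ℝ) + 1) * P.1 + P.2
  | .mid i, P => (i : ℕ) * P.1 + P.2 + C (i : ℕ)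
  | .const, _ => C (-1)

/-- The affine tropical curve: the points at which the minimum of the monomials is attained by at
least two of them. -/
def tropicalCurve (g : ℕ) (C : ℤ → ℝ) : Set (ℝ × ℝ) :=
  {P | ∃ m n : Monomial g, m ≠ n ∧ m.val C P = n.val C P ∧
    ∀ k : Monomial g, m.val C P ≤ k.val C P}

/-- `P` is the starting point of an infinite straight ray that is contained in the tropical curve;
such points make up the (closed) infinite edges. -/
def OnInfiniteEdge (g : ℕ) (C : ℤ → ℝ) (P : ℝ × ℝ) : Prop :=
  ∃ d : ℝ × ℝ, d ≠ 0 ∧ ∀ t : ℝ, 0 ≤ t → P + t • d ∈ tropicalCurve g C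

/-- The compact part `Γ` of the tropical curve: remove the infinite edges (and keep the vertices at
which they are attached to bounded edges). -/
def Gam (g : ℕ) (C : ℤ → ℝ) : Set (ℝ × ℝ) :=
  closure {P ∈ tropicalCurve g C | ¬ OnInfiniteEdge g C P}

/-! ### The metric graph -/

/-- `λ_0 = 0` and `λ_i = C_{g-i} - C_{g-i+1}` for `1 ≤ i ≤ g`. -/
def lam (g : ℕ) (C : ℤ → ℝ) : ℕ → ℝ
  | 0 => 0
  | i + 1 => C ((g : ℤ) - (i + 1)) - C ((g : ℤ) - (i + 1) + 1)

/-- `∑_{j=1}^g min(λ_i, λ_j)`. -/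
def height (g : ℕ) (C : ℤ → ℝ) (i : ℕ) : ℝ :=
  ∑ j ∈ Finset.Icc 1 g, min (lam g C i) (lam g C j)

/-- `p_i = C_{-1} - 2 ∑_{j=1}^g min(λ_i, λ_j)`. -/
def p (g : ℕ) (C : ℤ → ℝ) (i : ℕ) : ℝ := C (-1) - 2 * height g C i

/-- The lower vertices `v_0, …, v_g` of the curve. -/
def v (g : ℕ) (C : ℤ → ℝ) (i : ℕ) : ℝ × ℝ := (lam g C i, height g C i)

/-- The upper vertices `w_0, …, w_g` of the curve. -/
def w (g : ℕ) (C : ℤ → ℝ) (i : ℕ) : ℝ × ℝ := (lam g C i, C (-1) - height g C i)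

/-- The bounded edges: the vertical edges `v_i w_i` (`0 ≤ i ≤ g`), the lower edges `v_i v_{i+1}` and
the upper edges `w_i w_{i+1}` (`0 ≤ i < g`). -/
abbrev Edge (g : ℕ) : Type := Fin (g + 1) ⊕ Fin g ⊕ Fin g

/-- The initial vertex of an edge. -/
def Edge.src {g : ℕ} (C : ℤ → ℝ) : Edge g → ℝ × ℝ
  | .inl i => v g C i
  | .inr (.inl i) => v g C i
  | .inr (.inr i) => w g C i

/-- The final vertex of an edge. -/
def Edge.tgt {g : ℕ} (C : ℤ → ℝ) : Edge g → ℝ × ℝ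
  | .inl i => w g C i
  | .inr (.inl i) => v g C (i + 1)
  | .inr (.inr i) => w g C (i + 1)

/-- The primitive (integral) tangent vector of an edge. -/
def Edge.prim {g : ℕ} : Edge g → ℝ × ℝ
  | .inl _ => (0, 1)
  | .inr (.inl i) => (1, (g : ℝ) - (i : ℕ))
  | .inr (.inr i) => (1, -((g : ℝ) - (i : ℕ)))

/-- An edge as a closed segment in the plane. -/
def Edge.seg {g : ℕ} (C : ℤ → ℝ) (e : Edge g) : Set (ℝ × ℝ) := segment ℝ (e.src C) (e.tgt C)

/-- The weight `‖e‖ / ‖ξ_e‖` of an edge. -/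
def Edge.weight {g : ℕ} (C : ℤ → ℝ) (e : Edge g) : ℝ := ‖e.tgt C - e.src C‖ / ‖e.prim‖

/-- The arc length coordinate on an edge, which runs from `0` to the weight of the edge. -/
def Edge.pos {g : ℕ} (C : ℤ → ℝ) (e : Edge g) (x : ℝ × ℝ) : ℝ := ‖x - e.src C‖ / ‖e.prim‖

/-- A (piecewise linear) path on the graph from `x` to `y`, given by its successive break points:
each break point lies on a common edge with the next one. -/
def IsPath (g : ℕ) (C : ℤ → ℝ) (γ : List (ℝ × ℝ)) (x y : ℝ × ℝ) : Prop :=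
  γ.head? = some x ∧ γ.getLast? = some y ∧
    γ.IsChain (fun a b => ∃ e : Edge g, a ∈ e.seg C ∧ b ∈ e.seg C)

/-- The set of points that a path runs through. -/
def pathSupport (γ : List (ℝ × ℝ)) : Set (ℝ × ℝ) :=
  {P | ∃ s ∈ γ.zip γ.tail, P ∈ segment ℝ s.1 s.2}

open scoped Classical in
/-- How often (counted with sign, positively in the direction of `e`) the path `γ` runs over the
point of the edge `e` with arc length coordinate `u`. -/
def pathMult {g : ℕ} (C : ℤ → ℝ) (γ : List (ℝ × ℝ)) (e : Edge g) (u : ℝ) : ℝ :=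
  ((γ.zip γ.tail).map fun s =>
    if s.1 ∈ e.seg C ∧ s.2 ∈ e.seg C then
      (Ioc (e.pos C s.1) (e.pos C s.2)).indicator (fun _ => (1 : ℝ)) u -
        (Ioc (e.pos C s.2) (e.pos C s.1)).indicator (fun _ => (1 : ℝ)) u
    else 0).sum

/-- The symmetric bilinear form `Q` on paths: the integral of the product of the multiplicities with
respect to arc length. For a path `γ` without self-intersections `Q(γ, γ)` is the length of `γ`. -/
def Q (g : ℕ) (C : ℤ → ℝ) (γ δ : List (ℝ × ℝ)) : ℝ :=
  ∑ e : Edge g, ∫ u in (0 : ℝ)..(e.weight C), pathMult C γ e u * pathMult C δ e u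

/-- The basic cycles, oriented counterclockwise; the index `i : Fin g` starts from `0`, so that
`alpha i` is the cycle between the vertical edges number `i` and `i + 1`. -/
def alpha (g : ℕ) (C : ℤ → ℝ) (i : Fin g) : List (ℝ × ℝ) :=
  [v g C i, v g C (i + 1), w g C (i + 1), w g C i, v g C i]

/-- `(Q(γ, α_1), …, Q(γ, α_g))`. -/
def Qvec (g : ℕ) (C : ℤ → ℝ) (γ : List (ℝ × ℝ)) : Fin g → ℝ := fun j => Q g C γ (alpha g C j)

/-! ### The Jacobian and the Abel–Jacobi map -/

/-- The period matrix `K_{ij} = Q(α_i, α_j)`. -/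
def K (g : ℕ) (C : ℤ → ℝ) : Matrix (Fin g) (Fin g) ℝ :=
  Matrix.of fun i j => Q g C (alpha g C i) (alpha g C j)

/-- The lattice `K ℤ^g`. -/
def lattice (g : ℕ) (C : ℤ → ℝ) : AddSubgroup (Fin g → ℝ) where
  carrier := {x | ∃ n : Fin g → ℤ, x = (K g C).mulVec (fun i => (n i : ℝ))}
  zero_mem' := ⟨0, by simp [← Pi.zero_def]⟩
  add_mem' := by
    rintro _ _ ⟨m, rfl⟩ ⟨n, rfl⟩
    exact ⟨m + n, by rw [← Matrix.mulVec_add]; congr 1; ext i; simp⟩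
  neg_mem' := by
    rintro _ ⟨n, rfl⟩
    exact ⟨-n, by rw [← Matrix.mulVec_neg]; congr 1; ext i; simp⟩

/-- The tropical Jacobian `ℝ^g / K ℤ^g`. -/
abbrev Jac (g : ℕ) (C : ℤ → ℝ) : Type := (Fin g → ℝ) ⧸ lattice g C

open scoped Classical in
/-- The Abel–Jacobi image of a point `P`: the class of `(Q(γ, α_j))_j` for a path `γ` from `P₀`
to `P`. -/
def abelJacobiPt (g : ℕ) (C : ℤ → ℝ) (P₀ P : ℝ × ℝ) : Jac g C :=
  if h : ∃ γ, IsPath g C γ P₀ P then (Qvec g C h.choose : Jac g C) else 0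

/-- The Abel–Jacobi map `η` on effective divisors, which are multisets of points. -/
def eta (g : ℕ) (C : ℤ → ℝ) (P₀ : ℝ × ℝ) (D : Multiset (ℝ × ℝ)) : Jac g C :=
  (D.map (abelJacobiPt g C P₀)).sum

/-- The effective divisors of degree `g` on `Γ`. -/
def DivEff (g : ℕ) (C : ℤ → ℝ) : Set (Multiset (ℝ × ℝ)) :=
  {D | Multiset.card D = g ∧ ∀ P ∈ D, P ∈ Gam g C}

/-- `α_{ij}`: the intersection of `α_i` and `α_j` without its end points. (The intersection is a
segment or empty, and the extreme points of a segment are its end points.) -/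
def alphaInter (g : ℕ) (C : ℤ → ℝ) (i j : Fin g) : Set (ℝ × ℝ) :=
  (pathSupport (alpha g C i) ∩ pathSupport (alpha g C j)) \
    extremePoints ℝ (pathSupport (alpha g C i) ∩ pathSupport (alpha g C j))

open scoped Classical in
/-- The set `𝓓^g(Γ)` of the effective divisors `P_1 + ⋯ + P_g` with `P_i ∈ α_i` for all `i` and with
at most one point (counted with multiplicity) on `α_{ij}` for all `i ≠ j`. -/
def DSet (g : ℕ) (C : ℤ → ℝ) : Set (Multiset (ℝ × ℝ)) :=
  {D ∈ DivEff g C |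
    (∃ P : Fin g → ℝ × ℝ, D = Finset.univ.val.map P ∧ ∀ i, P i ∈ pathSupport (alpha g C i)) ∧
    ∀ i j : Fin g, i ≠ j → Multiset.card (D.filter (· ∈ alphaInter g C i j)) ≤ 1}

/-! ### The lift of the Abel–Jacobi map along the cycles -/

/-- The cycle number `i` as a closed path from its base point, which is `v_1` for the first two
cycles (`i = 0, 1`) and `v_i` for `i ≥ 2`. -/
def basedLoop (g : ℕ) (C : ℤ → ℝ) (i : Fin g) : List (ℝ × ℝ) :=
  if (i : ℕ) = 0 then [v g C 1, w g C 1, w g C 0, v g C 0, v g C 1] else alpha g C i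

/-- `γ` is the initial part of the path `L` up to the point `P`. -/
def IsInitialArc (L γ : List (ℝ × ℝ)) (P : ℝ × ℝ) : Prop :=
  ∃ l₁ x y l₂, L = l₁ ++ x :: y :: l₂ ∧ P ∈ segment ℝ x y ∧ γ = l₁ ++ [x, P]

/-- The image in `ℝ^g` of `𝓓^g(Γ)` under `P_1 + ⋯ + P_g ↦ ∑ i, (Q(γ_i, α_j))_j`, where `γ_i` runs from
the base point of the cycle number `i` along this cycle to `P_i`. As the sum is multivalued when
some `P_i` is a vertex, the image is taken as the closure of the set of the values at the divisors
whose points are not vertices. -/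
def liftedImage (g : ℕ) (C : ℤ → ℝ) : Set (Fin g → ℝ) :=
  closure {z | ∃ (P : Fin g → ℝ × ℝ) (γ : Fin g → List (ℝ × ℝ)),
    (Finset.univ.val.map P) ∈ DSet g C ∧
    (∀ i, IsInitialArc (basedLoop g C i) (γ i) (P i)) ∧
    (∀ i, ∀ k ≤ g, P i ≠ v g C k ∧ P i ≠ w g C k) ∧
    z = ∑ i, Qvec g C (γ i)}

/-! ### Polytopes and fundamental domains -/

/-- The translate by `x` of the sum of the segments from `0` to the vectors `a i`. -/
def zonotope {n k : ℕ} (x : Fin n → ℝ) (a : Fin k → Fin n → ℝ) : Set (Fin n → ℝ) :=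
  {z | ∃ t : Fin k → ℝ, (∀ i, t i ∈ Icc (0 : ℝ) 1) ∧ z = x + ∑ i, t i • a i}

/-- A nondegenerate parallelotope (parallelogram, parallelepiped) in `ℝ^n`. -/
def IsParallelotope {n : ℕ} (R : Set (Fin n → ℝ)) : Prop :=
  ∃ (x : Fin n → ℝ) (a : Fin n → Fin n → ℝ), LinearIndependent ℝ a ∧ R = zonotope x a

/-- `V` is the union of the sets `R k`, whose interiors are pairwise disjoint. -/
def IsNonoverlappingUnion {n m : ℕ} (R : Fin m → Set (Fin n → ℝ)) (V : Set (Fin n → ℝ)) : Prop :=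
  (Pairwise fun k l => Disjoint (interior (R k)) (interior (R l))) ∧ ⋃ k, R k = V

/-- The facets of a convex polytope in `ℝ^n`: its exposed faces of dimension `n - 1`. -/
def facets {n : ℕ} (V : Set (Fin n → ℝ)) : Set (Set (Fin n → ℝ)) :=
  {F | F.Nonempty ∧ IsExposed ℝ V F ∧ Module.finrank ℝ (vectorSpan ℝ F) + 1 = n}

/-- `V` is a closed fundamental domain of `L`: its translates by `L` cover the space, and their
interiors are pairwise disjoint. -/
def IsFundDomain {n : ℕ} (L : AddSubgroup (Fin n → ℝ)) (V : Set (Fin n → ℝ)) : Prop :=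
  IsClosed V ∧ (∀ z, ∃ l ∈ L, ∃ x ∈ V, z = l + x) ∧
    ∀ l ∈ L, l ≠ 0 → Disjoint (interior V) (interior ((fun x => l + x) '' V))

/-- The hexagon for `g = 2`: the sum of three segments, in the directions of the three arcs between
the trivalent vertices `v_1` and `w_1`. -/
def hexagon (C : ℤ → ℝ) : Set (Fin 2 → ℝ) :=
  zonotope ![p 2 C 1, -2 * p 2 C 1]
    ![![C (-1) + 2 * lam 2 C 1, 0], ![p 2 C 1, -p 2 C 1], ![0, p 2 C 1]]

/-- The dodecahedron for `g = 3`: the sum of five segments. -/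
def dodecahedron (C : ℤ → ℝ) : Set (Fin 3 → ℝ) :=
  zonotope ![p 3 C 1, -p 3 C 1, 0]
    ![![C (-1) + 2 * lam 3 C 1, 0, 0], ![p 3 C 1, -p 3 C 1, 0],
      ![0, -2 * (lam 3 C 2 - lam 3 C 1), 0], ![0, -p 3 C 2, p 3 C 2], ![0, 0, p 3 C 2]]

end TropHyper

end

noncomputable section

namespace TropHyper

variable {g : ℕ} {C : ℤ → ℝ}

/-! ### The shape of the ladder -/

/-! Convexity of `C` orders the `λ_j`, so the tropical polynomial is min(2Y, Y + prof X, C_{-1})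
with prof X = Σ_{j=0}^g min(X, λ_j). As 2 prof < C_{-1} everywhere, the curve consists of the graph
of prof, its mirror image C_{-1} - prof, and the vertical segments between them at the break points
`λ_i` (`mem_tropicalCurve_iff`). Without the rays this is the ladder (`Gam_eq`).

On each edge every basic cycle has a constant multiplicity, so γ ↦ Q(γ, α_j) integrates a constant
form along each edge. These forms have a potential that is well defined modulo the lattice
(`Edge.pot_compat`); hence the class of a path depends only on its end points (`Qvec_path`).

Now unroll the cycles and let x_i be the position of P_i on the universal cover of α_i. Up to a
constant, coordinate i of the Abel–Jacobi map is x_i - covR_{i-1}(x_{i-1}) - covL_{i+1}(x_{i+1}),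
where covR and covL measure the part of the way that runs over the right or left vertical edge
(`beta_apply`); they are nondecreasing and 1-Lipschitz. For g ≤ 3 the middle position u = x_1
determines the outer ones, and a single equation Ψ(u) = z remains. The two vertical edges of the
middle cycle together take up at most the whole increment of u, so Ψ is nondecreasing, and it is
unbounded in both directions. This gives solutions. Ψ is constant only where u runs over a vertical
edge while the point of the neighbouring cycle runs over the same edge in the opposite direction
(`rigidity`). Therefore the largest solution never has two points inside a common edge
(`exists_solution`), which is surjectivity. Two solutions in 𝓓^g(Γ) differ by two points that change
places on a common edge (`loopPt_swap`), so they are the same divisor, which is injectivity.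

For the fundamental domains the cycles are cut into arcs on which the covering functions are affine.
The positions of the divisors in 𝓓^g(Γ) become a union of boxes, three for g = 2 and twelve for g =
3, and the lift is affine and injective on each. Surjectivity makes their images cover the space
modulo the lattice, and rigidity makes the interiors disjoint modulo the lattice
(`IsCellDecomp.isTiling`). If lattice translates of the tiles have the union V, then V is a
fundamental domain (`IsTiling.isFundDomain`). That the unions are the stated zonotopes is an
exchange argument along the linear relations between the generators (`iUnion_shifted_plane_tile`,
`exists_normal_form`). The facets are counted through the sign vectors of linear functionals on the
generators (`ncard_facets_zonotope`): each hyperplane spanned by generators carries two opposite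
facets. -/

theorem lam_lt_succ (hC : IsGeneric g C) {i : ℕ} (hi : i < g) : lam g C i < lam g C (i + 1) := by
  rcases i with _ | i
  · have h1 := hC.last
    have h2 := hC.normalized
    simp only [lam]
    have e : ((g : ℤ) - ((0 : ℕ) + 1) + 1) = g := by push_cast; ring
    rw [e, h2]
    rw [h2] at h1
    have e2 : ((g : ℤ) - ((0 : ℕ) + 1)) = g - 1 := by push_cast; ring
    rw [e2]
    linarith
  · have h := hC.convex ((g : ℤ) - (i + 2)) (by omega) (by omega)
    simp only [lam]
    have e1 : (g : ℤ) - (i + 2) + 2 = (g : ℤ) - (i + 1) + 1 := by ring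
    have e2 : (g : ℤ) - (i + 2) + 1 = (g : ℤ) - (i + 1) := by ring
    have e3 : (g : ℤ) - (((i + 1 : ℕ) : ℤ) + 1) = (g : ℤ) - (i + 2) := by push_cast; ring
    rw [e1, e2] at h
    rw [e3, e2]
    linarith

theorem lam_lt_lam (hC : IsGeneric g C) {i j : ℕ} (hij : i < j) (hj : j ≤ g) :
    lam g C i < lam g C j := by
  induction j with
  | zero => omega
  | succ j ih =>
    rcases Nat.lt_succ_iff_lt_or_eq.mp hij with h | rfl
    · exact (ih h (by omega)).trans (lam_lt_succ hC (by omega))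
    · exact lam_lt_succ hC (by omega)

theorem lam_le_lam (hC : IsGeneric g C) {i j : ℕ} (hij : i ≤ j) (hj : j ≤ g) :
    lam g C i ≤ lam g C j := by
  rcases hij.lt_or_eq with h | rfl
  · exact (lam_lt_lam hC h hj).le
  · exact le_rfl

theorem lam_nonneg (hC : IsGeneric g C) {i : ℕ} (hi : i ≤ g) : 0 ≤ lam g C i :=
  lam_le_lam hC (Nat.zero_le i) hi

theorem lam_injective (hC : IsGeneric g C) {i j : ℕ} (hi : i ≤ g) (hj : j ≤ g)
    (h : lam g C i = lam g C j) : i = j := by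
  rcases lt_trichotomy i j with hij | hij | hij
  · exact absurd h (lam_lt_lam hC hij hj).ne
  · exact hij
  · exact absurd h (lam_lt_lam hC hij hi).ne'

/-- The tropical polynomial of the lower boundary of the ladder. -/
def prof (g : ℕ) (C : ℤ → ℝ) (X : ℝ) : ℝ := ∑ j ∈ Finset.range (g + 1), min X (lam g C j)

theorem prof_mono {X X' : ℝ} (h : X ≤ X') : prof g C X ≤ prof g C X' :=
  Finset.sum_le_sum fun _ _ => min_le_min_right _ h

/-- The sum in `prof` has the extra term j = 0, which is min(X, 0) and vanishes at the vertices. -/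
theorem prof_lam (hC : IsGeneric g C) {i : ℕ} (hi : i ≤ g) :
    prof g C (lam g C i) = height g C i := by
  unfold prof height
  rw [Finset.range_eq_Ico, Finset.sum_eq_sum_Ico_succ_bot (by omega)]
  have h0 : min (lam g C i) (lam g C 0) = 0 := min_eq_right (lam_nonneg hC hi)
  rw [h0, zero_add]
  rfl

/-- The linear form number `k` of the tropical polynomial dominates its minimum. -/
def lin (g : ℕ) (C : ℤ → ℝ) (k : ℕ) (X : ℝ) : ℝ :=
  ∑ j ∈ Finset.range (g + 1), if j < g + 1 - k then lam g C j else X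

/-- The `λ_j` are consecutive differences of `C`, so the sum telescopes; `C_g = 0` starts it. -/
theorem sum_lam (hC : IsGeneric g C) {m : ℕ} (hm : m ≤ g) :
    ∑ j ∈ Finset.range (m + 1), lam g C j = C ((g : ℤ) - m) := by
  induction m with
  | zero => simp [lam, hC.normalized]
  | succ m ih =>
    rw [Finset.sum_range_succ, ih (by omega)]
    simp only [lam]
    have e : (g : ℤ) - (m + 1) + 1 = g - m := by ring
    rw [e]
    push_cast
    ring

theorem sum_if_lt (a : ℕ → ℝ) (X : ℝ) {m n : ℕ} (h : m ≤ n) :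
    ∑ j ∈ Finset.range n, (if j < m then a j else X) =
      ∑ j ∈ Finset.range m, a j + ((n : ℝ) - m) * X := by
  obtain ⟨d, rfl⟩ := Nat.exists_eq_add_of_le h
  rw [Finset.sum_range_add]
  congr 1
  · exact Finset.sum_congr rfl fun j hj => if_pos (Finset.mem_range.mp hj)
  · rw [Finset.sum_congr rfl (g := fun _ => X) fun j _ => if_neg (by omega)]
    simp

theorem lin_eq (hC : IsGeneric g C) {k : ℕ} (hk : k ≤ g) (X : ℝ) :
    lin g C k X = k * X + C k := by
  unfold lin
  rw [sum_if_lt _ _ (by omega)]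
  have e : g + 1 - k = (g - k) + 1 := by omega
  rw [e, sum_lam hC (by omega)]
  have e2 : (g : ℤ) - ((g - k : ℕ) : ℤ) = k := by omega
  rw [e2]
  push_cast [Nat.cast_sub hk]
  ring

theorem lin_top (X : ℝ) : lin g C (g + 1) X = ((g : ℝ) + 1) * X := by
  unfold lin
  rw [sum_if_lt _ _ (by omega)]
  simp

theorem prof_le_lin (k : ℕ) (X : ℝ) : prof g C X ≤ lin g C k X := by
  refine Finset.sum_le_sum fun j _ => ?_
  split_ifs
  · exact min_le_right _ _
  · exact min_le_left _ _

/-- Both sides are sums over the same indices with termwise inequality, so equality of the sums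
forces equality of every term. -/
theorem lin_eq_prof {k : ℕ} {X : ℝ} (h : lin g C k X = prof g C X) {j : ℕ} (hj : j ≤ g) :
    (j < g + 1 - k → lam g C j ≤ X) ∧ (¬ j < g + 1 - k → X ≤ lam g C j) := by
  have h' := (Finset.sum_eq_sum_iff_of_le (s := Finset.range (g + 1))
    (f := fun j => min X (lam g C j)) (g := fun j => if j < g + 1 - k then lam g C j else X)
    (fun j _ => by
      split_ifs
      · exact min_le_right _ _
      · exact min_le_left _ _)).mp h.symm j (Finset.mem_range.mpr (by omega))
  constructor <;> intro hj' <;> simp only [hj', if_true, if_false] at h'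
  · exact min_eq_right_iff.mp h'
  · exact min_eq_left_iff.mp h'

theorem prof_eq_lin {k : ℕ} {X : ℝ} (h1 : ∀ j ≤ g, j < g + 1 - k → lam g C j ≤ X)
    (h2 : ∀ j ≤ g, ¬ j < g + 1 - k → X ≤ lam g C j) : prof g C X = lin g C k X := by
  refine Finset.sum_congr rfl fun j hj => ?_
  have hj' : j ≤ g := by have := Finset.mem_range.mp hj; omega
  split_ifs with h
  · exact min_eq_right (h1 j hj' h)
  · exact min_eq_left (h2 j hj' h)

theorem prof_of_mem_Icc (hC : IsGeneric g C) {i : ℕ} (hi : i < g) {X : ℝ}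
    (hX : X ∈ Icc (lam g C i) (lam g C (i + 1))) :
    prof g C X = height g C i + ((g : ℝ) - i) * (X - lam g C i) := by
  have key : ∀ X ∈ Icc (lam g C i) (lam g C (i + 1)), prof g C X = lin g C (g - i) X := by
    intro X hX
    refine prof_eq_lin (fun j hj h => ?_) (fun j hj h => ?_)
    · exact (lam_le_lam hC (by omega) (by omega)).trans hX.1
    · exact hX.2.trans (lam_le_lam hC (by omega) (by omega))
  have h1 := key X hX
  have h2 := key (lam g C i) ⟨le_rfl, (lam_lt_succ hC hi).le⟩
  rw [prof_lam hC hi.le] at h2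
  rw [lin_eq hC (by omega)] at h1 h2
  rw [h1, h2]
  push_cast [Nat.cast_sub hi.le]
  ring

theorem height_succ (hC : IsGeneric g C) {i : ℕ} (hi : i < g) :
    height g C (i + 1) = height g C i + ((g : ℝ) - i) * (lam g C (i + 1) - lam g C i) := by
  rw [← prof_lam hC (i := i + 1) (by omega)]
  exact prof_of_mem_Icc hC hi ⟨(lam_lt_succ hC hi).le, le_rfl⟩

theorem prof_of_nonpos (hC : IsGeneric g C) {X : ℝ} (hX : X ≤ 0) :
    prof g C X = ((g : ℝ) + 1) * X := by
  rw [← lin_top (C := C)]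
  exact prof_eq_lin (fun j hj h => by omega) (fun j hj _ => hX.trans (lam_nonneg hC hj))

theorem prof_of_ge (hC : IsGeneric g C) {X : ℝ} (hX : lam g C g ≤ X) :
    prof g C X = height g C g := by
  rw [← prof_lam hC le_rfl]
  refine Finset.sum_congr rfl fun j hj => ?_
  have hj' : lam g C j ≤ lam g C g :=
    lam_le_lam hC (by have := Finset.mem_range.mp hj; omega) le_rfl
  rw [min_eq_right (hj'.trans hX), min_eq_right hj']

theorem prof_le_height (hC : IsGeneric g C) (X : ℝ) : prof g C X ≤ height g C g := by
  rcases le_total (lam g C g) X with h | h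
  · exact (prof_of_ge hC h).le
  · rw [← prof_lam hC le_rfl]
    exact prof_mono h

theorem prof_lt_height (hC : IsGeneric g C) {X : ℝ} (hX : X < lam g C g) :
    prof g C X < height g C g := by
  rw [← prof_lam hC le_rfl]
  refine Finset.sum_lt_sum (fun j _ => min_le_min_right _ hX.le)
    ⟨g, Finset.self_mem_range_succ g, ?_⟩
  rw [min_self, min_eq_left hX.le]
  exact hX

theorem prof_lt_of_pos {X : ℝ} (hX : 0 < X) : prof g C X < ((g : ℝ) + 1) * X := by
  have : ((g : ℝ) + 1) * X = ∑ _j ∈ Finset.range (g + 1), X := by simp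
  rw [this]
  refine Finset.sum_lt_sum (fun j _ => min_le_left _ _) ⟨0, by simp, ?_⟩
  simp [lam, hX]

theorem height_last (hC : IsGeneric g C) : height g C g = C 0 := by
  rw [← prof_lam hC le_rfl]
  unfold prof
  have : C 0 = C ((g : ℤ) - g) := by simp
  rw [this, ← sum_lam hC le_rfl]
  refine Finset.sum_congr rfl fun j hj => min_eq_right ?_
  exact lam_le_lam hC (by have := Finset.mem_range.mp hj; omega) le_rfl

/-- This is the condition C_{-1} > 2 C_0, as the lower boundary rises to C_0. It keeps the lower
boundary strictly below its mirror image. -/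
theorem two_height_lt (hC : IsGeneric g C) : 2 * height g C g < C (-1) := by
  rw [height_last hC]
  exact hC.first

theorem two_prof_lt (hC : IsGeneric g C) (X : ℝ) : 2 * prof g C X < C (-1) := by
  have := two_height_lt hC
  have := prof_le_height hC X
  linarith

theorem p_pos (hC : IsGeneric g C) {i : ℕ} (hi : i ≤ g) : 0 < p g C i := by
  have := two_prof_lt hC (lam g C i)
  rw [prof_lam hC hi] at this
  unfold p
  linarith

/-! ### The compact part of the tropical curve -/

/-- The linear forms of the tropical polynomial that involve `Y` once. -/
def Monomial.index : Monomial g → Option ℕ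
  | .ySq => none
  | .xTop => some (g + 1)
  | .mid i => some i
  | .const => none

theorem Monomial.val_of_index (hC : IsGeneric g C) (P : ℝ × ℝ) {m : Monomial g} {k : ℕ}
    (h : m.index = some k) : k ≤ g + 1 ∧ m.val C P = P.2 + lin g C k P.1 := by
  cases m with
  | ySq => simp [Monomial.index] at h
  | const => simp [Monomial.index] at h
  | xTop =>
    simp only [Monomial.index, Option.some.injEq] at h
    subst h
    rw [lin_top]
    exact ⟨le_rfl, by simp only [Monomial.val]; ring⟩
  | mid i =>
    simp only [Monomial.index, Option.some.injEq] at h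
    subst h
    have := i.2
    rw [lin_eq hC (by omega)]
    exact ⟨by omega, by simp only [Monomial.val]; ring⟩

theorem Monomial.exists_index {k : ℕ} (hk : k ≤ g + 1) : ∃ m : Monomial g, m.index = some k := by
  rcases hk.lt_or_eq with h | rfl
  · exact ⟨.mid ⟨k, h⟩, rfl⟩
  · exact ⟨.xTop, rfl⟩

theorem Monomial.index_injective {m n : Monomial g} {k : ℕ} (hm : m.index = some k)
    (hn : n.index = some k) : m = n := by
  cases m <;> cases n <;> simp_all [Monomial.index, Fin.ext_iff]
  all_goals
    rename_i a
    have := a.2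
    omega

/-- Split the indices at the first j with X < λ_j: before it the minima are the `λ_i`, from it on
they are X. This is the linear form number g + 1 - j, or the form number 0 if there is no such j. -/
theorem exists_lin_eq_prof (hC : IsGeneric g C) (X : ℝ) :
    ∃ k ≤ g + 1, lin g C k X = prof g C X := by
  by_contra! hcon
  have key : ∀ j ≤ g, lam g C j ≤ X := by
    intro j
    induction j using Nat.strong_induction_on with
    | _ j ih =>
      intro hj
      by_contra! h
      refine hcon (g + 1 - j) (by omega) (prof_eq_lin (fun i hi hij => ?_) (fun i hi hij => ?_)).symm
      · exact ih i (by omega) hi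
      · exact h.le.trans (lam_le_lam hC (by omega) hi)
  exact hcon 0 (by omega) (prof_eq_lin (fun i hi _ => key i hi) (fun i hi h => by omega)).symm

/-- Only three quantities compete: 2Y, Y + prof X and C_{-1}. A tie of the first two gives the lower
boundary, a tie of the last two the upper one, and the first and third cannot both be minimal
because 2 prof X < C_{-1}. A tie between two monomials that contain Y once means that X is a break
point of prof. -/
theorem mem_tropicalCurve_iff (hC : IsGeneric g C) (P : ℝ × ℝ) :
    P ∈ tropicalCurve g C ↔ P.2 = prof g C P.1 ∨ P.2 = C (-1) - prof g C P.1 ∨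
      ∃ i ≤ g, P.1 = lam g C i ∧ prof g C P.1 ≤ P.2 ∧ P.2 ≤ C (-1) - prof g C P.1 := by
  obtain ⟨k₀, hk₀, e₀⟩ := exists_lin_eq_prof hC P.1
  obtain ⟨m₀, hm₀⟩ := Monomial.exists_index hk₀
  have hv₀ := (Monomial.val_of_index hC P hm₀).2
  have h2 := two_prof_lt hC P.1
  have hle : ∀ k : Monomial g, min (2 * P.2) (min (P.2 + prof g C P.1) (C (-1))) ≤ k.val C P := by
    intro k
    rcases hk : k.index with _ | j
    · cases k with
      | ySq => exact min_le_left _ _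
      | const => exact (min_le_right _ _).trans (min_le_right _ _)
      | xTop => simp [Monomial.index] at hk
      | mid i => simp [Monomial.index] at hk
    · rw [(Monomial.val_of_index hC P hk).2]
      have := prof_le_lin (g := g) (C := C) j P.1
      exact (min_le_right _ _).trans ((min_le_left _ _).trans (by linarith))
  constructor
  · rintro ⟨m, n, hmn, heq, hmin⟩
    have hy : m.val C P ≤ 2 * P.2 := hmin .ySq
    have hc : m.val C P ≤ C (-1) := hmin .const
    have h0 : m.val C P ≤ P.2 + prof g C P.1 := by
      have := hmin m₀
      rwa [hv₀, e₀] at this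
    rcases hm : m.index with _ | j <;> rcases hn : n.index with _ | j'
    · cases m <;> cases n <;> simp_all [Monomial.index, Monomial.val] <;> linarith
    · have hn' := (Monomial.val_of_index hC P hn).2
      have := prof_le_lin (g := g) (C := C) j' P.1
      cases m with
      | ySq =>
        left
        simp only [Monomial.val] at *
        linarith
      | const =>
        right; left
        simp only [Monomial.val] at *
        linarith
      | xTop => simp [Monomial.index] at hm
      | mid i => simp [Monomial.index] at hm
    · have hm' := (Monomial.val_of_index hC P hm).2
      have := prof_le_lin (g := g) (C := C) j P.1
      cases n with
      | ySq =>
        left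
        simp only [Monomial.val] at *
        linarith
      | const =>
        right; left
        simp only [Monomial.val] at *
        linarith
      | xTop => simp [Monomial.index] at hn
      | mid i => simp [Monomial.index] at hn
    · obtain ⟨hj, hm'⟩ := Monomial.val_of_index hC P hm
      obtain ⟨hj', hn'⟩ := Monomial.val_of_index hC P hn
      have l1 := prof_le_lin (g := g) (C := C) j P.1
      have l2 := prof_le_lin (g := g) (C := C) j' P.1
      have q1 : lin g C j P.1 = prof g C P.1 := by linarith
      have q2 : lin g C j' P.1 = prof g C P.1 := by linarith
      have hjj : j ≠ j' := by
        rintro rfl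
        exact hmn (Monomial.index_injective hm hn)
      right; right
      rcases hjj.lt_or_gt with h | h
      -- The form with the smaller index j uses λ_{g-j} where the form j' uses X, so both can equal
      -- prof only if λ_{g-j} = X.
      · refine ⟨g - j, by omega, le_antisymm ?_ ?_, by linarith, by linarith⟩
        · exact (lin_eq_prof q2 (j := g - j) (by omega)).2 (by omega)
        · exact (lin_eq_prof q1 (j := g - j) (by omega)).1 (by omega)
      · refine ⟨g - j', by omega, le_antisymm ?_ ?_, by linarith, by linarith⟩
        · exact (lin_eq_prof q1 (j := g - j') (by omega)).2 (by omega)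
        · exact (lin_eq_prof q2 (j := g - j') (by omega)).1 (by omega)
  · rintro (h | h | ⟨i, hi, hX, h1, h3⟩)
    · refine ⟨.ySq, m₀, ?_, ?_, fun k => le_trans ?_ (hle k)⟩
      · rintro rfl
        simp [Monomial.index] at hm₀
      · rw [hv₀, e₀]
        simp only [Monomial.val]
        linarith
      · simp only [Monomial.val]
        exact le_min le_rfl (le_min (by linarith) (by linarith))
    · refine ⟨.const, m₀, ?_, ?_, fun k => le_trans ?_ (hle k)⟩
      · rintro rfl
        simp [Monomial.index] at hm₀
      · rw [hv₀, e₀]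
        simp only [Monomial.val]
        linarith
      · simp only [Monomial.val]
        exact le_min (by linarith) (le_min (by linarith) (by linarith))
    · obtain ⟨m, hm⟩ := Monomial.exists_index (g := g) (k := g - i) (by omega)
      obtain ⟨n, hn⟩ := Monomial.exists_index (g := g) (k := g - i + 1) (by omega)
      have hm' := (Monomial.val_of_index hC P hm).2
      have hn' := (Monomial.val_of_index hC P hn).2
      have q1 : prof g C P.1 = lin g C (g - i) P.1 := by
        refine prof_eq_lin (fun j hj h => ?_) (fun j hj h => ?_)
        · rw [hX]
          exact lam_le_lam hC (by omega) hi
        · rw [hX]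
          exact lam_le_lam hC (by omega) hj
      have q2 : prof g C P.1 = lin g C (g - i + 1) P.1 := by
        refine prof_eq_lin (fun j hj h => ?_) (fun j hj h => ?_)
        · rw [hX]
          exact lam_le_lam hC (by omega) hi
        · rw [hX]
          exact lam_le_lam hC (by omega) hj
      refine ⟨m, n, ?_, ?_, fun k => le_trans ?_ (hle k)⟩
      · rintro rfl
        rw [hm] at hn
        simp at hn
      · rw [hm', hn', ← q1, ← q2]
      · rw [hm', ← q1]
        exact le_min (by linarith) (le_min le_rfl (by linarith))

end TropHyper
end

noncomputable section

namespace TropHyper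

variable {g : ℕ} {C : ℤ → ℝ}

/-! ### Arc length coordinates on the edges -/

/-- The length of an edge. -/
def Edge.len (C : ℤ → ℝ) : Edge g → ℝ
  | .inl i => p g C i
  | .inr (.inl i) => lam g C (i + 1) - lam g C i
  | .inr (.inr i) => lam g C (i + 1) - lam g C i

/-- The point of an edge with arc length coordinate `t`. -/
def Edge.pt (C : ℤ → ℝ) (e : Edge g) (t : ℝ) : ℝ × ℝ := e.src C + t • e.prim

theorem Edge.len_pos (hC : IsGeneric g C) (e : Edge g) : 0 < e.len C := by
  rcases e with i | i | i
  · exact p_pos hC (by omega)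
  · exact sub_pos.mpr (lam_lt_succ hC i.2)
  · exact sub_pos.mpr (lam_lt_succ hC i.2)

theorem Edge.tgt_eq (hC : IsGeneric g C) (e : Edge g) : e.tgt C = e.pt C (e.len C) := by
  rcases e with i | i | i
  · simp [Edge.tgt, Edge.pt, Edge.src, Edge.prim, Edge.len, v, w, p, Prod.ext_iff]
    ring
  · have := height_succ hC i.2
    simp [Edge.tgt, Edge.pt, Edge.src, Edge.prim, Edge.len, v, Prod.ext_iff]
    linarith
  · have := height_succ hC i.2
    simp [Edge.tgt, Edge.pt, Edge.src, Edge.prim, Edge.len, w, Prod.ext_iff]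
    linarith

theorem Edge.pt_zero (e : Edge g) : e.pt C 0 = e.src C := by simp [Edge.pt]

theorem Edge.seg_eq (hC : IsGeneric g C) (e : Edge g) :
    e.seg C = e.pt C '' Icc 0 (e.len C) := by
  have hl := e.len_pos hC
  unfold Edge.seg
  rw [segment_eq_image', e.tgt_eq hC]
  ext P
  constructor
  · rintro ⟨θ, hθ, rfl⟩
    refine ⟨θ * e.len C, ⟨mul_nonneg hθ.1 hl.le, ?_⟩, ?_⟩
    · nlinarith [hθ.2]
    · simp [Edge.pt, mul_smul]
  · rintro ⟨t, ht, rfl⟩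
    refine ⟨t / e.len C, ⟨div_nonneg ht.1 hl.le, (div_le_one hl).mpr ht.2⟩, ?_⟩
    simp only [Edge.pt, add_sub_cancel_left, smul_smul]
    rw [div_mul_cancel₀ _ hl.ne']

theorem Edge.pt_mem_seg (hC : IsGeneric g C) (e : Edge g) {t : ℝ} (ht : t ∈ Icc 0 (e.len C)) :
    e.pt C t ∈ e.seg C := by
  rw [e.seg_eq hC]
  exact ⟨t, ht, rfl⟩

theorem Edge.norm_prim_pos (e : Edge g) : 0 < ‖e.prim‖ := by
  rw [norm_pos_iff]
  rcases e with i | i | i <;> simp [Edge.prim, Prod.ext_iff]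

theorem Edge.pos_pt (e : Edge g) {t : ℝ} (ht : 0 ≤ t) : e.pos C (e.pt C t) = t := by
  unfold Edge.pos Edge.pt
  rw [add_sub_cancel_left, norm_smul, Real.norm_of_nonneg ht, mul_div_assoc,
    div_self e.norm_prim_pos.ne', mul_one]

theorem Edge.weight_eq (hC : IsGeneric g C) (e : Edge g) : e.weight C = e.len C := by
  have := e.pos_pt (C := C) (e.len_pos hC).le
  rwa [← e.tgt_eq hC] at this

theorem pt_vert (i : Fin (g + 1)) (t : ℝ) :
    Edge.pt C (.inl i : Edge g) t = (lam g C i, height g C i + t) := by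
  simp [Edge.pt, Edge.src, Edge.prim, v]

theorem pt_lower (hC : IsGeneric g C) (i : Fin g) {t : ℝ}
    (ht : t ∈ Icc 0 (lam g C (i + 1) - lam g C i)) :
    Edge.pt C (.inr (.inl i) : Edge g) t = (lam g C i + t, prof g C (lam g C i + t)) := by
  rw [prof_of_mem_Icc hC i.2 ⟨by linarith [ht.1], by linarith [ht.2]⟩]
  simp [Edge.pt, Edge.src, Edge.prim, v]
  ring

theorem pt_upper (hC : IsGeneric g C) (i : Fin g) {t : ℝ}
    (ht : t ∈ Icc 0 (lam g C (i + 1) - lam g C i)) :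
    Edge.pt C (.inr (.inr i) : Edge g) t =
      (lam g C i + t, C (-1) - prof g C (lam g C i + t)) := by
  rw [prof_of_mem_Icc hC i.2 ⟨by linarith [ht.1], by linarith [ht.2]⟩]
  simp [Edge.pt, Edge.src, Edge.prim, w]
  ring

theorem mem_seg_vert (hC : IsGeneric g C) (i : Fin (g + 1)) (P : ℝ × ℝ) :
    P ∈ Edge.seg C (.inl i : Edge g) ↔ P.1 = lam g C i ∧ height g C i ≤ P.2 ∧
      P.2 ≤ C (-1) - height g C i := by
  rw [Edge.seg_eq hC]
  constructor
  · rintro ⟨t, ht, rfl⟩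
    rw [pt_vert]
    have h1 := ht.1
    have h2 := ht.2
    simp only [Edge.len, p] at h2
    exact ⟨rfl, by simp only; linarith, by simp only; linarith⟩
  · rintro ⟨h1, h2, h3⟩
    refine ⟨P.2 - height g C i, ⟨by linarith, by simp only [Edge.len, p]; linarith⟩, ?_⟩
    rw [pt_vert, ← h1]
    simp

theorem mem_seg_lower (hC : IsGeneric g C) (i : Fin g) (P : ℝ × ℝ) :
    P ∈ Edge.seg C (.inr (.inl i) : Edge g) ↔ P.1 ∈ Icc (lam g C i) (lam g C (i + 1)) ∧
      P.2 = prof g C P.1 := by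
  rw [Edge.seg_eq hC]
  constructor
  · rintro ⟨t, ht, rfl⟩
    rw [pt_lower hC i ht]
    exact ⟨⟨by simp only; linarith [ht.1], by have := ht.2; simp only [Edge.len] at *; linarith⟩, rfl⟩
  · rintro ⟨h1, h2⟩
    have ht : P.1 - lam g C i ∈ Icc 0 (lam g C (i + 1) - lam g C i) :=
      ⟨by linarith [h1.1], by linarith [h1.2]⟩
    refine ⟨P.1 - lam g C i, ht, ?_⟩
    rw [pt_lower hC i ht]
    simp [Prod.ext_iff, h2]

theorem mem_seg_upper (hC : IsGeneric g C) (i : Fin g) (P : ℝ × ℝ) :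
    P ∈ Edge.seg C (.inr (.inr i) : Edge g) ↔ P.1 ∈ Icc (lam g C i) (lam g C (i + 1)) ∧
      P.2 = C (-1) - prof g C P.1 := by
  rw [Edge.seg_eq hC]
  constructor
  · rintro ⟨t, ht, rfl⟩
    rw [pt_upper hC i ht]
    exact ⟨⟨by simp only; linarith [ht.1], by have := ht.2; simp only [Edge.len] at *; linarith⟩, rfl⟩
  · rintro ⟨h1, h2⟩
    have ht : P.1 - lam g C i ∈ Icc 0 (lam g C (i + 1) - lam g C i) :=
      ⟨by linarith [h1.1], by linarith [h1.2]⟩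
    refine ⟨P.1 - lam g C i, ht, ?_⟩
    rw [pt_upper hC i ht]
    simp [Prod.ext_iff, h2]

/-- Two different edges have at most one point in common. -/
theorem eq_of_mem_seg (hC : IsGeneric g C) {e e' : Edge g} (hne : e ≠ e') {P P' : ℝ × ℝ}
    (h1 : P ∈ e.seg C) (h2 : P' ∈ e.seg C) (h1' : P ∈ e'.seg C) (h2' : P' ∈ e'.seg C) :
    P = P' := by
  have aux : ∀ i j : Fin g, i < j → P.1 ∈ Icc (lam g C i) (lam g C (i + 1)) →
      P'.1 ∈ Icc (lam g C i) (lam g C (i + 1)) → P.1 ∈ Icc (lam g C j) (lam g C (j + 1)) →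
      P'.1 ∈ Icc (lam g C j) (lam g C (j + 1)) → P.1 = P'.1 := by
    intro i j hij a b c d
    have := lam_le_lam hC (i := i + 1) (j := j) (by have : (i : ℕ) < j := hij; omega) (by omega)
    linarith [a.2, b.2, c.1, d.1]
  have hp := two_prof_lt hC P.1
  rcases e with i | i | i <;> rcases e' with j | j | j <;>
    simp only [mem_seg_vert hC, mem_seg_lower hC, mem_seg_upper hC] at h1 h2 h1' h2'
  · exfalso
    refine hne (congrArg _ (Fin.ext (lam_injective hC (by omega) (by omega) ?_)))
    rw [← h1.1, ← h1'.1]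
  · have hX : P.1 = P'.1 := h1.1.trans h2.1.symm
    exact Prod.ext hX (by rw [h1'.2, h2'.2, hX])
  · have hX : P.1 = P'.1 := h1.1.trans h2.1.symm
    exact Prod.ext hX (by rw [h1'.2, h2'.2, hX])
  · have hX : P.1 = P'.1 := h1'.1.trans h2'.1.symm
    exact Prod.ext hX (by rw [h1.2, h2.2, hX])
  · have hX : P.1 = P'.1 := by
      have hij : i ≠ j := by rintro rfl; exact hne rfl
      rcases hij.lt_or_gt with h | h
      · exact aux i j h h1.1 h2.1 h1'.1 h2'.1
      · exact aux j i h h1'.1 h2'.1 h1.1 h2.1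
    exact Prod.ext hX (by rw [h1.2, h2.2, hX])
  · linarith [h1.2, h1'.2]
  · have hX : P.1 = P'.1 := h1'.1.trans h2'.1.symm
    exact Prod.ext hX (by rw [h1.2, h2.2, hX])
  · linarith [h1.2, h1'.2]
  · have hX : P.1 = P'.1 := by
      have hij : i ≠ j := by rintro rfl; exact hne rfl
      rcases hij.lt_or_gt with h | h
      · exact aux i j h h1.1 h2.1 h1'.1 h2'.1
      · exact aux j i h h1'.1 h2'.1 h1.1 h2.1
    exact Prod.ext hX (by rw [h1.2, h2.2, hX])

/-! ### The infinite edges, and the compact part as the union of the bounded edges. -/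

theorem exists_lam_le_lt {X : ℝ} (h0 : 0 ≤ X) (hX : X < lam g C g) :
    ∃ i < g, lam g C i ≤ X ∧ X < lam g C (i + 1) := by
  by_contra! hcon
  have key : ∀ j ≤ g, lam g C j ≤ X := by
    intro j
    induction j with
    | zero => intro _; exact h0
    | succ j ih => intro hj; exact hcon j (by omega) (ih (by omega))
  exact absurd (key g le_rfl) (not_le.mpr hX)

theorem exists_lam_lt_le {X : ℝ} (h0 : 0 < X) (hX : X ≤ lam g C g) :
    ∃ i < g, lam g C i < X ∧ X ≤ lam g C (i + 1) := by
  by_contra! hcon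
  have key : ∀ j ≤ g, lam g C j < X := by
    intro j
    induction j with
    | zero => intro _; exact h0
    | succ j ih => intro hj; exact hcon j (by omega) (ih (by omega))
  exact absurd (key g le_rfl) (not_lt.mpr hX)

theorem ne_lam_of_mem_Ioo (hC : IsGeneric g C) {i : ℕ} (hi : i < g) {X : ℝ}
    (hX : X ∈ Ioo (lam g C i) (lam g C (i + 1))) {j : ℕ} (hj : j ≤ g) : X ≠ lam g C j := by
  rintro rfl
  rcases Nat.lt_or_ge i j with h | h
  · exact absurd hX.2 (not_lt.mpr (lam_le_lam hC h hj))
  · exact absurd hX.1 (not_lt.mpr (lam_le_lam hC h hi.le))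

theorem tropicalCurve_of_mem_Ioo (hC : IsGeneric g C) {i : ℕ} (hi : i < g) {P : ℝ × ℝ}
    (hX : P.1 ∈ Ioo (lam g C i) (lam g C (i + 1))) (hP : P ∈ tropicalCurve g C) :
    P.2 = prof g C P.1 ∨ P.2 = C (-1) - prof g C P.1 := by
  rcases (mem_tropicalCurve_iff hC P).mp hP with h | h | ⟨j, hj, h, -⟩
  · exact .inl h
  · exact .inr h
  · exact absurd h (ne_lam_of_mem_Ioo hC hi hX hj)

theorem le_of_mem_tropicalCurve (hC : IsGeneric g C) {P : ℝ × ℝ} (hP : P ∈ tropicalCurve g C) :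
    prof g C P.1 ≤ P.2 ∧ P.2 ≤ C (-1) - prof g C P.1 := by
  have := two_prof_lt hC P.1
  rcases (mem_tropicalCurve_iff hC P).mp hP with h | h | ⟨j, hj, h, h'⟩
  · constructor <;> linarith
  · constructor <;> linarith
  · exact h'

/-- If at all large times one of two affine functions vanishes, then one of them is zero. -/
theorem affine_eq_zero_or {a b c d T : ℝ} (h : ∀ t ≥ T, a + t * b = 0 ∨ c + t * d = 0) :
    (∀ t, a + t * b = 0) ∨ ∀ t, c + t * d = 0 := by
  have two : ∀ a b s t : ℝ, s ≠ t → a + s * b = 0 → a + t * b = 0 → ∀ r, a + r * b = 0 := by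
    intro a b s t hst h1 h2 r
    have : (s - t) * b = 0 := by linarith
    have hb : b = 0 := (mul_eq_zero.mp this).resolve_left (sub_ne_zero.mpr hst)
    subst hb
    linarith
  rcases h T le_rfl with h0 | h0 <;> rcases h (T + 1) (by linarith) with h1 | h1 <;>
    rcases h (T + 2) (by linarith) with h2 | h2
  · exact .inl (two a b _ _ (by linarith : T < T + 1).ne h0 h1)
  · exact .inl (two a b _ _ (by linarith : T < T + 1).ne h0 h1)
  · exact .inl (two a b _ _ (by linarith : T < T + 2).ne h0 h2)
  · exact .inr (two c d _ _ (by linarith : T + 1 < T + 2).ne h1 h2)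
  · exact .inl (two a b _ _ (by linarith : T + 1 < T + 2).ne h1 h2)
  · exact .inr (two c d _ _ (by linarith : T < T + 2).ne h0 h2)
  · exact .inr (two c d _ _ (by linarith : T < T + 1).ne h0 h1)
  · exact .inr (two c d _ _ (by linarith : T < T + 1).ne h0 h1)

/-- Points of the ladder that are not on an unbounded edge: the interior of a vertical edge, or
strictly between the first and the last vertical edge. -/
theorem not_onInfiniteEdge (hC : IsGeneric g C) {P : ℝ × ℝ} (h0 : 0 ≤ P.1)
    (hg : P.1 ≤ lam g C g)
    (hP : (0 < P.1 ∧ P.1 < lam g C g) ∨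
      (prof g C P.1 < P.2 ∧ P.2 < C (-1) - prof g C P.1)) :
    ¬ OnInfiniteEdge g C P := by
  rintro ⟨d, hd, hray⟩
  have hfst : ∀ t : ℝ, (P + t • d).1 = P.1 + t * d.1 := fun t => by simp
  have hsnd : ∀ t : ℝ, (P + t • d).2 = P.2 + t * d.2 := fun t => by simp
  have hbot := two_height_lt hC
  rcases lt_trichotomy d.1 0 with hd1 | hd1 | hd1
  · have hneg : 0 < -d.1 := by linarith
    -- A ray to the left finally reaches X < 0, where only the two lines Y = (g+1)X and Y = C_{-1} -
    -- (g+1)X remain. So the whole ray lies on one of them.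
    have hlines := affine_eq_zero_or (a := P.2 - (g + 1) * P.1) (b := d.2 - (g + 1) * d.1)
      (c := P.2 + (g + 1) * P.1 - C (-1)) (d := d.2 + (g + 1) * d.1) (T := P.1 / (-d.1) + 1)
      (fun t ht => by
        have hdiv : 0 ≤ P.1 / (-d.1) := div_nonneg h0 hneg.le
        have hX : P.1 + t * d.1 < 0 := by
          have : P.1 / (-d.1) < t := by linarith
          rw [div_lt_iff₀ hneg] at this
          linarith
        have hpr := prof_of_nonpos hC hX.le
        rcases (mem_tropicalCurve_iff hC _).mp (hray t (by linarith)) with h | h | ⟨i, hi, hl, -⟩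
        · left
          rw [hfst, hsnd, hpr] at h
          linarith
        · right
          rw [hfst, hsnd, hpr] at h
          linarith
        · rw [hfst] at hl
          have := lam_nonneg hC hi
          linarith)
    have hpos : 0 < P.1 := by
      rcases hP with hP | hP
      · exact hP.1
      · refine lt_of_le_of_ne h0 fun hz => ?_
        rw [prof_of_nonpos hC hz.symm.le, ← hz] at hP
        rcases hlines with h | h <;> have := h 0 <;> rw [← hz] at this <;> linarith [hP.1, hP.2]
    obtain ⟨k, hk, hk1, hk2⟩ := exists_lam_lt_le hpos hg
    have hk0 := lam_nonneg hC hk.le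
    -- Going back to X > 0, the line Y = (g+1)X is strictly above prof, so it can meet the curve
    -- between two vertical edges only in the other boundary; by symmetry the second line gives the
    -- same equation. Its left side is strictly increasing in X, so it cannot hold at two points.
    have key : ∀ θ ∈ Ioo (0 : ℝ) 1, ∀ X, X = P.1 - θ * (P.1 - lam g C k) →
        (g + 1) * X + prof g C X = C (-1) := by
      intro θ hθ X hXdef
      have ht : 0 ≤ θ * (P.1 - lam g C k) / (-d.1) :=
        div_nonneg (mul_nonneg hθ.1.le (by linarith)) hneg.le
      set t := θ * (P.1 - lam g C k) / (-d.1) with htdef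
      have htd : t * d.1 = -(θ * (P.1 - lam g C k)) := by
        have := div_mul_cancel₀ (θ * (P.1 - lam g C k)) hneg.ne'
        rw [← htdef] at this
        linarith
      have hX : P.1 + t * d.1 = X := by rw [htd, hXdef]; ring
      have hX1 : lam g C k < X := by rw [hXdef]; nlinarith [hθ.2]
      have hX2 : X < lam g C (k + 1) := by rw [hXdef]; nlinarith [hθ.1]
      have hcur := tropicalCurve_of_mem_Ioo hC hk (P := P + t • d)
        (by rw [hfst, hX]; exact ⟨hX1, hX2⟩) (hray t ht)
      rw [hfst, hsnd, hX] at hcur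
      have hlt := prof_lt_of_pos (g := g) (C := C) (hk0.trans_lt hX1)
      rcases hlines with h | h <;> have ht' := h t
      · have e : P.2 + t * d.2 = (g + 1) * X := by rw [← hX]; linarith
        rcases hcur with h' | h' <;> linarith
      · have e : P.2 + t * d.2 = C (-1) - (g + 1) * X := by rw [← hX]; linarith
        rcases hcur with h' | h' <;> linarith
    have h1 := key (1 / 3) ⟨by norm_num, by norm_num⟩ _ rfl
    have h2 := key (2 / 3) ⟨by norm_num, by norm_num⟩ _ rfl
    have hlt : P.1 - 2 / 3 * (P.1 - lam g C k) < P.1 - 1 / 3 * (P.1 - lam g C k) := by linarith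
    have hm := prof_mono (g := g) (C := C) hlt.le
    have hg0 : (0 : ℝ) ≤ g := Nat.cast_nonneg g
    nlinarith
  · have hd2 : d.2 ≠ 0 := fun h => hd (Prod.ext hd1 h)
    have hb : ∀ t ≥ 0, prof g C P.1 ≤ P.2 + t * d.2 ∧ P.2 + t * d.2 ≤ C (-1) - prof g C P.1 := by
      intro t ht
      have := le_of_mem_tropicalCurve hC (hray t ht)
      rwa [hfst, hsnd, hd1, mul_zero, add_zero] at this
    have hw := two_prof_lt hC P.1
    -- W exceeds the distance between the two boundaries, so a vertical ray that has moved by W has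
    -- left the curve.
    set W := C (-1) - 2 * prof g C P.1 + 1 with hW
    have hT : 0 ≤ W / |d.2| := div_nonneg (by linarith) (abs_nonneg _)
    have h1 := hb 0 le_rfl
    have h2 := hb _ hT
    have e : W / |d.2| * |d.2| = W := div_mul_cancel₀ _ (abs_pos.mpr hd2).ne'
    rcases abs_cases d.2 with ⟨h, -⟩ | ⟨h, -⟩
    · have e' : W / |d.2| * d.2 = W := by rwa [h] at e ⊢
      linarith [h1.1, h2.2]
    · have e' : W / |d.2| * d.2 = -W := by rw [h] at e ⊢; linarith
      linarith [h1.2, h2.1]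
  · have hlines := affine_eq_zero_or (a := P.2 - height g C g) (b := d.2)
      (c := P.2 - (C (-1) - height g C g)) (d := d.2) (T := (lam g C g - P.1) / d.1 + 1)
      (fun t ht => by
        have hdiv : 0 ≤ (lam g C g - P.1) / d.1 := div_nonneg (by linarith) hd1.le
        have hX : lam g C g < P.1 + t * d.1 := by
          have : (lam g C g - P.1) / d.1 < t := by linarith
          rw [div_lt_iff₀ hd1] at this
          linarith
        have hpr := prof_of_ge hC hX.le
        rcases (mem_tropicalCurve_iff hC _).mp (hray t (by linarith)) with h | h | ⟨i, hi, hl, -⟩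
        · left
          rw [hfst, hsnd, hpr] at h
          linarith
        · right
          rw [hfst, hsnd, hpr] at h
          linarith
        · rw [hfst] at hl
          have := lam_le_lam hC hi le_rfl
          linarith)
    have hlt : P.1 < lam g C g := by
      rcases hP with hP | hP
      · exact hP.2
      · refine lt_of_le_of_ne hg fun hz => ?_
        rw [prof_of_ge hC hz.symm.le] at hP
        rcases hlines with h | h <;> have := h 0 <;> linarith [hP.1, hP.2]
    obtain ⟨k, hk, hk1, hk2⟩ := exists_lam_le_lt h0 hlt
    have ht : 0 ≤ (lam g C (k + 1) - P.1) / 2 / d.1 := div_nonneg (by linarith) hd1.le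
    have htd : (lam g C (k + 1) - P.1) / 2 / d.1 * d.1 = (lam g C (k + 1) - P.1) / 2 :=
      div_mul_cancel₀ _ hd1.ne'
    have hle := lam_le_lam hC (i := k + 1) hk le_rfl
    have hcur := tropicalCurve_of_mem_Ioo hC hk (by
      rw [hfst, htd]
      exact ⟨by linarith, by linarith⟩) (hray _ ht)
    have hlt' := prof_lt_height hC
      (X := P.1 + (lam g C (k + 1) - P.1) / 2 / d.1 * d.1) (by rw [htd]; linarith)
    rw [hfst, hsnd] at hcur
    rcases hlines with h | h <;> have h' := h ((lam g C (k + 1) - P.1) / 2 / d.1) <;>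
      rcases hcur with h'' | h'' <;> linarith

theorem onInfiniteEdge_left (hC : IsGeneric g C) {P : ℝ × ℝ} (hX : P.1 ≤ 0)
    (hP : P.2 = prof g C P.1 ∨ P.2 = C (-1) - prof g C P.1) : OnInfiniteEdge g C P := by
  have hle : ∀ t : ℝ, 0 ≤ t → P.1 + -t ≤ 0 := fun t ht => by linarith
  rcases hP with h | h <;> rw [prof_of_nonpos hC hX] at h
  · refine ⟨(-1, -(g + 1)), by simp, fun t ht => (mem_tropicalCurve_iff hC _).mpr (.inl ?_)⟩
    simp only [Prod.fst_add, Prod.snd_add, Prod.smul_fst, Prod.smul_snd, smul_eq_mul, mul_neg,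
      mul_one]
    rw [prof_of_nonpos hC (hle t ht), h]
    ring
  · refine ⟨(-1, g + 1), by simp, fun t ht => (mem_tropicalCurve_iff hC _).mpr (.inr (.inl ?_))⟩
    simp only [Prod.fst_add, Prod.snd_add, Prod.smul_fst, Prod.smul_snd, smul_eq_mul, mul_neg,
      mul_one]
    rw [prof_of_nonpos hC (hle t ht), h]
    ring

theorem onInfiniteEdge_right (hC : IsGeneric g C) {P : ℝ × ℝ} (hX : lam g C g ≤ P.1)
    (hP : P.2 = prof g C P.1 ∨ P.2 = C (-1) - prof g C P.1) : OnInfiniteEdge g C P := by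
  refine ⟨(1, 0), by simp, fun t ht => (mem_tropicalCurve_iff hC _).mpr ?_⟩
  rw [← or_assoc]
  left
  simp only [Prod.fst_add, Prod.snd_add, Prod.smul_fst, Prod.smul_snd, smul_eq_mul, mul_one,
    mul_zero, add_zero]
  rw [prof_of_ge hC (by linarith)]
  rwa [prof_of_ge hC hX] at hP

theorem isClosed_iUnion_seg : IsClosed (⋃ e : Edge g, e.seg C) :=
  isClosed_iUnion_of_finite fun e => by
    unfold Edge.seg
    rw [← convexHull_pair]
    exact ((Set.toFinite _).isCompact_convexHull ℝ).isClosed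

/-- Points of the open edges start no ray inside the curve, and taking the closure adds the
vertices. Conversely, a point of the curve outside the ladder lies on a boundary branch at X < 0 or
X > λ_g, and there the branch itself continues as a ray. -/
theorem Gam_eq (hC : IsGeneric g C) : Gam g C = ⋃ e : Edge g, e.seg C := by
  apply Subset.antisymm
  · refine closure_minimal ?_ isClosed_iUnion_seg
    rintro P ⟨hP, hinf⟩
    rw [mem_iUnion]
    rcases (mem_tropicalCurve_iff hC P).mp hP with h | h | ⟨i, hi, hX, h1, h2⟩
    · have h0 : 0 ≤ P.1 := by
        by_contra! hneg
        exact hinf (onInfiniteEdge_left hC hneg.le (.inl h))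
      have hlt : P.1 < lam g C g := by
        by_contra! hneg
        exact hinf (onInfiniteEdge_right hC hneg (.inl h))
      obtain ⟨k, hk, hk1, hk2⟩ := exists_lam_le_lt h0 hlt
      exact ⟨.inr (.inl ⟨k, hk⟩), (mem_seg_lower hC _ _).mpr ⟨⟨hk1, hk2.le⟩, h⟩⟩
    · have h0 : 0 ≤ P.1 := by
        by_contra! hneg
        exact hinf (onInfiniteEdge_left hC hneg.le (.inr h))
      have hlt : P.1 < lam g C g := by
        by_contra! hneg
        exact hinf (onInfiniteEdge_right hC hneg (.inr h))
      obtain ⟨k, hk, hk1, hk2⟩ := exists_lam_le_lt h0 hlt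
      exact ⟨.inr (.inr ⟨k, hk⟩), (mem_seg_upper hC _ _).mpr ⟨⟨hk1, hk2.le⟩, h⟩⟩
    · rw [hX, prof_lam hC hi] at h1 h2
      exact ⟨.inl ⟨i, by omega⟩, (mem_seg_vert hC _ _).mpr ⟨hX, h1, h2⟩⟩
  · refine iUnion_subset fun e => ?_
    refine (segment_subset_closure_openSegment).trans (closure_mono ?_)
    intro P hP
    have hPe : ∃ t ∈ Ioo 0 (e.len C), P = e.pt C t := by
      rw [openSegment_eq_image'] at hP
      obtain ⟨θ, hθ, rfl⟩ := hP
      have hl := e.len_pos hC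
      refine ⟨θ * e.len C, ⟨mul_pos hθ.1 hl, by nlinarith [hθ.2]⟩, ?_⟩
      rw [e.tgt_eq hC]
      simp [Edge.pt, mul_smul]
    obtain ⟨t, ht, rfl⟩ := hPe
    rcases e with i | i | i
    · have ht2 := ht.2
      simp only [Edge.len, p] at ht2
      have hi : (i : ℕ) ≤ g := by omega
      rw [pt_vert]
      constructor
      · refine (mem_tropicalCurve_iff hC _).mpr (.inr (.inr ⟨i, hi, rfl, ?_⟩))
        simp only [prof_lam hC hi]
        exact ⟨by linarith [ht.1], by linarith⟩
      · refine not_onInfiniteEdge hC (lam_nonneg hC hi) (lam_le_lam hC hi le_rfl) (.inr ?_)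
        simp only [prof_lam hC hi]
        exact ⟨by linarith [ht.1], by linarith⟩
    · have ht2 := ht.2
      simp only [Edge.len] at ht2
      have h1 := lam_nonneg hC i.2.le
      have h2 := lam_le_lam hC (i := i + 1) (j := g) (by omega) le_rfl
      rw [pt_lower hC i ⟨ht.1.le, ht2.le⟩]
      refine ⟨(mem_tropicalCurve_iff hC _).mpr (.inl rfl), ?_⟩
      refine not_onInfiniteEdge hC ?_ ?_ (.inl ⟨?_, ?_⟩) <;> simp only <;> linarith [ht.1]
    · have ht2 := ht.2
      simp only [Edge.len] at ht2
      have h1 := lam_nonneg hC i.2.le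
      have h2 := lam_le_lam hC (i := i + 1) (j := g) (by omega) le_rfl
      rw [pt_upper hC i ⟨ht.1.le, ht2.le⟩]
      refine ⟨(mem_tropicalCurve_iff hC _).mpr (.inr (.inl rfl)), ?_⟩
      refine not_onInfiniteEdge hC ?_ ?_ (.inl ⟨?_, ?_⟩) <;> simp only <;> linarith [ht.1]

end TropHyper
end

noncomputable section

namespace TropHyper

variable {g : ℕ} {C : ℤ → ℝ}

/-! ### The bilinear form on paths -/

/-- The multiplicities of the basic cycles on an edge. -/
def Edge.dir : Edge g → Fin g → ℝ
  | .inl i, j => (if (i : ℕ) = j + 1 then 1 else 0) - (if (i : ℕ) = j then 1 else 0)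
  | .inr (.inl i), j => if i = j then 1 else 0
  | .inr (.inr i), j => -(if i = j then 1 else 0)

open scoped Classical in
/-- The contribution of a single step to the multiplicity of a path. -/
def stepMult (C : ℤ → ℝ) (a b : ℝ × ℝ) (e : Edge g) (u : ℝ) : ℝ :=
  if a ∈ e.seg C ∧ b ∈ e.seg C then
    (Ioc (e.pos C a) (e.pos C b)).indicator (fun _ => (1 : ℝ)) u -
      (Ioc (e.pos C b) (e.pos C a)).indicator (fun _ => (1 : ℝ)) u
  else 0

theorem pathMult_cons_cons (a b : ℝ × ℝ) (l : List (ℝ × ℝ)) (e : Edge g) (u : ℝ) :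
    pathMult C (a :: b :: l) e u = stepMult C a b e u + pathMult C (b :: l) e u := by
  simp [pathMult, stepMult]

theorem pathMult_singleton (a : ℝ × ℝ) (e : Edge g) (u : ℝ) : pathMult C [a] e u = 0 := by
  simp [pathMult]

/-- Two different edges share at most one point, so a step inside `e₀` whose ends also lie on
another edge is constant and contributes nothing there. -/
theorem stepMult_pt (hC : IsGeneric g C) (e₀ e : Edge g) {s t : ℝ} (hs : s ∈ Icc 0 (e₀.len C))
    (ht : t ∈ Icc 0 (e₀.len C)) (u : ℝ) :
    stepMult C (e₀.pt C s) (e₀.pt C t) e u = if e = e₀ then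
      (Ioc s t).indicator (fun _ => (1 : ℝ)) u - (Ioc t s).indicator (fun _ => (1 : ℝ)) u
      else 0 := by
  unfold stepMult
  have h1 := e₀.pt_mem_seg hC hs
  have h2 := e₀.pt_mem_seg hC ht
  by_cases he : e = e₀
  · subst he
    rw [if_pos ⟨h1, h2⟩, if_pos rfl, e.pos_pt hs.1, e.pos_pt ht.1]
  · rw [if_neg he]
    split_ifs with h
    · rw [eq_of_mem_seg hC he h.1 h.2 h1 h2]
      simp
    · rfl

theorem stepMult_forward (hC : IsGeneric g C) (e₀ e : Edge g) {a b : ℝ × ℝ}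
    (ha : a = e₀.pt C 0) (hb : b = e₀.pt C (e₀.len C)) {u : ℝ} (hu : u ∈ Ioc 0 (e.len C)) :
    stepMult C a b e u = if e = e₀ then 1 else 0 := by
  have hl := (e₀.len_pos hC).le
  rw [ha, hb, stepMult_pt hC e₀ e ⟨le_rfl, hl⟩ ⟨hl, le_rfl⟩]
  split_ifs with h
  · subst h
    simp [hl, hu]
  · rfl

theorem stepMult_backward (hC : IsGeneric g C) (e₀ e : Edge g) {a b : ℝ × ℝ}
    (ha : a = e₀.pt C (e₀.len C)) (hb : b = e₀.pt C 0) {u : ℝ} (hu : u ∈ Ioc 0 (e.len C)) :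
    stepMult C a b e u = if e = e₀ then -1 else 0 := by
  have hl := (e₀.len_pos hC).le
  rw [ha, hb, stepMult_pt hC e₀ e ⟨hl, le_rfl⟩ ⟨le_rfl, hl⟩]
  split_ifs with h
  · subst h
    simp [hl, hu]
  · rfl

/-- The lower edge `v_i v_{i+1}`. -/
abbrev lower (i : Fin g) : Edge g := .inr (.inl i)

/-- The upper edge `w_i w_{i+1}`. -/
abbrev upper (i : Fin g) : Edge g := .inr (.inr i)

/-- The vertical edge `v_i w_i` on the left of the cycle number `i`. -/
abbrev left (i : Fin g) : Edge g := .inl i.castSucc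

/-- The vertical edge `v_{i+1} w_{i+1}` on the right of the cycle number `i`. -/
abbrev right (i : Fin g) : Edge g := .inl i.succ

theorem v_eq_lower (i : Fin g) : v g C i = (lower i).pt C 0 := ((lower i).pt_zero).symm

theorem v_eq_left (i : Fin g) : v g C i = (left i).pt C 0 := ((left i).pt_zero).symm

theorem v_eq_right (i : Fin g) : v g C (i + 1) = (right i).pt C 0 := ((right i).pt_zero).symm

theorem v_eq_lower_len (hC : IsGeneric g C) (i : Fin g) :
    v g C (i + 1) = (lower i).pt C ((lower i).len C) := (lower i).tgt_eq hC

theorem w_eq_upper (i : Fin g) : w g C i = (upper i).pt C 0 := ((upper i).pt_zero).symm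

theorem w_eq_upper_len (hC : IsGeneric g C) (i : Fin g) :
    w g C (i + 1) = (upper i).pt C ((upper i).len C) := (upper i).tgt_eq hC

theorem w_eq_left_len (hC : IsGeneric g C) (i : Fin g) :
    w g C i = (left i).pt C ((left i).len C) := (left i).tgt_eq hC

theorem w_eq_right_len (hC : IsGeneric g C) (i : Fin g) :
    w g C (i + 1) = (right i).pt C ((right i).len C) := (right i).tgt_eq hC

/-- Each of the four steps of the cycle covers exactly one full edge. The position u = 0 is left out
because the multiplicities are indicators of intervals that are open on the left; it has measure
zero. -/
theorem pathMult_alpha (hC : IsGeneric g C) (j : Fin g) (e : Edge g) {u : ℝ}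
    (hu : u ∈ Ioc 0 (e.len C)) : pathMult C (alpha g C j) e u = e.dir j := by
  unfold alpha
  rw [pathMult_cons_cons, pathMult_cons_cons, pathMult_cons_cons, pathMult_cons_cons,
    pathMult_singleton,
    stepMult_forward hC (lower j) e (v_eq_lower j) (v_eq_lower_len hC j) hu,
    stepMult_forward hC (right j) e (v_eq_right j) (w_eq_right_len hC j) hu,
    stepMult_backward hC (upper j) e (w_eq_upper_len hC j) (w_eq_upper j) hu,
    stepMult_backward hC (left j) e (w_eq_left_len hC j) (v_eq_left j) hu]
  rcases e with i | i | i
  · simp only [reduceCtorEq, if_false, Sum.inl.injEq, Edge.dir, Fin.ext_iff, Fin.val_succ,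
      Fin.val_castSucc]
    split_ifs <;> norm_num
  · simp [Edge.dir]
  · simp only [reduceCtorEq, if_false, Sum.inr.injEq, Edge.dir]
    split_ifs <;> norm_num

theorem intervalIntegrable_stepMult (a b : ℝ × ℝ) (e : Edge g) (x y : ℝ) :
    IntervalIntegrable (stepMult C a b e) MeasureTheory.volume x y := by
  have key : ∀ c d : ℝ, IntervalIntegrable ((Ioc c d).indicator (fun _ => (1 : ℝ)))
      MeasureTheory.volume x y := fun c d =>
    ((MeasureTheory.integrable_indicator_iff measurableSet_Ioc).mpr
      (MeasureTheory.integrableOn_const (by simp))).intervalIntegrable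
  unfold stepMult
  by_cases h : a ∈ e.seg C ∧ b ∈ e.seg C
  · simp only [h, and_self, if_true]
    exact (key _ _).sub (key _ _)
  · simp only [h, if_false]
    exact intervalIntegrable_const

theorem intervalIntegrable_pathMult (γ : List (ℝ × ℝ)) (e : Edge g) (x y : ℝ) :
    IntervalIntegrable (pathMult C γ e) MeasureTheory.volume x y := by
  match γ with
  | [] =>
    have : pathMult C [] e = fun _ => (0 : ℝ) := by ext u; simp [pathMult]
    rw [this]
    exact intervalIntegrable_const
  | [a] =>
    have : pathMult C [a] e = fun _ => (0 : ℝ) := by ext u; simp [pathMult]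
    rw [this]
    exact intervalIntegrable_const
  | a :: b :: l =>
    have : pathMult C (a :: b :: l) e = fun u => stepMult C a b e u + pathMult C (b :: l) e u := by
      ext u
      exact pathMult_cons_cons a b l e u
    rw [this]
    exact (intervalIntegrable_stepMult a b e x y).add (intervalIntegrable_pathMult (b :: l) e x y)

/-- The multiplicity of α_j on an edge is a constant, so it comes out of the integral; what remains
is the signed length of γ on that edge. -/
theorem Qvec_eq (hC : IsGeneric g C) (γ : List (ℝ × ℝ)) :
    Qvec g C γ = ∑ e : Edge g, (∫ u in (0 : ℝ)..(e.len C), pathMult C γ e u) • e.dir := by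
  ext j
  rw [Finset.sum_apply]
  unfold Qvec Q
  refine Finset.sum_congr rfl fun e _ => ?_
  rw [e.weight_eq hC, Pi.smul_apply, smul_eq_mul, ← intervalIntegral.integral_mul_const]
  refine intervalIntegral.integral_congr_ae (Filter.Eventually.of_forall fun u hu => ?_)
  rw [uIoc_of_le (e.len_pos hC).le] at hu
  rw [pathMult_alpha hC j e hu]

theorem Qvec_singleton (hC : IsGeneric g C) (a : ℝ × ℝ) : Qvec g C [a] = 0 := by
  rw [Qvec_eq hC]
  simp [pathMult_singleton]

theorem Qvec_cons_cons (hC : IsGeneric g C) (a b : ℝ × ℝ) (l : List (ℝ × ℝ)) :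
    Qvec g C (a :: b :: l) = Qvec g C [a, b] + Qvec g C (b :: l) := by
  simp only [Qvec_eq hC, ← Finset.sum_add_distrib, ← add_smul]
  refine Finset.sum_congr rfl fun e _ => ?_
  congr 1
  simp only [pathMult_cons_cons, pathMult_singleton, add_zero]
  exact intervalIntegral.integral_add (intervalIntegrable_stepMult a b e _ _)
    (intervalIntegrable_pathMult _ e _ _)

theorem integral_indicator_Ioc {s t l : ℝ} (hs : 0 ≤ s) (ht : t ≤ l) (hl : 0 ≤ l) :
    ∫ u in (0 : ℝ)..l, (Ioc s t).indicator (fun _ => (1 : ℝ)) u = max (t - s) 0 := by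
  rw [intervalIntegral.integral_of_le hl, MeasureTheory.setIntegral_indicator measurableSet_Ioc]
  have : Ioc 0 l ∩ Ioc s t = Ioc s t := inter_eq_right.mpr (Ioc_subset_Ioc hs ht)
  rw [this]
  simp [MeasureTheory.measureReal_def, Real.volume_Ioc, ENNReal.toReal_ofReal']

theorem Qvec_pt (hC : IsGeneric g C) (e₀ : Edge g) {s t : ℝ} (hs : s ∈ Icc 0 (e₀.len C))
    (ht : t ∈ Icc 0 (e₀.len C)) :
    Qvec g C [e₀.pt C s, e₀.pt C t] = (t - s) • e₀.dir := by
  rw [Qvec_eq hC, Finset.sum_eq_single e₀]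
  · congr 1
    simp only [pathMult_cons_cons, pathMult_singleton, add_zero, stepMult_pt hC e₀ e₀ hs ht, if_true]
    have hl := (e₀.len_pos hC).le
    have key : ∀ c d : ℝ, IntervalIntegrable ((Ioc c d).indicator (fun _ => (1 : ℝ)))
        MeasureTheory.volume 0 (e₀.len C) := fun c d =>
      ((MeasureTheory.integrable_indicator_iff measurableSet_Ioc).mpr
        (MeasureTheory.integrableOn_const (by simp))).intervalIntegrable
    rw [intervalIntegral.integral_sub (key _ _) (key _ _),
      integral_indicator_Ioc hs.1 ht.2 hl, integral_indicator_Ioc ht.1 hs.2 hl]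
    rcases le_total s t with h | h
    · rw [max_eq_left (by linarith), max_eq_right (by linarith)]
      ring
    · rw [max_eq_right (by linarith), max_eq_left (by linarith)]
      ring
  · intro e _ he
    simp [pathMult_cons_cons, pathMult_singleton, stepMult_pt hC e₀ e hs ht, he]
  · simp

/-- The lattice vector of the cycle number `i`. -/
theorem Qvec_alpha (hC : IsGeneric g C) (i : Fin g) :
    Qvec g C (alpha g C i) = (lower i).len C • (lower i).dir + (right i).len C • (right i).dir -
      (upper i).len C • (upper i).dir - (left i).len C • (left i).dir := by
  have hl : ∀ e : Edge g, 0 ≤ e.len C := fun e => (e.len_pos hC).le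
  unfold alpha
  rw [Qvec_cons_cons hC, Qvec_cons_cons hC (v g C (i + 1)), Qvec_cons_cons hC (w g C (i + 1)),
    Qvec_cons_cons hC (w g C i), Qvec_singleton hC]
  have h1 : Qvec g C [v g C i, v g C (i + 1)] = (lower i).len C • (lower i).dir := by
    rw [v_eq_lower, v_eq_lower_len hC, Qvec_pt hC _ ⟨le_rfl, hl _⟩ ⟨hl _, le_rfl⟩, sub_zero]
  have h2 : Qvec g C [v g C (i + 1), w g C (i + 1)] = (right i).len C • (right i).dir := by
    rw [v_eq_right, w_eq_right_len hC, Qvec_pt hC _ ⟨le_rfl, hl _⟩ ⟨hl _, le_rfl⟩, sub_zero]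
  have h3 : Qvec g C [w g C (i + 1), w g C i] = -((upper i).len C • (upper i).dir) := by
    rw [w_eq_upper, w_eq_upper_len hC, Qvec_pt hC _ ⟨hl _, le_rfl⟩ ⟨le_rfl, hl _⟩, zero_sub, neg_smul]
  have h4 : Qvec g C [w g C i, v g C i] = -((left i).len C • (left i).dir) := by
    rw [v_eq_left, w_eq_left_len hC, Qvec_pt hC _ ⟨hl _, le_rfl⟩ ⟨le_rfl, hl _⟩, zero_sub, neg_smul]
  rw [h1, h2, h3, h4]
  abel

theorem mulVec_K (n : Fin g → ℤ) :
    (K g C).mulVec (fun i => (n i : ℝ)) = ∑ i, (n i : ℝ) • Qvec g C (alpha g C i) := by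
  ext j
  rw [Finset.sum_apply]
  simp only [Matrix.mulVec, dotProduct, K, Matrix.of_apply, Pi.smul_apply, smul_eq_mul, Qvec]
  refine Finset.sum_congr rfl fun i _ => ?_
  rw [mul_comm]
  congr 1
  unfold Q
  simp only [mul_comm]

theorem mem_lattice_iff (x : Fin g → ℝ) :
    x ∈ lattice g C ↔ ∃ n : Fin g → ℤ, x = ∑ i, (n i : ℝ) • Qvec g C (alpha g C i) := by
  change (∃ n : Fin g → ℤ, x = (K g C).mulVec (fun i => (n i : ℝ))) ↔ _
  simp only [mulVec_K]

theorem Qvec_alpha_mem_lattice (i : Fin g) : Qvec g C (alpha g C i) ∈ lattice g C :=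
  (mem_lattice_iff _).mpr ⟨Pi.single i 1, by simp [Pi.single_apply]⟩

/-! ### The Abel–Jacobi map is well defined -/

/-- The coordinates of a point on the lower boundary: how far it is along each of the lower edges. -/
def along (g : ℕ) (C : ℤ → ℝ) (X : ℝ) : Fin g → ℝ :=
  fun j => max 0 (min X (lam g C (j + 1)) - lam g C j)

/-- A multivalued potential of the differentials `Q(·, α_j)`, given on every edge. -/
def Edge.pot (C : ℤ → ℝ) : Edge g → ℝ → Fin g → ℝ
  | .inl i, t => along g C (lam g C i) + t • Edge.dir (.inl i)
  | .inr (.inl i), t => along g C (lam g C i + t)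
  | .inr (.inr i), t => (fun j : Fin g => if (j : ℕ) = 0 then -C (-1) else 0) - along g C (lam g C i + t)

/-- Only the coordinate i grows between λ_i and λ_{i+1}: the later ones are still 0 and the earlier
ones are already complete. -/
theorem along_add (hC : IsGeneric g C) (i : Fin g) {t : ℝ}
    (ht : t ∈ Icc 0 (lam g C (i + 1) - lam g C i)) :
    along g C (lam g C i + t) = along g C (lam g C i) + t • (lower i).dir := by
  ext j
  simp only [along, Edge.dir, Pi.add_apply, Pi.smul_apply, smul_eq_mul]
  have hj := lam_lt_succ hC j.2
  have hi := lam_lt_succ hC i.2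
  rcases lt_trichotomy i j with h | h | h
  · have : lam g C (i + 1) ≤ lam g C j :=
      lam_le_lam hC (by have : (i : ℕ) < j := h; omega) j.2.le
    rw [if_neg h.ne, max_eq_left, max_eq_left]
    · ring
    · linarith [min_le_left (lam g C i) (lam g C (j + 1))]
    · linarith [min_le_left (lam g C i + t) (lam g C (j + 1)), ht.2]
  · subst h
    rw [if_pos rfl, min_eq_left (by linarith [ht.2]), min_eq_left hi.le, max_eq_right (by linarith [ht.1])]
    simp
  · have : lam g C (j + 1) ≤ lam g C i :=
      lam_le_lam hC (by have : (j : ℕ) < i := h; omega) i.2.le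
    rw [if_neg h.ne', min_eq_right (by linarith [ht.1]), min_eq_right this]
    ring

theorem Edge.pot_sub (hC : IsGeneric g C) (e : Edge g) {s t : ℝ} (hs : s ∈ Icc 0 (e.len C))
    (ht : t ∈ Icc 0 (e.len C)) : e.pot C t - e.pot C s = (t - s) • e.dir := by
  rcases e with i | i | i
  · simp only [Edge.pot, sub_smul]
    abel
  · simp only [Edge.pot]
    rw [along_add hC i ht, along_add hC i hs, sub_smul]
    abel
  · simp only [Edge.pot]
    have : Edge.dir (upper i) = -(Edge.dir (lower i)) := by ext j; simp [Edge.dir]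
    rw [along_add hC i ht, along_add hC i hs, sub_smul, this]
    module

/-- The value at w_i reached along the vertical edge may differ from the one prescribed on the upper
boundary. At i = 0 they agree, because p_0 = C_{-1}; from i to i + 1 the difference changes by the
lattice vector of the cycle between the two vertical edges. -/
theorem pot_top_mem (hC : IsGeneric g C) (hg : 0 < g) {i : ℕ} (hi : i ≤ g) :
    along g C (lam g C i) + p g C i • Edge.dir (.inl ⟨i, by omega⟩ : Edge g) -
      ((fun j : Fin g => if (j : ℕ) = 0 then -C (-1) else 0) - along g C (lam g C i)) ∈ lattice g C := by
  induction i with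
  | zero =>
    have : along g C (lam g C 0) + p g C 0 • Edge.dir (.inl ⟨0, by omega⟩ : Edge g) -
      ((fun j : Fin g => if (j : ℕ) = 0 then -C (-1) else 0) - along g C (lam g C 0)) = 0 := by
      ext j
      have h0 : min (lam g C 0) (lam g C (j + 1)) - lam g C j ≤ 0 := by
        have := lam_nonneg hC j.2.le
        have h1 : lam g C 0 = 0 := rfl
        linarith [min_le_left (lam g C 0) (lam g C (j + 1))]
      have hp : p g C 0 = C (-1) := by
        rw [p, ← prof_lam hC hi, prof_of_nonpos hC (X := lam g C 0) le_rfl]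
        simp [lam]
      simp only [along, Pi.sub_apply, Pi.add_apply, Pi.smul_apply, smul_eq_mul, Pi.zero_apply,
        max_eq_left h0, Edge.dir, hp]
      by_cases hj : (j : ℕ) = 0
      · simp [hj]
      · simp [hj, Ne.symm hj]
    rw [this]
    exact zero_mem _
  | succ i ih =>
    have hi' : i < g := by omega
    have h := ih (by omega)
    have hl := lam_lt_succ hC hi'
    have e1 := along_add hC ⟨i, hi'⟩ (t := lam g C (i + 1) - lam g C i)
      ⟨sub_nonneg.mpr hl.le, le_rfl⟩
    simp only [add_sub_cancel] at e1
    have e2 := Qvec_alpha hC ⟨i, hi'⟩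
    have hup : Edge.dir (upper ⟨i, hi'⟩) = -(Edge.dir (lower ⟨i, hi'⟩)) := by ext j; simp [Edge.dir]
    have := add_mem h (Qvec_alpha_mem_lattice (C := C) ⟨i, hi'⟩)
    convert this using 1
    have hr : Edge.dir (right ⟨i, hi'⟩) = Edge.dir (.inl ⟨i + 1, by omega⟩ : Edge g) := rfl
    have hl' : Edge.dir (left ⟨i, hi'⟩) = Edge.dir (.inl ⟨i, by omega⟩ : Edge g) := rfl
    rw [e1, e2, hup, hr, hl']
    generalize Edge.dir (.inl ⟨i + 1, _⟩ : Edge g) = d₁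
    generalize Edge.dir (.inl ⟨i, _⟩ : Edge g) = d₂
    simp only [Edge.len, Fin.val_succ, Fin.val_castSucc]
    module

/-- On the lower and on the upper boundary the potential is a function of X alone, so it is single
valued there, and a vertical edge joins the lower boundary without a jump. The only jumps are those
at the upper vertices, which `pot_top_mem` places in the lattice. -/
theorem Edge.pot_compat (hC : IsGeneric g C) (hg : 0 < g) {e e' : Edge g} {s t : ℝ}
    (hs : s ∈ Icc 0 (e.len C)) (ht : t ∈ Icc 0 (e'.len C)) (h : e.pt C s = e'.pt C t) :
    e.pot C s - e'.pot C t ∈ lattice g C := by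
  have key : ∀ (i : Fin (g + 1)) (j : Fin g) (s t : ℝ), t ∈ Icc 0 ((lower j).len C) →
      Edge.pt C (.inl i) s = (lower j).pt C t →
      Edge.pot C (.inl i) s - (lower j).pot C t ∈ lattice g C := by
    intro i j s t ht h
    rw [pt_vert, pt_lower hC j ht, Prod.mk.injEq] at h
    have hX := h.1
    rw [← h.1, prof_lam hC (by omega)] at h
    have hs0 : s = 0 := by linarith [h.2]
    simp [Edge.pot, hs0, hX]
  have key' : ∀ (i : Fin (g + 1)) (j : Fin g) (s t : ℝ), t ∈ Icc 0 ((upper j).len C) →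
      Edge.pt C (.inl i) s = (upper j).pt C t →
      Edge.pot C (.inl i) s - (upper j).pot C t ∈ lattice g C := by
    intro i j s t ht h
    rw [pt_vert, pt_upper hC j ht, Prod.mk.injEq] at h
    have hX := h.1
    rw [← h.1, prof_lam hC (by omega)] at h
    have hs0 : s = p g C i := by rw [p]; linarith [h.2]
    simp only [Edge.pot, hs0, ← hX]
    exact pot_top_mem hC hg (i := i) (by omega)
  rcases e with i | i | i <;> rcases e' with j | j | j
  · rw [pt_vert, pt_vert, Prod.mk.injEq] at h
    have hij : i = j := Fin.ext (lam_injective hC (by omega) (by omega) h.1)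
    subst hij
    have : s = t := by linarith [h.2]
    subst this
    simp
  · exact key i j s t ht h
  · exact key' i j s t ht h
  · rw [← neg_sub]
    exact neg_mem (key j i t s hs h.symm)
  · rw [pt_lower hC i hs, pt_lower hC j ht, Prod.mk.injEq] at h
    simp [Edge.pot, h.1]
  · rw [pt_lower hC i hs, pt_upper hC j ht, Prod.mk.injEq, ← h.1] at h
    have := two_prof_lt hC (lam g C i + s)
    linarith [h.2]
  · rw [← neg_sub]
    exact neg_mem (key' j i t s hs h.symm)
  · rw [pt_upper hC i hs, pt_lower hC j ht, Prod.mk.injEq, ← h.1] at h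
    have := two_prof_lt hC (lam g C i + s)
    linarith [h.2]
  · rw [pt_upper hC i hs, pt_upper hC j ht, Prod.mk.injEq] at h
    simp [Edge.pot, h.1]

open scoped Classical in
/-- The potential as a function on the ladder with values in the Jacobian. -/
def jacPot (g : ℕ) (C : ℤ → ℝ) (P : ℝ × ℝ) : Jac g C :=
  if h : ∃ (e : Edge g) (t : ℝ), t ∈ Icc 0 (e.len C) ∧ e.pt C t = P then
    (h.choose.pot C h.choose_spec.choose : Jac g C) else 0

theorem jacPot_pt (hC : IsGeneric g C) (hg : 0 < g) (e : Edge g) {t : ℝ}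
    (ht : t ∈ Icc 0 (e.len C)) : jacPot g C (e.pt C t) = (e.pot C t : Jac g C) := by
  have h : ∃ (e' : Edge g) (t' : ℝ), t' ∈ Icc 0 (e'.len C) ∧ e'.pt C t' = e.pt C t :=
    ⟨e, t, ht, rfl⟩
  rw [jacPot, dif_pos h, QuotientAddGroup.eq_iff_sub_mem]
  exact Edge.pot_compat hC hg h.choose_spec.choose_spec.1 ht h.choose_spec.choose_spec.2

theorem Qvec_step (hC : IsGeneric g C) (hg : 0 < g) {e : Edge g} {a b : ℝ × ℝ}
    (ha : a ∈ e.seg C) (hb : b ∈ e.seg C) :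
    (Qvec g C [a, b] : Jac g C) = jacPot g C b - jacPot g C a := by
  rw [e.seg_eq hC] at ha hb
  obtain ⟨s, hs, rfl⟩ := ha
  obtain ⟨t, ht, rfl⟩ := hb
  rw [jacPot_pt hC hg e hs, jacPot_pt hC hg e ht, Qvec_pt hC e hs ht, ← e.pot_sub hC hs ht]
  rfl

/-- Every step of a path contributes a difference of values of the potential, and these differences
telescope. This is the independence of the chosen path. -/
theorem Qvec_path (hC : IsGeneric g C) (hg : 0 < g) (γ : List (ℝ × ℝ)) {x y : ℝ × ℝ}
    (h : IsPath g C γ x y) : (Qvec g C γ : Jac g C) = jacPot g C y - jacPot g C x := by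
  match γ with
  | [] => simp [IsPath] at h
  | [a] =>
    obtain ⟨h1, h2, -⟩ := h
    simp only [List.head?_cons, Option.some.injEq, List.getLast?_singleton] at h1 h2
    rw [← h1, ← h2, Qvec_singleton hC, sub_self]
    rfl
  | a :: b :: l =>
    obtain ⟨h1, h2, h3⟩ := h
    simp only [List.head?_cons, Option.some.injEq] at h1
    rw [List.isChain_cons_cons] at h3
    obtain ⟨⟨e, ha, hb⟩, h4⟩ := h3
    have ih := Qvec_path hC hg (b :: l) (x := b) (y := y)
      ⟨rfl, by rwa [List.getLast?_cons_cons] at h2, h4⟩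
    rw [Qvec_cons_cons hC, QuotientAddGroup.mk_add, ih, Qvec_step hC hg ha hb, h1]
    abel

/-- Two points lie on a common edge. -/
def Adjacent (g : ℕ) (C : ℤ → ℝ) (a b : ℝ × ℝ) : Prop := ∃ e : Edge g, a ∈ e.seg C ∧ b ∈ e.seg C

theorem exists_isPath_of_reflTransGen {a b : ℝ × ℝ}
    (h : Relation.ReflTransGen (Adjacent g C) a b) : ∃ γ, IsPath g C γ a b := by
  induction h using Relation.ReflTransGen.head_induction_on with
  | refl => exact ⟨[b], rfl, rfl, List.isChain_singleton _⟩
  | head h _ ih =>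
    obtain ⟨γ, h1, h2, h3⟩ := ih
    rename_i x y _
    match γ with
    | [] => simp at h1
    | z :: l =>
      simp only [List.head?_cons, Option.some.injEq] at h1
      subst h1
      exact ⟨x :: z :: l, rfl, by rwa [List.getLast?_cons_cons],
        List.isChain_cons_cons.mpr ⟨h, h3⟩⟩

theorem src_mem_seg (e : Edge g) : e.src C ∈ e.seg C := left_mem_segment _ _ _

theorem tgt_mem_seg (e : Edge g) : e.tgt C ∈ e.seg C := right_mem_segment _ _ _

theorem reflTransGen_v {i : ℕ} (hi : i ≤ g) :
    Relation.ReflTransGen (Adjacent g C) (v g C i) (v g C 0) := by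
  induction i with
  | zero => exact .refl
  | succ i ih =>
    exact .head ⟨lower ⟨i, by omega⟩, tgt_mem_seg (lower ⟨i, by omega⟩), src_mem_seg (lower ⟨i, _⟩)⟩
      (ih (by omega))

theorem reflTransGen_of_mem_seg {e : Edge g} {P : ℝ × ℝ} (hP : P ∈ e.seg C) :
    Relation.ReflTransGen (Adjacent g C) P (v g C 0) := by
  refine .head ⟨e, hP, src_mem_seg e⟩ ?_
  rcases e with i | i | i
  · exact reflTransGen_v (by omega)
  · exact reflTransGen_v (by omega)
  · exact .head ⟨left i, tgt_mem_seg (left i), src_mem_seg (left i)⟩ (reflTransGen_v i.2.le)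

theorem exists_isPath (hC : IsGeneric g C) {P₀ P : ℝ × ℝ} (h₀ : P₀ ∈ Gam g C)
    (h : P ∈ Gam g C) : ∃ γ, IsPath g C γ P₀ P := by
  rw [Gam_eq hC, mem_iUnion] at h₀ h
  obtain ⟨e₀, he₀⟩ := h₀
  obtain ⟨e, he⟩ := h
  apply exists_isPath_of_reflTransGen
  have : Std.Symm (Adjacent g C) := ⟨fun a b ⟨e, h1, h2⟩ => ⟨e, h2, h1⟩⟩
  exact (reflTransGen_of_mem_seg he₀).trans
    (Relation.ReflTransGen.stdSymm.symm _ _ (reflTransGen_of_mem_seg he))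

theorem abelJacobiPt_eq (hC : IsGeneric g C) (hg : 0 < g) {P₀ P : ℝ × ℝ} (h₀ : P₀ ∈ Gam g C)
    (h : P ∈ Gam g C) : abelJacobiPt g C P₀ P = jacPot g C P - jacPot g C P₀ := by
  have hex := exists_isPath hC h₀ h
  rw [abelJacobiPt, dif_pos hex]
  exact Qvec_path hC hg _ hex.choose_spec

end TropHyper
end

noncomputable section

namespace TropHyper

/-! ### Covering functions of arcs on a circle -/

/-- The signed length of the part of `[o, o + m] + L ℤ` between `0` and `x`. -/
def cov (L o m x : ℝ) : ℝ := m * ⌊x / L⌋ + max 0 (min (x - L * ⌊x / L⌋ - o) m)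

theorem exists_int_mul_add {L : ℝ} (hL : 0 < L) (x : ℝ) :
    ∃ (n : ℤ) (r : ℝ), r ∈ Ico 0 L ∧ x = n * L + r := by
  refine ⟨⌊x / L⌋, x - ⌊x / L⌋ * L, ⟨?_, ?_⟩, by ring⟩
  · have := (le_div_iff₀ hL).mp (Int.floor_le (x / L))
    linarith
  · have := (div_lt_iff₀ hL).mp (Int.lt_floor_add_one (x / L))
    linarith

/-- The hypotheses on the data of an arc `[o, o + m]` on a circle of length `L`. -/
structure IsArc (L o m : ℝ) : Prop where
  nonneg : 0 ≤ o
  pos : 0 < m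
  le : o + m ≤ L

variable {L o m : ℝ}

theorem IsArc.length_pos (h : IsArc L o m) : 0 < L := by linarith [h.nonneg, h.pos, h.le]

/-- The remainder may equal L: the floor then jumps by one, but at the end of a turn the arc is
covered completely, so both readings agree. -/
theorem cov_eq (h : IsArc L o m) (n : ℤ) {r : ℝ} (hr : r ∈ Icc 0 L) :
    cov L o m (n * L + r) = n * m + max 0 (min (r - o) m) := by
  have hL := h.length_pos
  rcases hr.2.eq_or_lt with rfl | hlt
  · have e : (n * r + r) / r = ((n + 1 : ℤ) : ℝ) := by field_simp; push_cast; ring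
    have e1 : min (r - o) m = m := min_eq_right (by linarith [h.le])
    have e2 : n * r + r - r * ((n + 1 : ℤ) : ℝ) - o = -o := by push_cast; ring
    have e3 : max 0 (min (-o) m) = 0 :=
      max_eq_left ((min_le_left _ _).trans (by linarith [h.nonneg]))
    rw [cov, e, Int.floor_intCast, e1, e2, e3, max_eq_right h.pos.le]
    push_cast
    ring
  · have e : ⌊(n * L + r) / L⌋ = n := by
      rw [Int.floor_eq_iff]
      constructor
      · rw [le_div_iff₀ hL]
        linarith [hr.1]
      · rw [div_lt_iff₀ hL]
        linarith
    rw [cov, e]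
    have : n * L + r - L * n - o = r - o := by ring
    rw [this]
    ring

theorem cov_before (h : IsArc L o m) (n : ℤ) {r : ℝ} (hr : r ∈ Icc 0 o) :
    cov L o m (n * L + r) = n * m := by
  rw [cov_eq h n ⟨hr.1, by linarith [hr.2, h.le, h.pos]⟩, max_eq_left, add_zero]
  exact (min_le_left _ _).trans (by linarith [hr.2])

theorem cov_inside (h : IsArc L o m) (n : ℤ) {r : ℝ} (hr : r ∈ Icc o (o + m)) :
    cov L o m (n * L + r) = n * m + (r - o) := by
  rw [cov_eq h n ⟨by linarith [hr.1, h.nonneg], by linarith [hr.2, h.le]⟩,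
    min_eq_left (by linarith [hr.2]), max_eq_right (by linarith [hr.1])]

theorem cov_after (h : IsArc L o m) (n : ℤ) {r : ℝ} (hr : r ∈ Icc (o + m) L) :
    cov L o m (n * L + r) = n * m + m := by
  rw [cov_eq h n ⟨by linarith [hr.1, h.nonneg, h.pos], hr.2⟩,
    min_eq_right (by linarith [hr.1]), max_eq_right h.pos.le]

theorem cov_add_period (h : IsArc L o m) (n : ℤ) (x : ℝ) :
    cov L o m (x + n * L) = cov L o m x + n * m := by
  obtain ⟨k, r, hr, rfl⟩ := exists_int_mul_add h.length_pos x
  have e : k * L + r + n * L = ((k + n : ℤ) : ℝ) * L + r := by push_cast; ring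
  rw [e, cov_eq h _ ⟨hr.1, hr.2.le⟩, cov_eq h _ ⟨hr.1, hr.2.le⟩]
  push_cast
  ring

/-- Each point lies before, on, or after the arc, within one turn. -/
theorem cov_cases (h : IsArc L o m) (r : ℝ) :
    (r ≤ o ∧ max 0 (min (r - o) m) = 0) ∨
      (o ≤ r ∧ r ≤ o + m ∧ max 0 (min (r - o) m) = r - o) ∨
      (o + m ≤ r ∧ max 0 (min (r - o) m) = m) := by
  rcases le_total r o with h1 | h1
  · exact .inl ⟨h1, max_eq_left ((min_le_left _ _).trans (by linarith))⟩
  · rcases le_total r (o + m) with h2 | h2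
    · refine .inr (.inl ⟨h1, h2, ?_⟩)
      rw [min_eq_left (by linarith), max_eq_right (by linarith)]
    · refine .inr (.inr ⟨h2, ?_⟩)
      rw [min_eq_right (by linarith), max_eq_right h.pos.le]

theorem int_le_of_lt {L r r' : ℝ} {n n' : ℤ} (hr : r ∈ Ico 0 L) (hr' : r' ∈ Ico 0 L)
    (h : n * L + r ≤ n' * L + r') : n ≤ n' := by
  by_contra! hlt
  have : (n' : ℝ) + 1 ≤ n := by exact_mod_cast hlt
  nlinarith [hr.1, hr'.2, hr'.1]

/-- Within one turn compare the two remainders with the arc. A change of turn adds m to the function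
and L ≥ m to the argument. -/
theorem cov_bounds (h : IsArc L o m) {x x' : ℝ} (hx : x ≤ x') :
    cov L o m x ≤ cov L o m x' ∧ cov L o m x' - cov L o m x ≤ x' - x := by
  obtain ⟨n, r, hr, rfl⟩ := exists_int_mul_add h.length_pos x
  obtain ⟨n', r', hr', rfl⟩ := exists_int_mul_add h.length_pos x'
  have hrc : r ∈ Icc 0 L := ⟨hr.1, hr.2.le⟩
  have hrc' : r' ∈ Icc 0 L := ⟨hr'.1, hr'.2.le⟩
  rw [cov_eq h n hrc, cov_eq h n' hrc']
  have h1 := h.nonneg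
  have h2 := h.pos
  have h3 := h.le
  rcases (int_le_of_lt hr hr' hx).eq_or_lt with rfl | hlt
  · have hrr : r ≤ r' := by linarith
    rcases cov_cases h r with ⟨a, e⟩ | ⟨a, a', e⟩ | ⟨a, e⟩ <;>
      rcases cov_cases h r' with ⟨b, e'⟩ | ⟨b, b', e'⟩ | ⟨b, e'⟩ <;> rw [e, e'] <;>
      constructor <;> linarith
  · have hn : (n : ℝ) + 1 ≤ n' := by exact_mod_cast hlt
    have hm : ((n' : ℝ) - n) * m ≥ m := by nlinarith
    have hLm : ((n' : ℝ) - n) * (L - m) ≥ L - m := by nlinarith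
    have hr1 := hr.1
    have hr2 := hr.2
    have hr1' := hr'.1
    have hr2' := hr'.2
    rcases cov_cases h r with ⟨a, e⟩ | ⟨a, a', e⟩ | ⟨a, e⟩ <;>
      rcases cov_cases h r' with ⟨b, e'⟩ | ⟨b, b', e'⟩ | ⟨b, e'⟩ <;> rw [e, e'] <;>
      constructor <;> linarith

theorem cov_continuous (h : IsArc L o m) : Continuous (cov L o m) := by
  have : LipschitzWith 1 (cov L o m) := by
    refine LipschitzWith.of_dist_le_mul fun x y => ?_
    rw [NNReal.coe_one, one_mul, Real.dist_eq, Real.dist_eq]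
    rcases le_total x y with hxy | hxy
    · have := cov_bounds h hxy
      rw [abs_sub_comm, abs_sub_comm x, abs_of_nonneg (by linarith), abs_of_nonneg (by linarith)]
      exact this.2
    · have := cov_bounds h hxy
      rw [abs_of_nonneg (by linarith), abs_of_nonneg (by linarith)]
      exact this.2
  exact this.continuous

/-- Where the covering function is constant, the arc is not met. -/
theorem cov_flat (h : IsArc L o m) {x x' : ℝ} (hx : x < x') (he : cov L o m x = cov L o m x') :
    ∃ n : ℤ, n * L + (o + m) ≤ x ∧ x' ≤ (n + 1) * L + o := by
  obtain ⟨n, r, hr, rfl⟩ := exists_int_mul_add h.length_pos x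
  obtain ⟨n', r', hr', rfl⟩ := exists_int_mul_add h.length_pos x'
  have hrc : r ∈ Icc 0 L := ⟨hr.1, hr.2.le⟩
  have hrc' : r' ∈ Icc 0 L := ⟨hr'.1, hr'.2.le⟩
  rw [cov_eq h n hrc, cov_eq h n' hrc'] at he
  have h1 := h.nonneg
  have h2 := h.pos
  have h3 := h.le
  have hr1 := hr.1
  have hr2 := hr.2
  have hr1' := hr'.1
  have hr2' := hr'.2
  rcases (int_le_of_lt hr hr' hx.le).eq_or_lt with rfl | hlt
  · have hrr : r < r' := by linarith
    rcases cov_cases h r with ⟨a, e⟩ | ⟨a, a', e⟩ | ⟨a, e⟩ <;>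
      rcases cov_cases h r' with ⟨b, e'⟩ | ⟨b, b', e'⟩ | ⟨b, e'⟩ <;> rw [e, e'] at he
    · exact ⟨n - 1, by push_cast; linarith, by push_cast; linarith⟩
    · exact ⟨n - 1, by push_cast; linarith, by push_cast; linarith⟩
    · linarith
    · linarith
    · linarith
    · exact ⟨n, by linarith, by linarith⟩
    · linarith
    · linarith
    · exact ⟨n, by linarith, by linarith⟩
  · have hn : (n : ℝ) + 1 ≤ n' := by exact_mod_cast hlt
    have hm : ((n' : ℝ) - n) * m ≥ m := by nlinarith
    have hn' : n' = n + 1 := by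
      by_contra hne
      have : n + 2 ≤ n' := by omega
      have : (n : ℝ) + 2 ≤ n' := by exact_mod_cast this
      have hm2 : ((n' : ℝ) - n) * m ≥ 2 * m := by nlinarith
      rcases cov_cases h r with ⟨a, e⟩ | ⟨a, a', e⟩ | ⟨a, e⟩ <;>
        rcases cov_cases h r' with ⟨b, e'⟩ | ⟨b, b', e'⟩ | ⟨b, e'⟩ <;> rw [e, e'] at he <;>
        linarith
    subst hn'
    push_cast at he ⊢
    refine ⟨n, ?_, ?_⟩ <;>
    rcases cov_cases h r with ⟨a, e⟩ | ⟨a, a', e⟩ | ⟨a, e⟩ <;>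
      rcases cov_cases h r' with ⟨b, e'⟩ | ⟨b, b', e'⟩ | ⟨b, e'⟩ <;> rw [e, e'] at he <;>
      linarith

/-- Where the covering function has slope one, one stays on the arc. -/
theorem cov_steep (h : IsArc L o m) (ho : 0 < o) {x x' : ℝ} (hx : x < x')
    (he : cov L o m x' - cov L o m x = x' - x) :
    ∃ n : ℤ, n * L + o ≤ x ∧ x' ≤ n * L + (o + m) := by
  obtain ⟨n, r, hr, rfl⟩ := exists_int_mul_add h.length_pos x
  obtain ⟨n', r', hr', rfl⟩ := exists_int_mul_add h.length_pos x'
  have hrc : r ∈ Icc 0 L := ⟨hr.1, hr.2.le⟩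
  have hrc' : r' ∈ Icc 0 L := ⟨hr'.1, hr'.2.le⟩
  rw [cov_eq h n hrc, cov_eq h n' hrc'] at he
  have h2 := h.pos
  have h3 := h.le
  have hr1 := hr.1
  have hr2 := hr.2
  have hr1' := hr'.1
  have hr2' := hr'.2
  rcases (int_le_of_lt hr hr' hx.le).eq_or_lt with rfl | hlt
  · have hrr : r < r' := by linarith
    refine ⟨n, ?_, ?_⟩ <;>
    rcases cov_cases h r with ⟨a, e⟩ | ⟨a, a', e⟩ | ⟨a, e⟩ <;>
      rcases cov_cases h r' with ⟨b, e'⟩ | ⟨b, b', e'⟩ | ⟨b, e'⟩ <;> rw [e, e'] at he <;>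
      linarith
  · have hLm : 0 < L - m := by linarith
    have hn' : n' = n + 1 := by
      by_contra hne
      have : n + 2 ≤ n' := by omega
      have : (n : ℝ) + 2 ≤ n' := by exact_mod_cast this
      have hm2 : ((n' : ℝ) - n) * (L - m) ≥ 2 * (L - m) := by nlinarith
      rcases cov_cases h r with ⟨a, e⟩ | ⟨a, a', e⟩ | ⟨a, e⟩ <;>
        rcases cov_cases h r' with ⟨b, e'⟩ | ⟨b, b', e'⟩ | ⟨b, e'⟩ <;> rw [e, e'] at he <;>
        linarith
    subst hn'
    push_cast at he ⊢
    refine ⟨n, ?_, ?_⟩ <;>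
    rcases cov_cases h r with ⟨a, e⟩ | ⟨a, a', e⟩ | ⟨a, e⟩ <;>
      rcases cov_cases h r' with ⟨b, e'⟩ | ⟨b, b', e'⟩ | ⟨b, e'⟩ <;> rw [e, e'] at he <;>
      linarith

/-- The four arcs of a circle that is subdivided at four points. -/
theorem cov_sum_four {a₁ a₂ a₃ a₄ : ℝ} (h₁ : 0 < a₁) (h₂ : 0 < a₂) (h₃ : 0 < a₃) (h₄ : 0 < a₄)
    (hL : L = a₁ + a₂ + a₃ + a₄) (x : ℝ) :
    cov L 0 a₁ x + cov L a₁ a₂ x + cov L (a₁ + a₂) a₃ x + cov L (a₁ + a₂ + a₃) a₄ x = x := by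
  have i₁ : IsArc L 0 a₁ := ⟨le_rfl, h₁, by linarith⟩
  have i₂ : IsArc L a₁ a₂ := ⟨h₁.le, h₂, by linarith⟩
  have i₃ : IsArc L (a₁ + a₂) a₃ := ⟨by linarith, h₃, by linarith⟩
  have i₄ : IsArc L (a₁ + a₂ + a₃) a₄ := ⟨by linarith, h₄, by linarith⟩
  obtain ⟨n, r, hr, rfl⟩ := exists_int_mul_add i₁.length_pos x
  have hrc : r ∈ Icc 0 L := ⟨hr.1, hr.2.le⟩
  have hr1 := hr.1
  have hr2 := hr.2
  have hn : n * L = n * a₁ + n * a₂ + n * a₃ + n * a₄ := by rw [hL]; ring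
  rw [cov_eq i₁ n hrc, cov_eq i₂ n hrc, cov_eq i₃ n hrc, cov_eq i₄ n hrc, hn]
  rcases cov_cases i₁ r with ⟨a, e⟩ | ⟨a, a', e⟩ | ⟨a, e⟩ <;>
    rcases cov_cases i₂ r with ⟨b, e'⟩ | ⟨b, b', e'⟩ | ⟨b, e'⟩ <;>
    rcases cov_cases i₃ r with ⟨c, f⟩ | ⟨c, c', f⟩ | ⟨c, f⟩ <;>
    rcases cov_cases i₄ r with ⟨d, f'⟩ | ⟨d, d', f'⟩ | ⟨d, f'⟩ <;>
    rw [e, e', f, f'] <;> linarith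

/-! ### The equations of the Abel–Jacobi map on the universal covers of the cycles -/

/-- Nondecreasing with slopes at most one. -/
def SlopeLeOne (f : ℝ → ℝ) : Prop := ∀ x x', x ≤ x' → f x ≤ f x' ∧ f x' - f x ≤ x' - x

variable {ℓ d b : ℝ} {G F : ℝ → ℝ}

/-- The four covering functions of the circle add up to u. If the two vertical arcs take up the
whole increment, those of the horizontal arcs are constant, so no horizontal arc is met and the
motion stays on one vertical arc. The positive length ℓ separates the two vertical arcs. -/
theorem two_steep (hℓ : 0 < ℓ) (hd : 0 < d) (hb : 0 < b) (hL : L = 2 * ℓ + d + b) {u u' : ℝ}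
    (hu : u < u') (he : (cov L (2 * ℓ + d) b u' - cov L (2 * ℓ + d) b u) +
      (cov L ℓ d u' - cov L ℓ d u) = u' - u) :
    (∃ n : ℤ, n * L + (2 * ℓ + d) ≤ u ∧ u' ≤ n * L + L) ∨
      ∃ n : ℤ, n * L + ℓ ≤ u ∧ u' ≤ n * L + (ℓ + d) := by
  have i₁ : IsArc L 0 ℓ := ⟨le_rfl, hℓ, by linarith⟩
  have i₃ : IsArc L (ℓ + d) ℓ := ⟨by linarith, hℓ, by linarith⟩
  have s := cov_sum_four hℓ hd hℓ hb (L := L) (by linarith) u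
  have s' := cov_sum_four hℓ hd hℓ hb (L := L) (by linarith) u'
  have e : ℓ + d + ℓ = 2 * ℓ + d := by ring
  rw [e] at s s'
  have m₁ := (cov_bounds i₁ hu.le).1
  have m₃ := (cov_bounds i₃ hu.le).1
  obtain ⟨n, hn1, hn2⟩ := cov_flat i₁ hu (by linarith)
  obtain ⟨k, hk1, hk2⟩ := cov_flat i₃ hu (by linarith)
  have hLpos := i₁.length_pos
  -- The stretches free of the first and of the third arc overlap only if they belong to the same
  -- turn (left edge) or to consecutive ones (right edge).
  have c1 : k < n + 1 := by
    by_contra! hcon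
    have : (n : ℝ) + 1 ≤ k := by exact_mod_cast hcon
    nlinarith
  have c2 : n < k + 2 := by
    by_contra! hcon
    have : (k : ℝ) + 2 ≤ n := by exact_mod_cast hcon
    nlinarith
  have : k = n ∨ k = n - 1 := by omega
  rcases this with rfl | rfl
  · exact .inl ⟨k, by linarith, by linarith⟩
  · refine .inr ⟨n, by linarith, ?_⟩
    push_cast at hk2
    linarith

/-- The equations give u' - u = ΔG + ΔF ≤ Δx + Δy, and Δx + Δy is the length that the motion from u
to u' spends on the two vertical arcs, hence at most u' - u. All inequalities are equalities: u
moves on a single vertical arc, one neighbour moves by the same amount with slope one, and the other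
neighbour rests. -/
theorem rigidity (hℓ : 0 < ℓ) (hd : 0 < d) (hb : 0 < b) (hL : L = 2 * ℓ + d + b)
    (hG : SlopeLeOne G) (hF : SlopeLeOne F) {x u y x' u' y' : ℝ} (hu : u < u')
    (e₁ : x' - cov L (2 * ℓ + d) b u' = x - cov L (2 * ℓ + d) b u)
    (e₂ : u' - G x' - F y' = u - G x - F y)
    (e₃ : y' - cov L ℓ d u' = y - cov L ℓ d u) :
    (∃ n : ℤ, n * L + (2 * ℓ + d) ≤ u ∧ u' ≤ n * L + L ∧ x' - x = u' - u ∧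
      G x' - G x = x' - x ∧ y' = y) ∨
    ∃ n : ℤ, n * L + ℓ ≤ u ∧ u' ≤ n * L + (ℓ + d) ∧ y' - y = u' - u ∧
      F y' - F y = y' - y ∧ x' = x := by
  have i₂ : IsArc L ℓ d := ⟨hℓ.le, hd, by linarith⟩
  have i₄ : IsArc L (2 * ℓ + d) b := ⟨by linarith, hb, by linarith⟩
  have m₂ := cov_bounds i₂ hu.le
  have m₄ := cov_bounds i₄ hu.le
  have g1 := hG x x' (by linarith)
  have f1 := hF y y' (by linarith)
  have s := cov_sum_four hℓ hd hℓ hb (L := L) (by linarith) u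
  have s' := cov_sum_four hℓ hd hℓ hb (L := L) (by linarith) u'
  have e : ℓ + d + ℓ = 2 * ℓ + d := by ring
  rw [e] at s s'
  have m₁ := (cov_bounds (⟨le_rfl, hℓ, by linarith⟩ : IsArc L 0 ℓ) hu.le).1
  have m₃ := (cov_bounds (⟨by linarith, hℓ, by linarith⟩ : IsArc L (ℓ + d) ℓ) hu.le).1
  rcases two_steep hℓ hd hb hL hu (by linarith) with ⟨n, hn1, hn2⟩ | ⟨n, hn1, hn2⟩
  · left
    have v1 : cov L ℓ d u = n * d + d := by
      have := cov_after i₂ n (r := u - n * L) ⟨by linarith, by linarith⟩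
      rwa [add_sub_cancel] at this
    have v2 : cov L ℓ d u' = n * d + d := by
      have := cov_after i₂ n (r := u' - n * L) ⟨by linarith, by linarith⟩
      rwa [add_sub_cancel] at this
    exact ⟨n, hn1, hn2, by linarith, by linarith, by linarith⟩
  · right
    have v1 : cov L (2 * ℓ + d) b u = n * b := by
      have := cov_before i₄ n (r := u - n * L) ⟨by linarith, by linarith⟩
      rwa [add_sub_cancel] at this
    have v2 : cov L (2 * ℓ + d) b u' = n * b := by
      have := cov_before i₄ n (r := u' - n * L) ⟨by linarith, by linarith⟩
      rwa [add_sub_cancel] at this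
    exact ⟨n, hn1, hn2, by linarith, by linarith, by linarith⟩

/-- Eliminating x and y leaves the equation Ψ u = z₂ with Ψ continuous, nondecreasing and unbounded
in both directions. The last clause holds for the largest solution: if a vertical arc and the
neighbour's function both had slope one just after it, Ψ would stay constant and the solution could
be increased. -/
theorem exists_solution (hℓ : 0 < ℓ) (hd : 0 < d) (hb : 0 < b) (hL : L = 2 * ℓ + d + b)
    (hG : SlopeLeOne G) (hF : SlopeLeOne F) (hGc : Continuous G) (hFc : Continuous F)
    (z₁ z₂ z₃ : ℝ) :
    ∃ x u y, x - cov L (2 * ℓ + d) b u = z₁ ∧ u - G x - F y = z₂ ∧ y - cov L ℓ d u = z₃ ∧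
      ∀ ε > 0, ¬ (cov L (2 * ℓ + d) b (u + ε) = cov L (2 * ℓ + d) b u + ε ∧
        cov L ℓ d (u + ε) = cov L ℓ d u ∧ G (x + ε) = G x + ε) ∧
      ¬ (cov L ℓ d (u + ε) = cov L ℓ d u + ε ∧
        cov L (2 * ℓ + d) b (u + ε) = cov L (2 * ℓ + d) b u ∧ F (y + ε) = F y + ε) := by
  have i₂ : IsArc L ℓ d := ⟨hℓ.le, hd, by linarith⟩
  have i₄ : IsArc L (2 * ℓ + d) b := ⟨by linarith, hb, by linarith⟩
  have hLpos := i₂.length_pos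
  set A := cov L (2 * ℓ + d) b with hA
  set B := cov L ℓ d with hB
  have zA : ∀ n : ℤ, A (n * L) = n * b := fun n => by
    have := cov_before i₄ n (r := 0) ⟨le_rfl, by linarith⟩
    rwa [add_zero] at this
  have zB : ∀ n : ℤ, B (n * L) = n * d := fun n => by
    have := cov_before i₂ n (r := 0) ⟨le_rfl, by linarith⟩
    rwa [add_zero] at this
  have zA0 : A 0 = 0 := by simpa using zA 0
  have zB0 : B 0 = 0 := by simpa using zB 0
  set Ψ : ℝ → ℝ := fun u => u - G (z₁ + A u) - F (z₃ + B u) with hΨ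
  have hΨc : Continuous Ψ := by
    have := cov_continuous i₂
    have := cov_continuous i₄
    fun_prop
  -- In a full turn u gains 2ℓ + d + b, while the subtracted terms gain at most b and d, so Ψ gains
  -- at least 2ℓ.
  have hup : ∀ n : ℤ, 0 ≤ n → n * (2 * ℓ) - G z₁ - F z₃ ≤ Ψ (n * L) := by
    intro n hn
    have hn' : (0 : ℝ) ≤ n := by exact_mod_cast hn
    have g1 := (hG z₁ (z₁ + n * b) (by nlinarith)).2
    have f1 := (hF z₃ (z₃ + n * d) (by nlinarith)).2
    simp only [hΨ, zA, zB]
    have : n * L = n * (2 * ℓ) + n * d + n * b := by rw [hL]; ring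
    linarith
  have hdown : ∀ n : ℤ, n ≤ 0 → Ψ (n * L) ≤ n * (2 * ℓ) - G z₁ - F z₃ := by
    intro n hn
    have hn' : (n : ℝ) ≤ 0 := by exact_mod_cast hn
    have g1 := (hG (z₁ + n * b) z₁ (by nlinarith)).2
    have f1 := (hF (z₃ + n * d) z₃ (by nlinarith)).2
    simp only [hΨ, zA, zB]
    have : n * L = n * (2 * ℓ) + n * d + n * b := by rw [hL]; ring
    linarith
  have hmono : ∀ u u', u ≤ u' → Ψ u ≤ Ψ u' := by
    intro u u' hu
    have m₂ := cov_bounds i₂ hu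
    have m₄ := cov_bounds i₄ hu
    have g1 := (hG (z₁ + A u) (z₁ + A u') (by linarith)).2
    have f1 := (hF (z₃ + B u) (z₃ + B u') (by linarith)).2
    have s := cov_sum_four hℓ hd hℓ hb (L := L) (by linarith) u
    have s' := cov_sum_four hℓ hd hℓ hb (L := L) (by linarith) u'
    have e : ℓ + d + ℓ = 2 * ℓ + d := by ring
    rw [e] at s s'
    have m₁ := (cov_bounds (⟨le_rfl, hℓ, by linarith⟩ : IsArc L 0 ℓ) hu).1
    have m₃ := (cov_bounds (⟨by linarith, hℓ, by linarith⟩ : IsArc L (ℓ + d) ℓ) hu).1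
    simp only [hΨ]
    linarith
  obtain ⟨N, hN⟩ := exists_nat_gt ((|z₂ + G z₁ + F z₃|) / (2 * ℓ))
  rw [div_lt_iff₀ (by linarith)] at hN
  have habs := abs_le.mp (le_refl |z₂ + G z₁ + F z₃|)
  have hhi : z₂ < Ψ (N * L) := by
    have := hup N (by positivity)
    push_cast at this
    linarith
  have hlo : Ψ (-(N * L)) < z₂ := by
    have := hdown (-N) (by simp)
    push_cast at this
    rw [neg_mul] at this
    linarith
  set S := {u | Ψ u = z₂} with hS
  have hSbdd : BddAbove S := by
    refine ⟨N * L, fun u hu => ?_⟩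
    by_contra! hcon
    have h1 := hmono _ _ hcon.le
    have hu' : Ψ u = z₂ := hu
    linarith
  have hSne : S.Nonempty := by
    have hle : -(N * L) ≤ N * L := by
      have : (0 : ℝ) ≤ N * L := by positivity
      linarith
    obtain ⟨u, -, hu⟩ := intermediate_value_Icc hle hΨc.continuousOn ⟨hlo.le, hhi.le⟩
    exact ⟨u, hu⟩
  have hScl : IsClosed S := isClosed_eq hΨc continuous_const
  have hmem : Ψ (sSup S) = z₂ := hScl.csSup_mem hSne hSbdd
  set u := sSup S with hudef
  have hmax : ∀ ε > 0, Ψ (u + ε) ≠ z₂ := by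
    intro ε hε he
    have := le_csSup hSbdd (show u + ε ∈ S from he)
    linarith
  refine ⟨z₁ + A u, u, z₃ + B u, by ring, hmem, by ring, fun ε hε => ⟨?_, ?_⟩⟩
  · rintro ⟨h1, h2, h3⟩
    refine hmax ε hε ?_
    rw [← hmem]
    simp only [hΨ, h1, h2]
    rw [← add_assoc, h3]
    ring
  · rintro ⟨h1, h2, h3⟩
    refine hmax ε hε ?_
    rw [← hmem]
    simp only [hΨ, h1, h2]
    rw [← add_assoc, h3]
    ring

theorem cov_slopeLeOne (h : IsArc L o m) : SlopeLeOne (cov L o m) := fun _ _ hx => cov_bounds h hx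

/-- In genus two there is no third cycle; its covering function is replaced by zero. -/
theorem zero_slopeLeOne : SlopeLeOne (fun _ => (0 : ℝ)) := fun x x' hx => ⟨le_rfl, by linarith⟩

end TropHyper
end

noncomputable section

namespace TropHyper

variable {g : ℕ} {C : ℤ → ℝ}

/-! ### Universal covers of the basic cycles -/

/-- The length of the lower (or upper) edge of the cycle number `i`. -/
def stepLen (g : ℕ) (C : ℤ → ℝ) (i : ℕ) : ℝ := lam g C (i + 1) - lam g C i

/-- The length of the cycle number `i`. -/
def cyc (g : ℕ) (C : ℤ → ℝ) (i : ℕ) : ℝ := 2 * stepLen g C i + p g C (i + 1) + p g C i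

/-- The length that the first `x` units of the cycle number `i` have in common with its right
vertical edge. -/
def covR (g : ℕ) (C : ℤ → ℝ) (i : ℕ) : ℝ → ℝ := cov (cyc g C i) (stepLen g C i) (p g C (i + 1))

/-- The length that the first `x` units of the cycle number `i` have in common with its left
vertical edge. -/
def covL (g : ℕ) (C : ℤ → ℝ) (i : ℕ) : ℝ → ℝ :=
  cov (cyc g C i) (2 * stepLen g C i + p g C (i + 1)) (p g C i)

/-- The length that the first `x` units of the cycle number `i` have in common with its lower
edge. -/
def covB (g : ℕ) (C : ℤ → ℝ) (i : ℕ) : ℝ → ℝ := cov (cyc g C i) 0 (stepLen g C i)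

/-- The length that the first `x` units of the cycle number `i` have in common with its upper
edge. -/
def covT (g : ℕ) (C : ℤ → ℝ) (i : ℕ) : ℝ → ℝ :=
  cov (cyc g C i) (stepLen g C i + p g C (i + 1)) (stepLen g C i)

theorem stepLen_pos (hC : IsGeneric g C) (i : Fin g) : 0 < stepLen g C i :=
  sub_pos.mpr (lam_lt_succ hC i.2)

theorem isArc_R (hC : IsGeneric g C) (i : Fin g) :
    IsArc (cyc g C i) (stepLen g C i) (p g C (i + 1)) := by
  have h1 := stepLen_pos hC i
  have h2 := p_pos hC i.2.le
  have h3 := p_pos hC (i := i + 1) i.2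
  exact ⟨h1.le, h3, by unfold cyc; linarith⟩

theorem isArc_L (hC : IsGeneric g C) (i : Fin g) :
    IsArc (cyc g C i) (2 * stepLen g C i + p g C (i + 1)) (p g C i) := by
  have h1 := stepLen_pos hC i
  have h2 := p_pos hC i.2.le
  have h3 := p_pos hC (i := i + 1) i.2
  exact ⟨by linarith, h2, by unfold cyc; linarith⟩

theorem isArc_B (hC : IsGeneric g C) (i : Fin g) : IsArc (cyc g C i) 0 (stepLen g C i) := by
  have h1 := stepLen_pos hC i
  have h2 := p_pos hC i.2.le
  have h3 := p_pos hC (i := i + 1) i.2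
  exact ⟨le_rfl, h1, by unfold cyc; linarith⟩

theorem isArc_T (hC : IsGeneric g C) (i : Fin g) :
    IsArc (cyc g C i) (stepLen g C i + p g C (i + 1)) (stepLen g C i) := by
  have h1 := stepLen_pos hC i
  have h2 := p_pos hC i.2.le
  have h3 := p_pos hC (i := i + 1) i.2
  exact ⟨by linarith, h1, by unfold cyc; linarith⟩

theorem cyc_pos (hC : IsGeneric g C) (i : Fin g) : 0 < cyc g C i := (isArc_B hC i).length_pos

theorem covB_add (hC : IsGeneric g C) (i : Fin g) (x : ℝ) :
    covB g C i x + covR g C i x + covT g C i x + covL g C i x = x := by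
  have := cov_sum_four (stepLen_pos hC i) (p_pos hC (i := i + 1) i.2) (stepLen_pos hC i)
    (p_pos hC i.2.le) (L := cyc g C i) (by unfold cyc; ring) x
  have e : stepLen g C i + p g C (i + 1) + stepLen g C i = 2 * stepLen g C i + p g C (i + 1) := by
    ring
  rwa [e] at this

/-- The universal cover of the cycle number `i`, with base point `v_i`. -/
def loopPt (g : ℕ) (C : ℤ → ℝ) (i : Fin g) (x : ℝ) : ℝ × ℝ :=
  v g C i + covB g C i x • Edge.prim (lower i) + covR g C i x • Edge.prim (right i) -
    covT g C i x • Edge.prim (upper i) - covL g C i x • Edge.prim (left i)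

/-- The lift of the Abel–Jacobi map to the universal cover of the cycle number `i`. -/
def beta (g : ℕ) (C : ℤ → ℝ) (i : Fin g) (x : ℝ) : Fin g → ℝ :=
  covB g C i x • Edge.dir (lower i) + covR g C i x • Edge.dir (right i) -
    covT g C i x • Edge.dir (upper i) - covL g C i x • Edge.dir (left i)

/-- In its own coordinate the cycle contributes all four edges, hence the full length x. A
neighbouring cycle runs over the common vertical edge in the opposite direction, whence the minus
signs. -/
theorem beta_apply (hC : IsGeneric g C) (i : Fin g) (x : ℝ) (j : Fin g) :
    beta g C i x j = (if i = j then x else 0) - (if (j : ℕ) = i + 1 then covR g C i x else 0) -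
      (if (i : ℕ) = j + 1 then covL g C i x else 0) := by
  have h := covB_add hC i x
  simp only [beta, Edge.dir, Pi.sub_apply, Pi.add_apply, Pi.smul_apply, smul_eq_mul, Fin.val_succ,
    Fin.val_castSucc, Fin.ext_iff]
  rcases lt_trichotomy (i : ℕ) j with hij | hij | hij
  · have e1 : (i : ℕ) ≠ j := by omega
    have e2 : (i : ℕ) + 1 ≠ j + 1 := by omega
    have e3 : (i : ℕ) ≠ j + 1 := by omega
    by_cases e4 : (j : ℕ) = i + 1
    · simp [e4]
    · simp [e1, e3, e4, Ne.symm e4]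
  · have e4 : (j : ℕ) ≠ i + 1 := by omega
    have hij' : i = j := Fin.ext hij
    subst hij'
    simp
    linarith
  · have e1 : (i : ℕ) ≠ j := by omega
    have e2 : (j : ℕ) ≠ i + 1 := by omega
    have e3 : (i : ℕ) + 1 ≠ j := by omega
    by_cases e4 : (i : ℕ) = j + 1
    · simp only [if_neg e1, if_neg e2, if_neg e3, if_pos e4, if_neg (by omega : (i : ℕ) + 1 ≠ j + 1)]
      ring
    · simp [e1, e2, e3, e4]

theorem beta_add_period (hC : IsGeneric g C) (i : Fin g) (n : ℤ) (x : ℝ) :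
    beta g C i (x + n * cyc g C i) = beta g C i x + (n : ℝ) • Qvec g C (alpha g C i) := by
  rw [Qvec_alpha hC]
  simp only [beta, covB, covR, covT, covL, cov_add_period (isArc_B hC i),
    cov_add_period (isArc_R hC i), cov_add_period (isArc_T hC i), cov_add_period (isArc_L hC i),
    Edge.len, Fin.val_succ, Fin.val_castSucc]
  rw [← stepLen]
  module

/-- The lower edge rises and the upper edge falls by the same amount, and p_{i+1} is p_i less twice
that amount. -/
theorem closing (hC : IsGeneric g C) (i : Fin g) :
    stepLen g C i • Edge.prim (lower i) + p g C (i + 1) • Edge.prim (right i) -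
      stepLen g C i • Edge.prim (upper i) - p g C i • Edge.prim (left i) = 0 := by
  have := height_succ hC i.2
  simp only [Edge.prim, stepLen, p, Prod.ext_iff]
  constructor
  · simp
  · simp
    linarith

theorem loopPt_add_period (hC : IsGeneric g C) (i : Fin g) (n : ℤ) (x : ℝ) :
    loopPt g C i (x + n * cyc g C i) = loopPt g C i x := by
  have h : (n : ℝ) • _ = (n : ℝ) • (0 : ℝ × ℝ) := congrArg ((n : ℝ) • ·) (closing hC i)
  rw [smul_zero] at h
  rw [← add_zero (loopPt g C i x), ← h]
  simp only [loopPt, covB, covR, covT, covL, cov_add_period (isArc_B hC i),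
    cov_add_period (isArc_R hC i), cov_add_period (isArc_T hC i), cov_add_period (isArc_L hC i)]
  module

theorem cov_zero_turn {L o m : ℝ} (h : IsArc L o m) (r : ℝ) :
    (r ∈ Icc 0 o → cov L o m r = 0) ∧ (r ∈ Icc o (o + m) → cov L o m r = r - o) ∧
      (r ∈ Icc (o + m) L → cov L o m r = m) := by
  refine ⟨fun hr => ?_, fun hr => ?_, fun hr => ?_⟩
  · simpa using cov_before h 0 hr
  · simpa using cov_inside h 0 hr
  · simpa using cov_after h 0 hr

theorem covs_lower (hC : IsGeneric g C) (i : Fin g) {t : ℝ} (ht : t ∈ Icc 0 (stepLen g C i)) :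
    covB g C i t = t ∧ covR g C i t = 0 ∧ covT g C i t = 0 ∧ covL g C i t = 0 := by
  have h1 := stepLen_pos hC i
  have h2 := p_pos hC i.2.le
  have h3 := p_pos hC (i := i + 1) i.2
  have := ht.1
  have := ht.2
  refine ⟨?_, ?_, ?_, ?_⟩
  · have := (cov_zero_turn (isArc_B hC i) (t)).2.1 ⟨by linarith, by linarith⟩
    simpa [covB] using this
  · exact (cov_zero_turn (isArc_R hC i) _).1 ⟨by linarith, by linarith⟩
  · exact (cov_zero_turn (isArc_T hC i) _).1 ⟨by linarith, by linarith⟩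
  · exact (cov_zero_turn (isArc_L hC i) _).1 ⟨by linarith, by linarith⟩

theorem covs_right (hC : IsGeneric g C) (i : Fin g) {t : ℝ} (ht : t ∈ Icc 0 (p g C (i + 1))) :
    covB g C i (stepLen g C i + t) = stepLen g C i ∧ covR g C i (stepLen g C i + t) = t ∧
      covT g C i (stepLen g C i + t) = 0 ∧ covL g C i (stepLen g C i + t) = 0 := by
  have h1 := stepLen_pos hC i
  have h2 := p_pos hC i.2.le
  have h3 := p_pos hC (i := i + 1) i.2
  have := ht.1
  have := ht.2
  refine ⟨?_, ?_, ?_, ?_⟩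
  · exact (cov_zero_turn (isArc_B hC i) _).2.2 ⟨by linarith, by unfold cyc; linarith⟩
  · have := (cov_zero_turn (isArc_R hC i) (stepLen g C i + t)).2.1 ⟨by linarith, by linarith⟩
    simpa [covR] using this
  · exact (cov_zero_turn (isArc_T hC i) _).1 ⟨by linarith, by linarith⟩
  · exact (cov_zero_turn (isArc_L hC i) _).1 ⟨by linarith, by linarith⟩

theorem covs_upper (hC : IsGeneric g C) (i : Fin g) {t : ℝ} (ht : t ∈ Icc 0 (stepLen g C i)) :
    covB g C i (stepLen g C i + p g C (i + 1) + t) = stepLen g C i ∧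
      covR g C i (stepLen g C i + p g C (i + 1) + t) = p g C (i + 1) ∧
      covT g C i (stepLen g C i + p g C (i + 1) + t) = t ∧
      covL g C i (stepLen g C i + p g C (i + 1) + t) = 0 := by
  have h1 := stepLen_pos hC i
  have h2 := p_pos hC i.2.le
  have h3 := p_pos hC (i := i + 1) i.2
  have := ht.1
  have := ht.2
  refine ⟨?_, ?_, ?_, ?_⟩
  · exact (cov_zero_turn (isArc_B hC i) _).2.2 ⟨by linarith, by unfold cyc; linarith⟩
  · exact (cov_zero_turn (isArc_R hC i) _).2.2 ⟨by linarith, by unfold cyc; linarith⟩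
  · have := (cov_zero_turn (isArc_T hC i) (stepLen g C i + p g C (i + 1) + t)).2.1
      ⟨by linarith, by linarith⟩
    simpa [covT] using this
  · exact (cov_zero_turn (isArc_L hC i) _).1 ⟨by linarith, by linarith⟩

theorem covs_left (hC : IsGeneric g C) (i : Fin g) {t : ℝ} (ht : t ∈ Icc 0 (p g C i)) :
    covB g C i (2 * stepLen g C i + p g C (i + 1) + t) = stepLen g C i ∧
      covR g C i (2 * stepLen g C i + p g C (i + 1) + t) = p g C (i + 1) ∧
      covT g C i (2 * stepLen g C i + p g C (i + 1) + t) = stepLen g C i ∧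
      covL g C i (2 * stepLen g C i + p g C (i + 1) + t) = t := by
  have h1 := stepLen_pos hC i
  have h2 := p_pos hC i.2.le
  have h3 := p_pos hC (i := i + 1) i.2
  have := ht.1
  have := ht.2
  refine ⟨?_, ?_, ?_, ?_⟩
  · exact (cov_zero_turn (isArc_B hC i) _).2.2 ⟨by linarith, by unfold cyc; linarith⟩
  · exact (cov_zero_turn (isArc_R hC i) _).2.2 ⟨by linarith, by unfold cyc; linarith⟩
  · exact (cov_zero_turn (isArc_T hC i) _).2.2 ⟨by linarith, by unfold cyc; linarith⟩
  · have := (cov_zero_turn (isArc_L hC i) (2 * stepLen g C i + p g C (i + 1) + t)).2.1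
      ⟨by linarith, by linarith⟩
    simpa [covL] using this

theorem loopPt_lower (hC : IsGeneric g C) (i : Fin g) {t : ℝ} (ht : t ∈ Icc 0 (stepLen g C i)) :
    loopPt g C i t = (lower i).pt C t := by
  obtain ⟨e1, e2, e3, e4⟩ := covs_lower hC i ht
  simp only [loopPt, e1, e2, e3, e4, Edge.pt, Edge.src]
  module

theorem loopPt_right (hC : IsGeneric g C) (i : Fin g) {t : ℝ} (ht : t ∈ Icc 0 (p g C (i + 1))) :
    loopPt g C i (stepLen g C i + t) = (right i).pt C t := by
  obtain ⟨e1, e2, e3, e4⟩ := covs_right hC i ht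
  have h := v_eq_lower_len hC i
  have h' : Edge.src C (right i) = v g C (i + 1) := rfl
  have h2 : Edge.len C (lower i) = stepLen g C i := rfl
  rw [h2] at h
  simp only [loopPt, e1, e2, e3, e4]
  rw [Edge.pt, h', h, Edge.pt, Edge.src]
  module

theorem loopPt_left (hC : IsGeneric g C) (i : Fin g) {t : ℝ} (ht : t ∈ Icc 0 (p g C i)) :
    loopPt g C i (2 * stepLen g C i + p g C (i + 1) + t) = (left i).pt C (p g C i - t) := by
  obtain ⟨e1, e2, e3, e4⟩ := covs_left hC i ht
  have h := closing hC i
  rw [sub_eq_zero] at h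
  have h' : Edge.src C (left i) = v g C i := rfl
  simp only [loopPt, e1, e2, e3, e4, Edge.pt, h', sub_smul, ← h]
  module

theorem loopPt_upper (hC : IsGeneric g C) (i : Fin g) {t : ℝ} (ht : t ∈ Icc 0 (stepLen g C i)) :
    loopPt g C i (stepLen g C i + p g C (i + 1) + t) = (upper i).pt C (stepLen g C i - t) := by
  obtain ⟨e1, e2, e3, e4⟩ := covs_upper hC i ht
  have h := closing hC i
  rw [sub_eq_zero] at h
  have h' : Edge.src C (upper i) = (left i).pt C ((left i).len C) := w_eq_left_len hC i
  have h'' : Edge.src C (left i) = v g C i := rfl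
  have h3 : Edge.len C (left i) = p g C i := rfl
  simp only [loopPt, e1, e2, e3, e4, Edge.pt, h', h'', h3, sub_smul, ← h]
  module

/-- Each point of the universal cover lies over one of the four edges of the cycle. -/
theorem loop_cases (hC : IsGeneric g C) (i : Fin g) (x : ℝ) :
    ∃ (n : ℤ) (t : ℝ), (t ∈ Ico 0 (stepLen g C i) ∧ x = t + n * cyc g C i) ∨
      (t ∈ Ico 0 (p g C (i + 1)) ∧ x = stepLen g C i + t + n * cyc g C i) ∨
      (t ∈ Ico 0 (stepLen g C i) ∧ x = stepLen g C i + p g C (i + 1) + t + n * cyc g C i) ∨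
      (t ∈ Ico 0 (p g C i) ∧ x = 2 * stepLen g C i + p g C (i + 1) + t + n * cyc g C i) := by
  obtain ⟨n, r, hr, rfl⟩ := exists_int_mul_add (cyc_pos hC i) x
  have hr2 := hr.2
  simp only [cyc] at hr2
  refine ⟨n, ?_⟩
  rcases lt_or_ge r (stepLen g C i) with h1 | h1
  · exact ⟨r, .inl ⟨⟨hr.1, h1⟩, by ring⟩⟩
  rcases lt_or_ge r (stepLen g C i + p g C (i + 1)) with h2 | h2
  · exact ⟨r - stepLen g C i, .inr (.inl ⟨⟨by linarith, by linarith⟩, by ring⟩)⟩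
  rcases lt_or_ge r (2 * stepLen g C i + p g C (i + 1)) with h3 | h3
  · exact ⟨r - (stepLen g C i + p g C (i + 1)),
      .inr (.inr (.inl ⟨⟨by linarith, by linarith⟩, by ring⟩))⟩
  · exact ⟨r - (2 * stepLen g C i + p g C (i + 1)),
      .inr (.inr (.inr ⟨⟨by linarith, by linarith⟩, by ring⟩))⟩

theorem mem_support_iff (i : Fin g) (P : ℝ × ℝ) :
    P ∈ pathSupport (alpha g C i) ↔ P ∈ (lower i).seg C ∨ P ∈ (right i).seg C ∨
      P ∈ (upper i).seg C ∨ P ∈ (left i).seg C := by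
  have h1 : Edge.seg C (upper i) = segment ℝ (w g C (i + 1)) (w g C i) := segment_symm _ _ _
  have h2 : Edge.seg C (left i) = segment ℝ (w g C i) (v g C i) := segment_symm _ _ _
  rw [h1, h2]
  simp only [pathSupport, alpha, List.tail_cons, List.zip_cons_cons, List.zip_nil_right,
    List.mem_cons, List.not_mem_nil, or_false, exists_eq_or_imp, exists_eq_left, mem_ofPred_eq]
  rfl

theorem loopPt_mem_support (hC : IsGeneric g C) (i : Fin g) (x : ℝ) :
    loopPt g C i x ∈ pathSupport (alpha g C i) := by
  rw [mem_support_iff]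
  obtain ⟨n, t, ⟨ht, rfl⟩ | ⟨ht, rfl⟩ | ⟨ht, rfl⟩ | ⟨ht, rfl⟩⟩ := loop_cases hC i x <;>
    have ht' := Ico_subset_Icc_self ht <;> rw [loopPt_add_period hC]
  · rw [loopPt_lower hC i ht']
    exact .inl (Edge.pt_mem_seg hC _ ht')
  · rw [loopPt_right hC i ht']
    exact .inr (.inl (Edge.pt_mem_seg hC _ ht'))
  · rw [loopPt_upper hC i ht']
    exact .inr (.inr (.inl (Edge.pt_mem_seg hC _ ⟨by linarith [ht'.2], sub_le_self _ ht.1⟩)))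
  · rw [loopPt_left hC i ht']
    exact .inr (.inr (.inr (Edge.pt_mem_seg hC _ ⟨by linarith [ht'.2], sub_le_self _ ht.1⟩)))

theorem exists_loopPt (hC : IsGeneric g C) (i : Fin g) {P : ℝ × ℝ}
    (hP : P ∈ pathSupport (alpha g C i)) : ∃ x, loopPt g C i x = P := by
  rw [mem_support_iff] at hP
  simp only [Edge.seg_eq hC] at hP
  rcases hP with ⟨t, ht, rfl⟩ | ⟨t, ht, rfl⟩ | ⟨t, ht, rfl⟩ | ⟨t, ht, rfl⟩
  · exact ⟨_, loopPt_lower hC i ht⟩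
  · exact ⟨_, loopPt_right hC i ht⟩
  · refine ⟨_, (loopPt_upper hC i (t := stepLen g C i - t) ⟨sub_nonneg.mpr ht.2, ?_⟩).trans ?_⟩
    · exact sub_le_self _ ht.1
    · rw [sub_sub_cancel]
  · refine ⟨_, (loopPt_left hC i (t := p g C i - t) ⟨sub_nonneg.mpr ht.2, ?_⟩).trans ?_⟩
    · exact sub_le_self _ ht.1
    · rw [sub_sub_cancel]

theorem support_subset_Gam (hC : IsGeneric g C) (i : Fin g) {P : ℝ × ℝ}
    (hP : P ∈ pathSupport (alpha g C i)) : P ∈ Gam g C := by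
  rw [Gam_eq hC, mem_iUnion]
  rw [mem_support_iff] at hP
  rcases hP with h | h | h | h <;> exact ⟨_, h⟩

/-- Along the lower and the right edge the lift and the potential agree exactly. On the upper edge
they differ by the jump of the potential at w_{i+1}, and on the left edge by the vector of the whole
cycle; both lie in the lattice. -/
theorem jacPot_loopPt (hC : IsGeneric g C) (hg : 0 < g) (i : Fin g) (x : ℝ) :
    jacPot g C (loopPt g C i x) = ((along g C (lam g C i) + beta g C i x : Fin g → ℝ) : Jac g C) := by
  have hs := stepLen_pos hC i
  have hα := Qvec_alpha hC i
  have hmem := Qvec_alpha_mem_lattice (C := C) i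
  have hpr := p_pos hC (i := i + 1) i.2
  have hright : ∀ t, Edge.pot C (right i) t =
      along g C (lam g C i) + stepLen g C i • Edge.dir (lower i) + t • Edge.dir (right i) := by
    intro t
    have := along_add hC i (t := stepLen g C i) ⟨hs.le, le_rfl⟩
    have e : lam g C i + stepLen g C i = lam g C (i + 1) := by simp [stepLen]
    rw [e] at this
    change along g C (lam g C (i + 1)) + _ = _
    rw [this]
  obtain ⟨n, t, h⟩ := loop_cases hC i x
  have hper : ∀ y, x = y + n * cyc g C i → ∀ (e : Edge g) (s : ℝ), s ∈ Icc 0 (e.len C) →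
      loopPt g C i y = e.pt C s →
      along g C (lam g C i) + beta g C i y - e.pot C s ∈ lattice g C →
      jacPot g C (loopPt g C i x) =
        ((along g C (lam g C i) + beta g C i x : Fin g → ℝ) : Jac g C) := by
    rintro y rfl e s hs he hsub
    rw [loopPt_add_period hC, beta_add_period hC, he, jacPot_pt hC hg e hs, eq_comm,
      QuotientAddGroup.eq_iff_sub_mem]
    have hn : (n : ℝ) • Qvec g C (alpha g C i) ∈ lattice g C := by
      have := zsmul_mem hmem n
      rwa [← Int.cast_smul_eq_zsmul ℝ] at this
    have := add_mem hsub hn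
    convert this using 1
    abel
  rcases h with ⟨ht, hx⟩ | ⟨ht, hx⟩ | ⟨ht, hx⟩ | ⟨ht, hx⟩ <;> have ht' := Ico_subset_Icc_self ht
  · refine hper _ hx _ _ ht' (loopPt_lower hC i ht') ?_
    obtain ⟨e1, e2, e3, e4⟩ := covs_lower hC i ht'
    have := along_add hC i ht'
    simp only [beta, e1, e2, e3, e4, Edge.pot, this]
    convert zero_mem (lattice g C) using 1
    module
  · refine hper _ hx _ _ ht' (loopPt_right hC i ht') ?_
    obtain ⟨e1, e2, e3, e4⟩ := covs_right hC i ht'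
    rw [hright]
    simp only [beta, e1, e2, e3, e4]
    convert zero_mem (lattice g C) using 1
    module
  · have ht2 : stepLen g C i - t ∈ Icc 0 ((upper i).len C) :=
      ⟨by linarith [ht'.2], sub_le_self _ ht.1⟩
    have hlen : Edge.len C (upper i) = stepLen g C i := rfl
    refine hper _ hx _ _ ht2 (loopPt_upper hC i ht') ?_
    obtain ⟨e1, e2, e3, e4⟩ := covs_upper hC i ht'
    have hc := Edge.pot_compat hC hg (e := right i) (e' := upper i) (s := p g C (i + 1))
      (t := stepLen g C i) ⟨hpr.le, le_rfl⟩ ⟨hs.le, le_rfl⟩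
      ((w_eq_right_len hC i).symm.trans (w_eq_upper_len hC i))
    have hsub := Edge.pot_sub hC (upper i) (s := stepLen g C i) (t := stepLen g C i - t)
      ⟨hs.le, le_rfl⟩ ht2
    rw [hright] at hc
    convert hc using 1
    rw [sub_eq_iff_eq_add] at hsub
    rw [hsub]
    simp only [beta, e1, e2, e3, e4]
    module
  · have ht2 : p g C i - t ∈ Icc 0 ((left i).len C) :=
      ⟨by linarith [ht'.2], sub_le_self _ ht.1⟩
    refine hper _ hx _ _ ht2 (loopPt_left hC i ht') ?_
    obtain ⟨e1, e2, e3, e4⟩ := covs_left hC i ht'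
    convert hmem using 1
    rw [hα]
    have hl : Edge.pot C (left i) (p g C i - t) =
      along g C (lam g C i) + (p g C i - t) • Edge.dir (left i) := rfl
    have h1 : Edge.len C (left i) = p g C i := rfl
    have h2 : Edge.len C (right i) = p g C (i + 1) := rfl
    have h3 : Edge.len C (lower i) = stepLen g C i := rfl
    have h4 : Edge.len C (upper i) = stepLen g C i := rfl
    rw [hl, h1, h2, h3, h4]
    simp only [beta, e1, e2, e3, e4]
    module

/-! ### The divisors -/

/-- The vertical edge number `k` without its end points. -/
def openVert (g : ℕ) (C : ℤ → ℝ) (k : ℕ) : Set (ℝ × ℝ) :=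
  {lam g C k} ×ˢ Ioo (height g C k) (C (-1) - height g C k)

theorem bounds_of_mem_support (hC : IsGeneric g C) (i : Fin g) {P : ℝ × ℝ}
    (hP : P ∈ pathSupport (alpha g C i)) :
    P.1 ∈ Icc (lam g C i) (lam g C (i + 1)) ∧ prof g C P.1 ≤ P.2 ∧
      P.2 ≤ C (-1) - prof g C P.1 := by
  rw [mem_support_iff, mem_seg_lower hC, mem_seg_upper hC, mem_seg_vert hC, mem_seg_vert hC] at hP
  have h1 := two_prof_lt hC P.1
  have h2 := lam_lt_succ hC i.2
  rcases hP with ⟨h, h'⟩ | ⟨h, h'⟩ | ⟨h, h'⟩ | ⟨h, h'⟩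
  · exact ⟨h, by linarith, by linarith⟩
  · simp only [Fin.val_succ] at h h'
    rw [h, prof_lam hC i.2]
    exact ⟨⟨h2.le, le_rfl⟩, h'⟩
  · exact ⟨h, by linarith, by linarith⟩
  · simp only [Fin.val_castSucc] at h h'
    rw [h, prof_lam hC i.2.le]
    exact ⟨⟨le_rfl, h2.le⟩, h'⟩

theorem support_inter (hC : IsGeneric g C) {i j : Fin g} (hij : (j : ℕ) = i + 1) :
    pathSupport (alpha g C i) ∩ pathSupport (alpha g C j) =
      {lam g C j} ×ˢ Icc (height g C j) (C (-1) - height g C j) := by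
  ext P
  constructor
  · rintro ⟨h1, h2⟩
    obtain ⟨a1, a2, a3⟩ := bounds_of_mem_support hC i h1
    obtain ⟨b1, -, -⟩ := bounds_of_mem_support hC j h2
    have hX : P.1 = lam g C j := le_antisymm (by rw [hij]; exact a1.2) b1.1
    rw [hX, prof_lam hC j.2.le] at a2 a3
    exact ⟨hX, a2, a3⟩
  · rintro ⟨h1, h2⟩
    constructor
    · refine (mem_support_iff i P).mpr (.inr (.inl ((mem_seg_vert hC _ _).mpr ?_)))
      rw [Fin.val_succ, ← hij]
      exact ⟨h1, h2⟩
    · exact (mem_support_iff j P).mpr (.inr (.inr (.inr ((mem_seg_vert hC _ _).mpr ⟨h1, h2⟩))))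

/-- The common edge is the product of a point and an interval, so its extreme points are the two end
points of the interval. -/
theorem alphaInter_succ (hC : IsGeneric g C) {i j : Fin g} (hij : (j : ℕ) = i + 1) :
    alphaInter g C i j = openVert g C j := by
  have h : height g C j ≤ C (-1) - height g C j := by
    have := p_pos hC j.2.le
    rw [p] at this
    linarith
  unfold alphaInter openVert
  rw [support_inter hC hij, extremePoints_prod, extremePoints_singleton, extremePoints_Icc h]
  ext P
  simp only [mem_sdiff, mem_prod, mem_singleton_iff, mem_Icc, mem_insert_iff, mem_Ioo]
  constructor
  · rintro ⟨⟨h1, h2, h3⟩, h4⟩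
    have h4' := not_or.mp fun h => h4 ⟨h1, h⟩
    exact ⟨h1, lt_of_le_of_ne h2 (Ne.symm h4'.1), lt_of_le_of_ne h3 h4'.2⟩
  · rintro ⟨h1, h2, h3⟩
    exact ⟨⟨h1, h2.le, h3.le⟩, fun h => h.2.elim h2.ne' h3.ne⟩

theorem alphaInter_comm (i j : Fin g) : alphaInter g C i j = alphaInter g C j i := by
  unfold alphaInter
  rw [inter_comm]

theorem alphaInter_eq_empty (hC : IsGeneric g C) {i j : Fin g} (hij : (i : ℕ) + 1 < j) :
    alphaInter g C i j = ∅ := by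
  have : pathSupport (alpha g C i) ∩ pathSupport (alpha g C j) = ∅ := by
    refine eq_empty_of_forall_notMem fun P hP => ?_
    have h1 := (bounds_of_mem_support hC i hP.1).1.2
    have h2 := (bounds_of_mem_support hC j hP.2).1.1
    have := lam_lt_lam hC hij j.2.le
    linarith
  unfold alphaInter
  rw [this, empty_sdiff]

theorem index_of_mem_openVert (hC : IsGeneric g C) {k : Fin g} {i : ℕ} (hi : i + 1 < g)
    {P : ℝ × ℝ} (hP : P ∈ pathSupport (alpha g C k)) (h : P ∈ openVert g C (i + 1)) :
    (k : ℕ) = i ∨ (k : ℕ) = i + 1 := by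
  obtain ⟨h1, -⟩ := bounds_of_mem_support hC k hP
  have hX : P.1 = lam g C (i + 1) := h.1
  rw [hX] at h1
  have a : (k : ℕ) ≤ i + 1 := by
    by_contra! hlt
    exact absurd h1.1 (not_le.mpr (lam_lt_lam hC hlt k.2.le))
  have b : i ≤ (k : ℕ) := by
    by_contra! hlt
    exact absurd h1.2 (not_le.mpr (lam_lt_lam hC (by omega) hi.le))
  omega

/-- Only neighbouring cycles meet, and a point inside their common edge lies on no third cycle. So
the condition on the multiset concerns only the two points that are assigned to these two cycles. -/
theorem mem_DSet_iff (hC : IsGeneric g C) {P : Fin g → ℝ × ℝ}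
    (hP : ∀ i, P i ∈ pathSupport (alpha g C i)) :
    Finset.univ.val.map P ∈ DSet g C ↔ ∀ i j : Fin g, (j : ℕ) = i + 1 →
      ¬ (P i ∈ openVert g C j ∧ P j ∈ openVert g C j) := by
  classical
  have hcard : ∀ S : Set (ℝ × ℝ), Multiset.card ((Finset.univ.val.map P).filter (· ∈ S)) =
      (Finset.univ.filter fun k => P k ∈ S).card := by
    intro S
    rw [Multiset.filter_map, Multiset.card_map]
    rfl
  constructor
  · rintro ⟨-, -, h⟩ i j hij ⟨h1, h2⟩
    have hne : i ≠ j := by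
      rintro rfl
      omega
    have h3 := h i j hne
    have h3' : (Finset.univ.filter fun k => P k ∈ alphaInter g C i j).card ≤ 1 := by
      rw [← hcard]
      convert h3
    rw [alphaInter_succ hC hij, Finset.card_le_one] at h3'
    exact hne (h3' i (by simpa using h1) j (by simpa using h2))
  · intro h
    refine ⟨⟨by simp, ?_⟩, ⟨P, rfl, hP⟩, ?_⟩
    · intro Q hQ
      obtain ⟨i, -, rfl⟩ := Multiset.mem_map.mp hQ
      exact support_subset_Gam hC i (hP i)
    · have key : ∀ i j : Fin g, i < j →
          (Finset.univ.filter fun k => P k ∈ alphaInter g C i j).card ≤ 1 := by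
        intro i j hij
        have hij' : (i : ℕ) < j := hij
        rcases Nat.lt_or_ge (i + 1) j with hlt | hge
        · rw [alphaInter_eq_empty hC hlt]
          simp
        · have hj : (j : ℕ) = i + 1 := by omega
          rw [alphaInter_succ hC hj, Finset.card_le_one]
          intro a ha c hc
          simp only [Finset.mem_filter, Finset.mem_univ, true_and] at ha hc
          by_contra hac
          have ha' := index_of_mem_openVert hC (i := i) (by omega) (hP a) (by rwa [← hj])
          have hc' := index_of_mem_openVert hC (i := i) (by omega) (hP c) (by rwa [← hj])
          rcases ha' with ha' | ha' <;> rcases hc' with hc' | hc'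
          · exact hac (Fin.ext (ha'.trans hc'.symm))
          · obtain rfl : a = i := Fin.ext ha'
            obtain rfl : c = j := Fin.ext (hc'.trans hj.symm)
            exact h a c hj ⟨ha, hc⟩
          · obtain rfl : c = i := Fin.ext hc'
            obtain rfl : a = j := Fin.ext (ha'.trans hj.symm)
            exact h c a hj ⟨hc, ha⟩
          · exact hac (Fin.ext (ha'.trans hc'.symm))
      intro i j hij
      have := hcard (alphaInter g C i j)
      rcases hij.lt_or_gt with hlt | hlt
      · have h1 := key i j hlt
        rw [← this] at h1
        convert h1
      · have h1 := key j i hlt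
        rw [alphaInter_comm, ← this] at h1
        convert h1

theorem pt_mem_openVert {k : Fin (g + 1)} {t : ℝ} (ht : t ∈ Ioo 0 (p g C k)) :
    Edge.pt C (.inl k : Edge g) t ∈ openVert g C k := by
  rw [pt_vert]
  have := ht.2
  unfold p at this
  exact ⟨rfl, by simp only; linarith [ht.1], by simp only; linarith⟩

theorem loopPt_mem_openVert_right (hC : IsGeneric g C) (i : Fin g) {x : ℝ}
    (h : loopPt g C i x ∈ openVert g C (i + 1)) :
    ∃ (n : ℤ) (t : ℝ), t ∈ Ioo 0 (p g C (i + 1)) ∧ x = stepLen g C i + t + n * cyc g C i := by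
  have hlt := lam_lt_succ hC i.2
  obtain ⟨n, t, hc⟩ := loop_cases hC i x
  rcases hc with ⟨ht, rfl⟩ | ⟨ht, rfl⟩ | ⟨ht, rfl⟩ | ⟨ht, rfl⟩ <;>
    have ht' := Ico_subset_Icc_self ht <;> rw [loopPt_add_period hC] at h
  · rw [loopPt_lower hC i ht', pt_lower hC i ht'] at h
    obtain ⟨h1, h2, -⟩ := h
    simp only [mem_singleton_iff] at h1 h2
    rw [h1, prof_lam hC i.2] at h2
    exact absurd h2 (lt_irrefl _)
  · refine ⟨n, t, ⟨lt_of_le_of_ne ht.1 ?_, ht.2⟩, rfl⟩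
    rintro rfl
    rw [loopPt_right hC i ht', pt_vert] at h
    have := h.2.1
    simp at this
  · have ht2 : stepLen g C i - t ∈ Icc 0 ((upper i).len C) :=
      ⟨by linarith [ht'.2], sub_le_self _ ht.1⟩
    rw [loopPt_upper hC i ht', pt_upper hC i ht2] at h
    obtain ⟨h1, -, h2⟩ := h
    simp only [mem_singleton_iff] at h1 h2
    rw [h1, prof_lam hC i.2] at h2
    exact absurd h2 (lt_irrefl _)
  · rw [loopPt_left hC i ht', pt_vert] at h
    exact absurd h.1 hlt.ne

theorem loopPt_mem_openVert_left (hC : IsGeneric g C) (i : Fin g) {x : ℝ}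
    (h : loopPt g C i x ∈ openVert g C i) :
    ∃ (n : ℤ) (t : ℝ), t ∈ Ioo 0 (p g C i) ∧
      x = 2 * stepLen g C i + p g C (i + 1) + t + n * cyc g C i := by
  have hlt := lam_lt_succ hC i.2
  obtain ⟨n, t, hc⟩ := loop_cases hC i x
  rcases hc with ⟨ht, rfl⟩ | ⟨ht, rfl⟩ | ⟨ht, rfl⟩ | ⟨ht, rfl⟩ <;>
    have ht' := Ico_subset_Icc_self ht <;> rw [loopPt_add_period hC] at h
  · rw [loopPt_lower hC i ht', pt_lower hC i ht'] at h
    obtain ⟨h1, h2, -⟩ := h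
    simp only [mem_singleton_iff] at h1 h2
    rw [h1, prof_lam hC i.2.le] at h2
    exact absurd h2 (lt_irrefl _)
  · rw [loopPt_right hC i ht', pt_vert] at h
    exact absurd h.1 hlt.ne'
  · have ht2 : stepLen g C i - t ∈ Icc 0 ((upper i).len C) :=
      ⟨by linarith [ht'.2], sub_le_self _ ht.1⟩
    rw [loopPt_upper hC i ht', pt_upper hC i ht2] at h
    obtain ⟨h1, -, h2⟩ := h
    simp only [mem_singleton_iff] at h1 h2
    rw [h1, prof_lam hC i.2.le] at h2
    exact absurd h2 (lt_irrefl _)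
  · refine ⟨n, t, ⟨lt_of_le_of_ne ht.1 ?_, ht.2⟩, rfl⟩
    rintro rfl
    rw [loopPt_left hC i ht', pt_vert] at h
    have := h.2.2
    simp only [p, Fin.val_castSucc] at this
    linarith

/-- Two points that move in opposite directions over a common vertical edge, and that are not both
in its interior at the beginning and at the end, exchange their places. -/
theorem loopPt_swap (hC : IsGeneric g C) {i j : Fin g} (hij : (j : ℕ) = i + 1) {x u δ : ℝ}
    (hδ : 0 < δ) {n k : ℤ} (hx : n * cyc g C i + stepLen g C i ≤ x)
    (hx' : x + δ ≤ n * cyc g C i + (stepLen g C i + p g C (i + 1)))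
    (hu : k * cyc g C j + (2 * stepLen g C j + p g C (j + 1)) ≤ u)
    (hu' : u + δ ≤ k * cyc g C j + cyc g C j)
    (h : ¬ (loopPt g C i x ∈ openVert g C j ∧ loopPt g C j u ∈ openVert g C j))
    (h' : ¬ (loopPt g C i (x + δ) ∈ openVert g C j ∧ loopPt g C j (u + δ) ∈ openVert g C j)) :
    loopPt g C i x = loopPt g C j (u + δ) ∧ loopPt g C j u = loopPt g C i (x + δ) := by
  have he : right i = left j := by
    simp only [Sum.inl.injEq, Fin.ext_iff, Fin.val_succ, Fin.val_castSucc]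
    omega
  set b := p g C j with hb
  have hpi : p g C (i + 1) = b := by rw [← hij]
  obtain ⟨τ, rfl⟩ : ∃ τ, x = stepLen g C i + τ + n * cyc g C i :=
    ⟨x - n * cyc g C i - stepLen g C i, by ring⟩
  obtain ⟨σ, rfl⟩ : ∃ σ, u = 2 * stepLen g C j + p g C (j + 1) + σ + k * cyc g C j :=
    ⟨u - k * cyc g C j - (2 * stepLen g C j + p g C (j + 1)), by ring⟩
  have hcj : cyc g C j = 2 * stepLen g C j + p g C (j + 1) + b := rfl
  have h1 : 0 ≤ τ := by linarith
  have h2 : τ + δ ≤ b := by linarith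
  have h3 : 0 ≤ σ := by linarith
  have h4 : σ + δ ≤ b := by linarith
  have e1 : ∀ s ∈ Icc 0 b, loopPt g C i (stepLen g C i + s + n * cyc g C i) = (left j).pt C s := by
    intro s hs
    rw [loopPt_add_period hC, loopPt_right hC i (by rwa [hpi]), he]
  have e2 : ∀ s ∈ Icc 0 b,
      loopPt g C j (2 * stepLen g C j + p g C (j + 1) + s + k * cyc g C j) =
        (left j).pt C (b - s) := by
    intro s hs
    rw [loopPt_add_period hC, loopPt_left hC j hs]
  have r1 : stepLen g C i + τ + n * cyc g C i + δ = stepLen g C i + (τ + δ) + n * cyc g C i := by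
    ring
  have r2 : 2 * stepLen g C j + p g C (j + 1) + σ + k * cyc g C j + δ =
      2 * stepLen g C j + p g C (j + 1) + (σ + δ) + k * cyc g C j := by ring
  rw [r1, r2, e1 _ ⟨by linarith, h2⟩, e2 _ ⟨by linarith, h4⟩] at h'
  rw [r1, r2, e1 _ ⟨by linarith, h2⟩, e2 _ ⟨by linarith, h4⟩, e1 _ ⟨h1, by linarith⟩,
    e2 _ ⟨h3, by linarith⟩]
  rw [e1 _ ⟨h1, by linarith⟩, e2 _ ⟨h3, by linarith⟩] at h
  have op : ∀ s, 0 < s → s < b → (left j).pt C s ∈ openVert g C j := fun s hs hs' =>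
    pt_mem_openVert (k := j.castSucc) ⟨hs, hs'⟩
  have c1 : τ = 0 ∨ σ = 0 := by
    by_contra! hcon
    have hτ := lt_of_le_of_ne h1 (Ne.symm hcon.1)
    have hσ := lt_of_le_of_ne h3 (Ne.symm hcon.2)
    exact h ⟨op _ hτ (by linarith), op _ (by linarith) (by linarith)⟩
  have c2 : τ + δ = b ∨ σ + δ = b := by
    by_contra! hcon
    have hτ := lt_of_le_of_ne h2 hcon.1
    have hσ := lt_of_le_of_ne h4 hcon.2
    exact h' ⟨op _ (by linarith) (by linarith), op _ (by linarith) (by linarith)⟩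
  -- At the beginning one of the two points is at its starting vertex, and at the end one has
  -- crossed the whole edge. In every combination this gives τ + δ = b - σ and b - (σ + δ) = τ: each
  -- final position is the other's initial one.
  have key : τ + σ + δ = b := by
    rcases c1 with c1 | c1 <;> rcases c2 with c2 | c2 <;> linarith
  constructor
  · congr 1
    linarith
  · congr 1
    linarith

/-- Up to a constant of the Jacobian, which depends only on `P₀`, the Abel–Jacobi map is the sum of
the lifts `beta`. -/
theorem eta_loopPt (hC : IsGeneric g C) (hg : 0 < g) {P₀ : ℝ × ℝ} (h₀ : P₀ ∈ Gam g C)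
    (x : Fin g → ℝ) :
    eta g C P₀ (Finset.univ.val.map fun i => loopPt g C i (x i)) =
      ((∑ i, beta g C i (x i) : Fin g → ℝ) : Jac g C) +
        (((∑ i : Fin g, along g C (lam g C i) : Fin g → ℝ) : Jac g C) -
          g • jacPot g C P₀) := by
  unfold eta
  rw [Multiset.map_map]
  change ∑ i : Fin g, abelJacobiPt g C P₀ (loopPt g C i (x i)) = _
  have : ∀ i : Fin g, abelJacobiPt g C P₀ (loopPt g C i (x i)) =
      (beta g C i (x i) : Jac g C) + ((along g C (lam g C i) : Jac g C) - jacPot g C P₀) := by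
    intro i
    rw [abelJacobiPt_eq hC hg h₀ (support_subset_Gam hC i (loopPt_mem_support hC i _)),
      jacPot_loopPt hC hg, QuotientAddGroup.mk_add]
    abel
  simp only [this, Finset.sum_add_distrib, Finset.sum_sub_distrib, Finset.sum_const,
    Finset.card_univ, Fintype.card_fin]
  have hs : ∀ f : Fin g → Fin g → ℝ, ((∑ i, f i : Fin g → ℝ) : Jac g C) =
      ∑ i, ((f i : Fin g → ℝ) : Jac g C) := fun f =>
    map_sum (QuotientAddGroup.mk' (lattice g C)) f Finset.univ
  rw [hs, hs]

end TropHyper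
end

noncomputable section

namespace TropHyper

variable {g : ℕ} {C : ℤ → ℝ}

/-! ### Bijectivity of the Abel–Jacobi map -/

theorem cov_advance_inside {L o m : ℝ} (h : IsArc L o m) (n : ℤ) {x ε : ℝ} (hε : 0 ≤ ε)
    (hx : n * L + o ≤ x) (hy : x + ε ≤ n * L + (o + m)) :
    cov L o m (x + ε) = cov L o m x + ε := by
  have h1 := cov_inside h n (r := x - n * L) ⟨by linarith, by linarith⟩
  have h2 := cov_inside h n (r := x + ε - n * L) ⟨by linarith, by linarith⟩
  rw [add_sub_cancel] at h1 h2
  rw [h1, h2]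
  ring

theorem cov_advance_before {L o m : ℝ} (h : IsArc L o m) (n : ℤ) {x y : ℝ} (hxy : x ≤ y)
    (hx : n * L ≤ x) (hy : y ≤ n * L + o) : cov L o m y = cov L o m x := by
  have h1 := cov_before h n (r := x - n * L) ⟨by linarith, by linarith⟩
  have h2 := cov_before h n (r := y - n * L) ⟨by linarith, by linarith⟩
  rw [add_sub_cancel] at h1 h2
  rw [h1, h2]

theorem cov_advance_after {L o m : ℝ} (h : IsArc L o m) (n : ℤ) {x y : ℝ} (hxy : x ≤ y)
    (hx : n * L + (o + m) ≤ x) (hy : y ≤ n * L + L) : cov L o m y = cov L o m x := by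
  have h1 := cov_after h n (r := x - n * L) ⟨by linarith, by linarith⟩
  have h2 := cov_after h n (r := y - n * L) ⟨by linarith, by linarith⟩
  rw [add_sub_cancel] at h1 h2
  rw [h1, h2]

theorem cyc_eq (i : ℕ) :
    cyc g C i = 2 * stepLen g C i + p g C (i + 1) + p g C i := rfl

/-- Two points in the interior of a common vertical edge can be moved in opposite directions. -/
theorem exists_advance (hC : IsGeneric g C) {i j : Fin g} (hij : (j : ℕ) = i + 1) {x u : ℝ}
    (hx : loopPt g C i x ∈ openVert g C j) (hu : loopPt g C j u ∈ openVert g C j) :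
    ∃ ε > 0, covR g C i (x + ε) = covR g C i x + ε ∧ covL g C i (x + ε) = covL g C i x ∧
      covL g C j (u + ε) = covL g C j u + ε ∧ covR g C j (u + ε) = covR g C j u := by
  obtain ⟨n, t, ht, rfl⟩ := loopPt_mem_openVert_right hC i (by rwa [← hij])
  obtain ⟨k, s, hs, rfl⟩ := loopPt_mem_openVert_left hC j hu
  have h1 := stepLen_pos hC i
  have h2 := stepLen_pos hC j
  have h3 := p_pos hC (i := j + 1) j.2
  obtain ⟨ε, hε, hεt, hεs⟩ : ∃ ε > 0, ε ≤ p g C (i + 1) - t ∧ ε ≤ p g C j - s :=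
    ⟨min (p g C (i + 1) - t) (p g C j - s), lt_min (by linarith [ht.2]) (by linarith [hs.2]),
      min_le_left _ _, min_le_right _ _⟩
  have ht1 := ht.1
  have hs1 := hs.1
  refine ⟨ε, hε, ?_, ?_, ?_, ?_⟩
  · exact cov_advance_inside (isArc_R hC i) n hε.le (by linarith) (by linarith)
  · exact cov_advance_before (isArc_L hC i) n (by linarith) (by linarith) (by linarith)
  · exact cov_advance_inside (isArc_L hC j) k hε.le (by linarith) (by linarith)
  · refine cov_advance_after (isArc_R hC j) k (by linarith) (by linarith) ?_
    have := cyc_eq (g := g) (C := C) j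
    linarith

/-- The divisor over a point of the product of the universal covers. -/
def loopDiv (g : ℕ) (C : ℤ → ℝ) (x : Fin g → ℝ) : Multiset (ℝ × ℝ) :=
  Finset.univ.val.map fun i => loopPt g C i (x i)

theorem exists_loopDiv (hC : IsGeneric g C) {D : Multiset (ℝ × ℝ)} (hD : D ∈ DSet g C) :
    ∃ x, D = loopDiv g C x := by
  obtain ⟨-, ⟨P, rfl, hP⟩, -⟩ := hD
  choose x hx using fun i => exists_loopPt hC i (hP i)
  exact ⟨x, by simp only [loopDiv, hx]⟩

theorem loopDiv_mem_iff (hC : IsGeneric g C) (x : Fin g → ℝ) :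
    loopDiv g C x ∈ DSet g C ↔ ∀ i j : Fin g, (j : ℕ) = i + 1 →
      ¬ (loopPt g C i (x i) ∈ openVert g C j ∧ loopPt g C j (x j) ∈ openVert g C j) :=
  mem_DSet_iff hC fun i => loopPt_mem_support hC i (x i)

theorem loopDiv_add_period (hC : IsGeneric g C) (x : Fin g → ℝ) (n : Fin g → ℤ) :
    loopDiv g C (fun i => x i + n i * cyc g C i) = loopDiv g C x := by
  simp only [loopDiv, loopPt_add_period hC]

/-- The lift of the Abel–Jacobi map to the product of the universal covers. -/
def sumBeta (g : ℕ) (C : ℤ → ℝ) (x : Fin g → ℝ) : Fin g → ℝ := ∑ i, beta g C i (x i)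

theorem sumBeta_add_period (hC : IsGeneric g C) (x : Fin g → ℝ) (n : Fin g → ℤ) :
    sumBeta g C (fun i => x i + n i * cyc g C i) =
      sumBeta g C x + ∑ i, (n i : ℝ) • Qvec g C (alpha g C i) := by
  simp only [sumBeta, beta_add_period hC, Finset.sum_add_distrib]

/-- Bijectivity of the Abel–Jacobi map follows from the corresponding facts on the product of the
universal covers. -/
theorem bijOn_eta (hC : IsGeneric g C) (hg : 0 < g)
    (hinj : ∀ x x' : Fin g → ℝ, loopDiv g C x ∈ DSet g C → loopDiv g C x' ∈ DSet g C →
      sumBeta g C x = sumBeta g C x' → loopDiv g C x = loopDiv g C x')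
    (hsurj : ∀ z, ∃ x, sumBeta g C x = z ∧ loopDiv g C x ∈ DSet g C)
    {P₀ : ℝ × ℝ} (h₀ : P₀ ∈ Gam g C) : BijOn (eta g C P₀) (DSet g C) univ := by
  refine ⟨fun _ _ => mem_univ _, ?_, ?_⟩
  · intro D hD D' hD' he
    obtain ⟨x, rfl⟩ := exists_loopDiv hC hD
    obtain ⟨x', rfl⟩ := exists_loopDiv hC hD'
    simp only [loopDiv] at he
    rw [eta_loopPt hC hg h₀, eta_loopPt hC hg h₀, add_left_inj,
      QuotientAddGroup.eq_iff_sub_mem, mem_lattice_iff] at he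
    obtain ⟨n, hn⟩ := he
    -- The lattice vector is absorbed by full turns of the second tuple, which do not change its
    -- divisor.
    have h1 : sumBeta g C x = sumBeta g C (fun i => x' i + n i * cyc g C i) := by
      rw [sumBeta_add_period hC, ← hn]
      simp [sumBeta]
    have h2 := loopDiv_add_period hC x' n
    rw [← h2]
    exact hinj _ _ hD (by rwa [h2]) h1
  · intro c _
    set k := (((∑ i : Fin g, along g C (lam g C i) : Fin g → ℝ) : Jac g C) -
      g • jacPot g C P₀) with hk
    obtain ⟨z, hz⟩ := QuotientAddGroup.mk_surjective (c - k)
    obtain ⟨x, hx, hD⟩ := hsurj z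
    refine ⟨_, hD, ?_⟩
    have := eta_loopPt hC hg h₀ x
    rw [← hk] at this
    rw [loopDiv, this]
    change ((sumBeta g C x : Fin g → ℝ) : Jac g C) + k = c
    rw [hx, hz, sub_add_cancel]

/-- Injectivity follows from the case of comparable coordinates. -/
theorem inj_of_lt (k : Fin g)
    (heq : ∀ x x' : Fin g → ℝ, sumBeta g C x = sumBeta g C x' → x k = x' k → x = x')
    (hlt : ∀ x x' : Fin g → ℝ, loopDiv g C x ∈ DSet g C → loopDiv g C x' ∈ DSet g C →
      sumBeta g C x = sumBeta g C x' → x k < x' k → loopDiv g C x = loopDiv g C x')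
    (x x' : Fin g → ℝ) (hx : loopDiv g C x ∈ DSet g C) (hx' : loopDiv g C x' ∈ DSet g C)
    (h : sumBeta g C x = sumBeta g C x') : loopDiv g C x = loopDiv g C x' := by
  rcases lt_trichotomy (x k) (x' k) with hk | hk | hk
  · exact hlt x x' hx hx' h hk
  · rw [heq x x' h hk]
  · exact (hlt x' x hx' hx h.symm hk).symm

/-! ### The equations and their solutions in genus two. -/

section GenusTwo

theorem sumBeta_two (hC : IsGeneric 2 C) (x : Fin 2 → ℝ) :
    sumBeta 2 C x = ![x 0 - covL 2 C 1 (x 1), x 1 - covR 2 C 0 (x 0)] := by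
  ext j
  fin_cases j <;> simp [sumBeta, Fin.sum_univ_two, beta_apply hC]

theorem loopDiv_two (x : Fin 2 → ℝ) :
    loopDiv 2 C x = {loopPt 2 C 0 (x 0), loopPt 2 C 1 (x 1)} := rfl

/-- Points with the same image on the product of the universal covers, for genus two. -/
theorem rigidity_two (hC : IsGeneric 2 C) {x x' : Fin 2 → ℝ}
    (h : sumBeta 2 C x = sumBeta 2 C x') (hlt : x 1 < x' 1) :
    x' 0 - x 0 = x' 1 - x 1 ∧
    (∃ n : ℤ, n * cyc 2 C 1 + (2 * stepLen 2 C 1 + p 2 C 2) ≤ x 1 ∧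
      x' 1 ≤ n * cyc 2 C 1 + cyc 2 C 1) ∧
    ∃ n : ℤ, n * cyc 2 C 0 + stepLen 2 C 0 ≤ x 0 ∧
      x' 0 ≤ n * cyc 2 C 0 + (stepLen 2 C 0 + p 2 C 1) := by
  rw [sumBeta_two hC, sumBeta_two hC] at h
  have e0 := congrFun h 0
  have e1 := congrFun h 1
  simp only [Matrix.cons_val_zero, Matrix.cons_val_one] at e0 e1
  have h0 := stepLen_pos hC 0
  have h1 := stepLen_pos hC 1
  have p1 := p_pos hC (i := 1) (by norm_num)
  have p2 := p_pos hC (i := 2) (by norm_num)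
  have hR := isArc_R hC 0
  -- With F = 0 and y = covR(u) the third equation is trivial, and the alternative in which y moves
  -- is impossible.
  rcases rigidity (G := covR 2 C 0) (F := fun _ => 0) (y := covR 2 C 1 (x 1))
    (y' := covR 2 C 1 (x' 1)) h1 p2 p1 (cyc_eq 1) (cov_slopeLeOne hR) zero_slopeLeOne hlt
    e0.symm (by linarith) (by change covR 2 C 1 _ - covR 2 C 1 _ = covR 2 C 1 _ - covR 2 C 1 _; ring)
    with ⟨n, a1, a2, a3, a4, -⟩ | ⟨n, a1, a2, a3, a4, -⟩
  · exact ⟨a3, ⟨n, a1, a2⟩, cov_steep hR h0 (by linarith) a4⟩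
  · linarith

/-- By rigidity two different tuples with the same image have points that cross the common edge in
opposite directions. As neither divisor has both points inside this edge, the points just change
places. -/
theorem injective_two (hC : IsGeneric 2 C) (x x' : Fin 2 → ℝ)
    (hx : loopDiv 2 C x ∈ DSet 2 C) (hx' : loopDiv 2 C x' ∈ DSet 2 C)
    (h : sumBeta 2 C x = sumBeta 2 C x') : loopDiv 2 C x = loopDiv 2 C x' := by
  refine inj_of_lt 1 (fun x x' h hk => ?_) (fun x x' hx hx' h hlt => ?_) x x' hx hx' h
  · rw [sumBeta_two hC, sumBeta_two hC] at h
    have e0 := congrFun h 0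
    simp only [Matrix.cons_val_zero, hk, sub_left_inj] at e0
    ext j
    fin_cases j
    · exact e0
    · exact hk
  · obtain ⟨e, ⟨n, a1, a2⟩, ⟨k, b1, b2⟩⟩ := rigidity_two hC h hlt
    rw [loopDiv_mem_iff hC] at hx hx'
    have s := loopPt_swap hC (i := 0) (j := 1) rfl (x := x 0) (u := x 1) (δ := x' 1 - x 1)
      (by linarith) (n := k) (k := n) b1 (by rw [← e]; simpa using b2) a1 (by simpa using a2)
      (hx 0 1 rfl) (by
        rw [add_sub_cancel, ← e, add_sub_cancel]
        exact hx' 0 1 rfl)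
    rw [add_sub_cancel, ← e, add_sub_cancel] at s
    rw [loopDiv_two, loopDiv_two, s.1, s.2]
    exact Multiset.pair_comm _ _

/-- If both points of the maximal solution were inside the common edge, they could be moved on
against each other with the same image, contrary to maximality. -/
theorem surjective_two (hC : IsGeneric 2 C) (z : Fin 2 → ℝ) :
    ∃ x, sumBeta 2 C x = z ∧ loopDiv 2 C x ∈ DSet 2 C := by
  have h1 := stepLen_pos hC 1
  have p1 := p_pos hC (i := 1) (by norm_num)
  have p2 := p_pos hC (i := 2) (by norm_num)
  have hR := isArc_R hC 0
  obtain ⟨x, u, y, e1, e2, -, e4⟩ := exists_solution (G := covR 2 C 0) (F := fun _ => 0) h1 p2 p1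
    (cyc_eq 1) (cov_slopeLeOne hR) zero_slopeLeOne (cov_continuous hR) continuous_const
    (z 0) (z 1) 0
  refine ⟨![x, u], ?_, (loopDiv_mem_iff hC _).mpr fun i j hij => ?_⟩
  · rw [sumBeta_two hC]
    ext j
    fin_cases j
    · exact e1
    · simpa using e2
  · rintro ⟨m1, m2⟩
    obtain ⟨ε, hε, c1, -, c3, c4⟩ := exists_advance hC hij m1 m2
    have hi : i = 0 := Fin.ext (by have := j.2; omega)
    subst hi
    have hj : j = 1 := Fin.ext hij
    subst hj
    exact (e4 ε hε).1 ⟨c3, c4, c1⟩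

end GenusTwo

/-! ### The equations and their solutions in genus three. -/

section GenusThree

theorem sumBeta_three (hC : IsGeneric 3 C) (x : Fin 3 → ℝ) :
    sumBeta 3 C x = ![x 0 - covL 3 C 1 (x 1), x 1 - covR 3 C 0 (x 0) - covL 3 C 2 (x 2),
      x 2 - covR 3 C 1 (x 1)] := by
  ext j
  fin_cases j <;> simp [sumBeta, Fin.sum_univ_three, beta_apply hC]

theorem loopDiv_three (x : Fin 3 → ℝ) :
    loopDiv 3 C x = {loopPt 3 C 0 (x 0), loopPt 3 C 1 (x 1), loopPt 3 C 2 (x 2)} := rfl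

/-- Points with the same image on the product of the universal covers, for genus three. -/
theorem rigidity_three (hC : IsGeneric 3 C) {x x' : Fin 3 → ℝ}
    (h : sumBeta 3 C x = sumBeta 3 C x') (hlt : x 1 < x' 1) :
    (x' 0 - x 0 = x' 1 - x 1 ∧ x' 2 = x 2 ∧
      (∃ n : ℤ, n * cyc 3 C 1 + (2 * stepLen 3 C 1 + p 3 C 2) ≤ x 1 ∧
        x' 1 ≤ n * cyc 3 C 1 + cyc 3 C 1) ∧
      ∃ n : ℤ, n * cyc 3 C 0 + stepLen 3 C 0 ≤ x 0 ∧
        x' 0 ≤ n * cyc 3 C 0 + (stepLen 3 C 0 + p 3 C 1)) ∨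
    (x' 2 - x 2 = x' 1 - x 1 ∧ x' 0 = x 0 ∧
      (∃ n : ℤ, n * cyc 3 C 1 + stepLen 3 C 1 ≤ x 1 ∧
        x' 1 ≤ n * cyc 3 C 1 + (stepLen 3 C 1 + p 3 C 2)) ∧
      ∃ n : ℤ, n * cyc 3 C 2 + (2 * stepLen 3 C 2 + p 3 C 3) ≤ x 2 ∧
        x' 2 ≤ n * cyc 3 C 2 + cyc 3 C 2) := by
  rw [sumBeta_three hC, sumBeta_three hC] at h
  have e0 := congrFun h 0
  have e1 := congrFun h 1
  have e2 := congrFun h 2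
  simp only [Matrix.cons_val_zero, Matrix.cons_val_one, Matrix.cons_val] at e0 e1 e2
  have h0 := stepLen_pos hC 0
  have h1 := stepLen_pos hC 1
  have h2 := stepLen_pos hC 2
  have p1 := p_pos hC (i := 1) (by norm_num)
  have p2 := p_pos hC (i := 2) (by norm_num)
  have p3 := p_pos hC (i := 3) (by norm_num)
  have hR := isArc_R hC 0
  have hL := isArc_L hC 2
  rcases rigidity (G := covR 3 C 0) (F := covL 3 C 2) h1 p2 p1 (cyc_eq 1) (cov_slopeLeOne hR)
    (cov_slopeLeOne hL) hlt e0.symm e1.symm e2.symm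
    with ⟨n, a1, a2, a3, a4, a5⟩ | ⟨n, a1, a2, a3, a4, a5⟩
  · exact .inl ⟨a3, a5, ⟨n, a1, a2⟩, cov_steep hR h0 (by linarith) a4⟩
  · obtain ⟨k, k1, k2⟩ := cov_steep hL (by
      change 0 < 2 * stepLen 3 C 2 + p 3 C 3
      linarith [show (0 : ℝ) < stepLen 3 C 2 from h2]) (by linarith) a4
    exact .inr ⟨a3, a5, ⟨n, a1, a2⟩, k, k1, k2⟩

theorem injective_three (hC : IsGeneric 3 C) (x x' : Fin 3 → ℝ)
    (hx : loopDiv 3 C x ∈ DSet 3 C) (hx' : loopDiv 3 C x' ∈ DSet 3 C)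
    (h : sumBeta 3 C x = sumBeta 3 C x') : loopDiv 3 C x = loopDiv 3 C x' := by
  refine inj_of_lt 1 (fun x x' h hk => ?_) (fun x x' hx hx' h hlt => ?_) x x' hx hx' h
  · rw [sumBeta_three hC, sumBeta_three hC] at h
    have e0 := congrFun h 0
    have e2 := congrFun h 2
    simp only [Matrix.cons_val_zero, Matrix.cons_val, hk, sub_left_inj] at e0 e2
    ext j
    fin_cases j
    · exact e0
    · exact hk
    · exact e2
  · rw [loopDiv_mem_iff hC] at hx hx'
    rcases rigidity_three hC h hlt with
      ⟨e, e', ⟨n, a1, a2⟩, ⟨k, b1, b2⟩⟩ | ⟨e, e', ⟨n, a1, a2⟩, ⟨k, b1, b2⟩⟩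
    · have s := loopPt_swap hC (i := 0) (j := 1) rfl (x := x 0) (u := x 1) (δ := x' 1 - x 1)
        (by linarith) (n := k) (k := n) b1 (by rw [← e]; simpa using b2) a1 (by simpa using a2)
        (hx 0 1 rfl) (by
          rw [add_sub_cancel, ← e, add_sub_cancel]
          exact hx' 0 1 rfl)
      rw [add_sub_cancel, ← e, add_sub_cancel] at s
      rw [loopDiv_three, loopDiv_three, s.1, s.2, e']
      exact Multiset.cons_swap _ _ _
    · have s := loopPt_swap hC (i := 1) (j := 2) rfl (x := x 1) (u := x 2) (δ := x' 1 - x 1)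
        (by linarith) (n := n) (k := k) a1 (by simpa using a2) b1 (by rw [← e]; simpa using b2)
        (hx 1 2 rfl) (by
          rw [add_sub_cancel, ← e, add_sub_cancel]
          exact hx' 1 2 rfl)
      rw [add_sub_cancel, ← e, add_sub_cancel] at s
      rw [loopDiv_three, loopDiv_three, s.1, s.2, e']
      exact congrArg _ (Multiset.pair_comm _ _)

/-- The argument of genus two, with the middle cycle in the role of u: maximality now excludes a
common pair on either of its vertical edges. -/
theorem surjective_three (hC : IsGeneric 3 C) (z : Fin 3 → ℝ) :
    ∃ x, sumBeta 3 C x = z ∧ loopDiv 3 C x ∈ DSet 3 C := by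
  have h1 := stepLen_pos hC 1
  have p1 := p_pos hC (i := 1) (by norm_num)
  have p2 := p_pos hC (i := 2) (by norm_num)
  have hR := isArc_R hC 0
  have hL := isArc_L hC 2
  obtain ⟨x, u, y, e1, e2, e3, e4⟩ := exists_solution (G := covR 3 C 0) (F := covL 3 C 2) h1 p2 p1
    (cyc_eq 1) (cov_slopeLeOne hR) (cov_slopeLeOne hL) (cov_continuous hR) (cov_continuous hL)
    (z 0) (z 1) (z 2)
  refine ⟨![x, u, y], ?_, (loopDiv_mem_iff hC _).mpr fun i j hij => ?_⟩
  · rw [sumBeta_three hC]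
    ext j
    fin_cases j
    · exact e1
    · exact e2
    · exact e3
  · rintro ⟨m1, m2⟩
    obtain ⟨ε, hε, c1, c2, c3, c4⟩ := exists_advance hC hij m1 m2
    have hi : i = 0 ∨ i = 1 := by
      have := j.2
      rcases i with ⟨_ | _ | i, hi⟩
      · exact .inl rfl
      · exact .inr rfl
      · simp only at hij
        omega
    rcases hi with rfl | rfl
    · have hj : j = 1 := Fin.ext hij
      subst hj
      exact (e4 ε hε).1 ⟨c3, c4, c1⟩
    · have hj : j = 2 := Fin.ext hij
      subst hj
      exact (e4 ε hε).2 ⟨c1, c2, c3⟩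

end GenusThree

end TropHyper
end

noncomputable section

namespace TropHyper

/-! ### Parallelotopes -/

section Parallelotope

variable {n : ℕ}

/-- The affine homeomorphism `t ↦ x + ∑ i, t i • a i` for a basis `a`. -/
def paraHomeo (x : Fin n → ℝ) (a : Fin n → Fin n → ℝ) (ha : LinearIndependent ℝ a) :
    (Fin n → ℝ) ≃ₜ (Fin n → ℝ) :=
  (LinearEquiv.ofInjectiveEndo (Fintype.linearCombination ℝ a)
    (linearIndependent_iff_injective_fintypeLinearCombination.mp ha)).toContinuousLinearEquiv.toHomeomorph.trans
    (Homeomorph.addLeft x)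

/-- The image of a product set under `t ↦ x + ∑ i, t i • a i`. -/
def paraSet (x : Fin n → ℝ) (a : Fin n → Fin n → ℝ) (S : Fin n → Set ℝ) : Set (Fin n → ℝ) :=
  {z | ∃ t : Fin n → ℝ, (∀ i, t i ∈ S i) ∧ z = x + ∑ i, t i • a i}

theorem paraSet_eq_image (x : Fin n → ℝ) {a : Fin n → Fin n → ℝ} (ha : LinearIndependent ℝ a)
    (S : Fin n → Set ℝ) : paraSet x a S = paraHomeo x a ha '' univ.pi S := by
  ext z
  constructor
  · rintro ⟨t, ht, rfl⟩
    exact ⟨t, fun i _ => ht i, rfl⟩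
  · rintro ⟨t, ht, rfl⟩
    exact ⟨t, fun i => ht i (mem_univ i), rfl⟩

theorem zonotope_eq_paraSet (x : Fin n → ℝ) (a : Fin n → Fin n → ℝ) :
    zonotope x a = paraSet x a fun _ => Icc 0 1 := rfl

theorem closure_paraSet (x : Fin n → ℝ) {a : Fin n → Fin n → ℝ} (ha : LinearIndependent ℝ a)
    (S : Fin n → Set ℝ) : closure (paraSet x a S) = paraSet x a fun i => closure (S i) := by
  rw [paraSet_eq_image x ha, paraSet_eq_image x ha, ← Homeomorph.image_closure, closure_pi_set]

theorem interior_zonotope (x : Fin n → ℝ) {a : Fin n → Fin n → ℝ} (ha : LinearIndependent ℝ a) :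
    interior (zonotope x a) = paraSet x a fun _ => Ioo 0 1 := by
  rw [zonotope_eq_paraSet, paraSet_eq_image x ha, paraSet_eq_image x ha,
    ← Homeomorph.image_interior, interior_pi_set finite_univ]
  simp only [interior_Icc]

theorem IsParallelotope.subset_closure_interior {R : Set (Fin n → ℝ)} (h : IsParallelotope R) :
    R ⊆ closure (interior R) := by
  obtain ⟨x, a, ha, rfl⟩ := h
  rw [interior_zonotope x ha, closure_paraSet x ha, zonotope_eq_paraSet]
  simp only [closure_Ioo (zero_ne_one' ℝ)]
  exact Subset.rfl

theorem IsParallelotope.isClosed {R : Set (Fin n → ℝ)} (h : IsParallelotope R) : IsClosed R := by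
  obtain ⟨x, a, ha, rfl⟩ := h
  have := closure_paraSet x ha fun _ => Ioo 0 1
  simp only [closure_Ioo (zero_ne_one' ℝ)] at this
  rw [zonotope_eq_paraSet, ← this]
  exact isClosed_closure

theorem interior_translate (l : Fin n → ℝ) (R : Set (Fin n → ℝ)) :
    interior ((fun x => l + x) '' R) = (fun x => l + x) '' interior R :=
  ((Homeomorph.addLeft l).image_interior R).symm

theorem IsParallelotope.translate {R : Set (Fin n → ℝ)} (h : IsParallelotope R) (l : Fin n → ℝ) :
    IsParallelotope ((fun x => l + x) '' R) := by
  obtain ⟨x, a, ha, rfl⟩ := h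
  refine ⟨l + x, a, ha, ?_⟩
  ext z
  constructor
  · rintro ⟨_, ⟨t, ht, rfl⟩, rfl⟩
    exact ⟨t, ht, (add_assoc _ _ _).symm⟩
  · rintro ⟨t, ht, rfl⟩
    exact ⟨_, ⟨t, ht, rfl⟩, (add_assoc _ _ _).symm⟩

end Parallelotope

/-! ### Fundamental domains that are assembled from tiles -/

section Tiles

variable {n m : ℕ}

/-- Parallelotopes whose translates by `Λ` tile the space. -/
structure IsTiling (Λ : AddSubgroup (Fin n → ℝ)) (R : Fin m → Set (Fin n → ℝ)) : Prop where
  para : ∀ k, IsParallelotope (R k)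
  cover : ∀ z, ∃ l ∈ Λ, ∃ k, ∃ x ∈ R k, z = l + x
  disjoint : ∀ k k', ∀ z ∈ interior (R k), ∀ z' ∈ interior (R k'), z' - z ∈ Λ → z' = z ∧ k = k'

variable {Λ : AddSubgroup (Fin n → ℝ)} {R : Fin m → Set (Fin n → ℝ)}

theorem IsTiling.isNonoverlappingUnion (h : IsTiling Λ R) {l : Fin m → Fin n → ℝ}
    (hl : ∀ k, l k ∈ Λ) {V : Set (Fin n → ℝ)} (hV : ⋃ k, (fun z => l k + z) '' R k = V) :
    IsNonoverlappingUnion (fun k => (fun z => l k + z) '' R k) V := by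
  refine ⟨fun k k' hk => Set.disjoint_left.mpr fun z hz hz' => ?_, hV⟩
  simp only [interior_translate] at hz hz'
  obtain ⟨y, hy, rfl⟩ := hz
  obtain ⟨y', hy', he⟩ := hz'
  refine hk (h.disjoint k k' y hy y' hy' ?_).2
  have : y' - y = l k - l k' := by
    rw [sub_eq_sub_iff_add_eq_add, add_comm]
    exact he
  rw [this]
  exact sub_mem (hl k) (hl k')

/-- Suppose that the interiors of V and q + V meet. Their intersection is open, so it meets the
interior of a shifted tile of V, and this smaller open set meets the interior of a shifted tile of q
+ V. The tiling property then identifies the two tiles and gives q = 0. -/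
theorem IsTiling.isFundDomain (h : IsTiling Λ R) {l : Fin m → Fin n → ℝ}
    (hl : ∀ k, l k ∈ Λ) {V : Set (Fin n → ℝ)} (hV : ⋃ k, (fun z => l k + z) '' R k = V) :
    IsFundDomain Λ V := by
  refine ⟨?_, ?_, ?_⟩
  · rw [← hV]
    exact isClosed_iUnion_of_finite fun k => ((h.para k).translate (l k)).isClosed
  · intro z
    obtain ⟨q, hq, k, x, hx, rfl⟩ := h.cover z
    refine ⟨q - l k, sub_mem hq (hl k), l k + x, ?_, by abel⟩
    rw [← hV, mem_iUnion]
    exact ⟨k, x, hx, rfl⟩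
  · intro q hq hq0
    rw [Set.disjoint_iff_inter_eq_empty, ← not_nonempty_iff_eq_empty]
    rintro ⟨z, hz, hz'⟩
    set O := interior V ∩ interior ((fun x => q + x) '' V) with hO
    have hOo : IsOpen O := isOpen_interior.inter isOpen_interior
    -- A parallelotope lies in the closure of its interior, so an open set that meets r + V also
    -- meets the interior of a tile of it.
    have key : ∀ O : Set (Fin n → ℝ), IsOpen O → ∀ r : Fin n → ℝ, (O ∩ (fun x => r + x) '' V).Nonempty →
        ∃ k, (O ∩ (fun x => r + l k + x) '' interior (R k)).Nonempty := by
      rintro O hO r ⟨y, hyO, x, hx, rfl⟩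
      rw [← hV, mem_iUnion] at hx
      obtain ⟨k, x', hx', rfl⟩ := hx
      have hcl : r + l k + x' ∈ closure ((fun x => r + l k + x) '' interior (R k)) :=
        image_closure_subset_closure_image (continuous_const.add continuous_id)
          ⟨x', (h.para k).subset_closure_interior hx', rfl⟩
      refine ⟨k, mem_closure_iff.mp hcl O hO ?_⟩
      simpa [add_assoc] using hyO
    obtain ⟨k, hk⟩ := key O hOo 0 ⟨z, ⟨hz, hz'⟩, z, interior_subset hz, zero_add z⟩
    obtain ⟨y, hyO, hyk⟩ := hk
    obtain ⟨k', hk'⟩ := key (O ∩ (fun x => 0 + l k + x) '' interior (R k))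
      (hOo.inter ((Homeomorph.addLeft (0 + l k)).isOpenMap _ isOpen_interior)) q
      ⟨y, ⟨hyO, hyk⟩, interior_subset hyO.2⟩
    obtain ⟨y', ⟨-, x₁, hx₁, e₁⟩, x₂, hx₂, e₂⟩ := hk'
    simp only [zero_add] at e₁ e₂
    have hd : x₂ - x₁ = l k - (q + l k') := by
      have : q + l k' + x₂ = l k + x₁ := e₂.trans e₁.symm
      rw [sub_eq_sub_iff_add_eq_add, add_comm, this]
    obtain ⟨h1, rfl⟩ := h.disjoint k k' x₁ hx₁ x₂ hx₂
      (by rw [hd]; exact sub_mem (hl k) (add_mem hq (hl k')))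
    rw [h1, sub_self] at hd
    exact hq0 (by simpa using hd)

end Tiles

/-! ### The facets of a zonotope -/

section Facets

variable {n k : ℕ} (x : Fin n → ℝ) (a : Fin k → Fin n → ℝ)

/-- The points of a zonotope whose coordinates are prescribed by a sign vector. -/
def signFace (σ : Fin k → SignType) : Set (Fin n → ℝ) :=
  {z | ∃ t : Fin k → ℝ, (∀ i, t i ∈ Icc (0 : ℝ) 1) ∧
    (∀ i, (σ i = 1 → t i = 1) ∧ (σ i = -1 → t i = 0)) ∧ z = x + ∑ i, t i • a i}

/-- The sign vector of a linear functional. -/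
def signVec (l : StrongDual ℝ (Fin n → ℝ)) : Fin k → SignType := fun i => SignType.sign (l (a i))

variable {x a}

/-- Vary one coordinate at a time: where the functional is positive or negative on a generator, that
coordinate must be at the corresponding end of [0, 1]. -/
theorem coord_of_isMax {l : StrongDual ℝ (Fin n → ℝ)} {t : Fin k → ℝ}
    (ht : ∀ i, t i ∈ Icc (0 : ℝ) 1)
    (hmax : ∀ y ∈ zonotope x a, l y ≤ l (x + ∑ i, t i • a i)) (i : Fin k) :
    (signVec a l i = 1 → t i = 1) ∧ (signVec a l i = -1 → t i = 0) := by
  have key : ∀ s ∈ Icc (0 : ℝ) 1, s * l (a i) ≤ t i * l (a i) := by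
    intro s hs
    have hy : x + ∑ j, (Function.update t i s) j • a j ∈ zonotope x a := by
      refine ⟨_, fun j => ?_, rfl⟩
      by_cases hj : j = i
      · subst hj
        simpa using hs
      · simpa [hj] using ht j
    have := hmax _ hy
    simp only [map_add, map_sum, map_smul, smul_eq_mul, add_le_add_iff_left] at this
    rw [← Finset.add_sum_erase _ _ (Finset.mem_univ i),
      ← Finset.add_sum_erase _ (fun j => t j * l (a j)) (Finset.mem_univ i)] at this
    have he : ∑ j ∈ Finset.univ.erase i, Function.update t i s j * l (a j) =
        ∑ j ∈ Finset.univ.erase i, t j * l (a j) :=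
      Finset.sum_congr rfl fun j hj => by rw [Function.update_of_ne (Finset.ne_of_mem_erase hj)]
    rw [he, Function.update_self] at this
    linarith
  unfold signVec
  constructor
  · intro h
    rw [sign_eq_one_iff] at h
    have := key 1 ⟨zero_le_one, le_rfl⟩
    exact le_antisymm (ht i).2 (le_of_mul_le_mul_right this h)
  · intro h
    rw [sign_eq_neg_one_iff] at h
    have := key 0 ⟨le_rfl, zero_le_one⟩
    have h0 := (ht i).1
    nlinarith

theorem exposed_eq_signFace (l : StrongDual ℝ (Fin n → ℝ)) :
    {z ∈ zonotope x a | ∀ y ∈ zonotope x a, l y ≤ l z} = signFace x a (signVec a l) := by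
  ext z
  constructor
  · rintro ⟨⟨t, ht, rfl⟩, hmax⟩
    exact ⟨t, ht, coord_of_isMax ht hmax, rfl⟩
  · rintro ⟨t, ht, hσ, rfl⟩
    refine ⟨⟨t, ht, rfl⟩, ?_⟩
    rintro _ ⟨s, hs, rfl⟩
    simp only [map_add, map_sum, map_smul, smul_eq_mul, add_le_add_iff_left]
    refine Finset.sum_le_sum fun i _ => ?_
    rcases lt_trichotomy (l (a i)) 0 with h | h | h
    · have := (hσ i).2 (sign_eq_neg_one_iff.mpr h)
      rw [this]
      nlinarith [(hs i).1]
    · rw [h]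
      simp
    · have := (hσ i).1 (sign_eq_one_iff.mpr h)
      rw [this]
      nlinarith [(hs i).2]

/-- The coordinates of the barycenter of the face with a given sign vector. -/
def midCoord (σ : SignType) : ℝ := (1 + (σ : ℝ)) / 2

theorem midCoord_spec (σ : SignType) : midCoord σ ∈ Icc (0 : ℝ) 1 ∧ (σ = 1 ↔ midCoord σ = 1) ∧
    (σ = -1 ↔ midCoord σ = 0) := by
  cases σ <;> norm_num [midCoord]; decide

theorem center_mem_signFace (σ : Fin k → SignType) :
    x + ∑ i, midCoord (σ i) • a i ∈ signFace x a σ :=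
  ⟨_, fun i => (midCoord_spec (σ i)).1,
    fun i => ⟨(midCoord_spec (σ i)).2.1.mp, (midCoord_spec (σ i)).2.2.mp⟩, rfl⟩

/-- The barycenter of a face maximizes its functional. Since its coordinates are 1 or 0 only where
the sign vector is 1 or -1, the face determines the signs, even though the coordinates of a point of
a zonotope are not unique. -/
theorem signVec_eq_of_signFace_eq {l l' : StrongDual ℝ (Fin n → ℝ)}
    (h : signFace x a (signVec a l) = signFace x a (signVec a l')) :
    signVec a l = signVec a l' := by
  have key : ∀ l l' : StrongDual ℝ (Fin n → ℝ),
      signFace x a (signVec a l) = signFace x a (signVec a l') → ∀ i,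
      (signVec a l' i = 1 → signVec a l i = 1) ∧ (signVec a l' i = -1 → signVec a l i = -1) := by
    intro l l' h i
    have hc := center_mem_signFace (x := x) (a := a) (signVec a l)
    rw [h, ← exposed_eq_signFace] at hc
    have := coord_of_isMax (fun i => (midCoord_spec (signVec a l i)).1) hc.2 i
    exact ⟨fun h' => (midCoord_spec _).2.1.mpr (this.1 h'),
      fun h' => (midCoord_spec _).2.2.mpr (this.2 h')⟩
  ext1 i
  have h1 := key l l' h i
  have h2 := key l' l h.symm i
  rcases h3 : signVec a l i with _ | _ | _ <;> rcases h4 : signVec a l' i with _ | _ | _ <;>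
    rw [h3, h4] at h1 h2 <;> revert h1 h2 <;> decide

/-- Exactly the coordinates with sign 0 are free on the face. -/
theorem vectorSpan_signFace (σ : Fin k → SignType) :
    vectorSpan ℝ (signFace x a σ) = Submodule.span ℝ (a '' {i | σ i = 0}) := by
  apply le_antisymm
  · rw [vectorSpan, Submodule.span_le]
    rintro _ ⟨_, ⟨t, ht, hσ, rfl⟩, _, ⟨s, hs, hσ', rfl⟩, rfl⟩
    simp only [vsub_eq_sub, add_sub_add_left_eq_sub, ← Finset.sum_sub_distrib, ← sub_smul]
    refine Submodule.sum_mem _ fun i _ => ?_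
    by_cases h : σ i = 0
    · exact Submodule.smul_mem _ _ (Submodule.subset_span ⟨i, h, rfl⟩)
    · have : t i - s i = 0 := by
        rcases h' : σ i with _ | _ | _
        · exact absurd h' h
        · rw [(hσ i).2 h', (hσ' i).2 h', sub_self]
        · rw [(hσ i).1 h', (hσ' i).1 h', sub_self]
      rw [this, zero_smul]
      exact zero_mem _
  · rw [Submodule.span_le]
    rintro _ ⟨i, hi, rfl⟩
    have hi' : σ i = 0 := hi
    set t : Fin k → ℝ := fun j => midCoord (σ j) with ht
    have hmem : ∀ c ∈ Icc (0 : ℝ) 1, x + ∑ j, Function.update t i c j • a j ∈ signFace x a σ := by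
      intro c hc
      refine ⟨_, fun j => ?_, fun j => ?_, rfl⟩
      · by_cases hj : j = i
        · subst hj
          simpa using hc
        · simpa [hj] using (midCoord_spec (σ j)).1
      · by_cases hj : j = i
        · subst hj
          rw [hi']
          exact ⟨fun h => absurd h (by decide), fun h => absurd h (by decide)⟩
        · rw [Function.update_of_ne hj]
          exact ⟨(midCoord_spec (σ j)).2.1.mp, (midCoord_spec (σ j)).2.2.mp⟩
    have := vsub_mem_vectorSpan ℝ (hmem 1 ⟨zero_le_one, le_rfl⟩) (hmem 0 ⟨le_rfl, zero_le_one⟩)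
    convert this using 1
    simp only [vsub_eq_sub, add_sub_add_left_eq_sub, ← Finset.sum_sub_distrib, ← sub_smul]
    rw [Finset.sum_eq_single i]
    · simp
    · intro j _ hj
      simp [hj]
    · simp

theorem facets_zonotope : facets (zonotope x a) = signFace x a ''
    {σ | (∃ l : StrongDual ℝ (Fin n → ℝ), σ = signVec a l) ∧
      Module.finrank ℝ (Submodule.span ℝ (a '' {i | σ i = 0})) + 1 = n} := by
  ext F
  constructor
  · rintro ⟨hne, hexp, hrank⟩
    obtain ⟨l, hl⟩ := hexp hne
    rw [exposed_eq_signFace] at hl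
    subst hl
    rw [vectorSpan_signFace] at hrank
    exact ⟨_, ⟨⟨l, rfl⟩, hrank⟩, rfl⟩
  · rintro ⟨_, ⟨⟨l, rfl⟩, hrank⟩, rfl⟩
    refine ⟨⟨_, center_mem_signFace _⟩, fun _ => ⟨l, ?_⟩, ?_⟩
    · exact (exposed_eq_signFace l).symm
    · rwa [vectorSpan_signFace]

/-- The number of facets of a zonotope, if its facet normals are the multiples of the functionals
`N q` (up to functionals that vanish on all generators). -/
theorem ncard_facets_zonotope {m : ℕ} (N : Fin m → StrongDual ℝ (Fin n → ℝ))
    (M : Fin m → Fin k → SignType) (hM : ∀ q i, SignType.sign (N q (a i)) = M q i)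
    (hrank : ∀ q, Module.finrank ℝ (Submodule.span ℝ (a '' {i | M q i = 0})) + 1 = n)
    (hN : ∀ l : StrongDual ℝ (Fin n → ℝ),
      Module.finrank ℝ (Submodule.span ℝ (a '' {i | l (a i) = 0})) + 1 = n →
      ∃ q, ∃ c : ℝ, c ≠ 0 ∧ ∀ i, l (a i) = c * N q (a i))
    (hinj : Function.Injective fun (qs : Fin m × ℤˣ) i => SignType.sign (qs.2 : ℤ) * M qs.1 i) :
    (facets (zonotope x a)).ncard = 2 * m := by
  have hset : {σ : Fin k → SignType | (∃ l : StrongDual ℝ (Fin n → ℝ), σ = signVec a l) ∧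
      Module.finrank ℝ (Submodule.span ℝ (a '' {i | σ i = 0})) + 1 = n} =
      Set.range fun (qs : Fin m × ℤˣ) i => SignType.sign (qs.2 : ℤ) * M qs.1 i := by
    ext σ
    constructor
    · rintro ⟨⟨l, rfl⟩, hr⟩
      have hz : {i | signVec a l i = 0} = {i | l (a i) = 0} := by
        ext i
        exact sign_eq_zero_iff
      rw [hz] at hr
      obtain ⟨q, c, hc, hl⟩ := hN l hr
      refine ⟨(q, if 0 < c then 1 else -1), ?_⟩
      ext1 i
      simp only [signVec, hl, sign_mul, hM]
      rcases hc.lt_or_gt with h | h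
      · rw [if_neg (not_lt.mpr h.le), sign_neg h]
        simp
      · rw [if_pos h, sign_pos h]
        simp
    · rintro ⟨⟨q, s⟩, rfl⟩
      refine ⟨⟨((s : ℤ) : ℝ) • N q, ?_⟩, ?_⟩
      · ext1 i
        simp only [signVec, smul_apply, smul_eq_mul, sign_mul, hM]
        rcases Int.units_eq_one_or s with rfl | rfl <;> simp
      · have : {i | SignType.sign (s : ℤ) * M q i = 0} = {i | M q i = 0} := by
          ext i
          rcases Int.units_eq_one_or s with rfl | rfl <;> simp
        rw [this]
        exact hrank q
  rw [facets_zonotope, Set.InjOn.ncard_image, hset, ← Set.image_univ,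
    Set.ncard_image_of_injective _ hinj, Set.ncard_univ]
  · simp [mul_comm]
  · rintro _ ⟨⟨l, rfl⟩, -⟩ _ ⟨⟨l', rfl⟩, -⟩ h
    exact signVec_eq_of_signFace_eq h

end Facets

end TropHyper
end

noncomputable section

namespace TropHyper

/-! ### The facets of the hexagon and of the dodecahedron -/

section FacetCount

variable {n k : ℕ} {a : Fin k → Fin n → ℝ}

/-- The linear functional with given coefficients. -/
def functional (v : Fin n → ℝ) : StrongDual ℝ (Fin n → ℝ) :=
  ∑ i, v i • ContinuousLinearMap.proj (R := ℝ) (φ := fun _ : Fin n => ℝ) i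

theorem functional_apply (v z : Fin n → ℝ) : functional v z = ∑ i, v i * z i := by
  simp [functional]

theorem exists_functional (l : StrongDual ℝ (Fin n → ℝ)) : ∃ v, l = functional v := by
  refine ⟨fun i => l (Pi.single i 1), ContinuousLinearMap.ext fun z => ?_⟩
  rw [functional_apply]
  have := LinearMap.pi_apply_eq_sum_univ l.toLinearMap z
  simp only [ContinuousLinearMap.coe_coe, smul_eq_mul] at this
  rw [this]
  refine Finset.sum_congr rfl fun i _ => ?_
  rw [mul_comm]
  congr 2
  ext j
  simp [Pi.single_apply, eq_comm]

/-- The span lies in the kernel of a nonzero functional, of dimension n - 1, and contains n - 1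
independent generators. -/
theorem finrank_span_of_functional {r : ℕ} (hr : r + 1 = n) {l : StrongDual ℝ (Fin n → ℝ)}
    (hl : l ≠ 0) {S : Set (Fin k)} (hS : ∀ i ∈ S, l (a i) = 0) (f : Fin r → Fin k)
    (hf : ∀ j, f j ∈ S) (hli : LinearIndependent ℝ (a ∘ f)) :
    Module.finrank ℝ (Submodule.span ℝ (a '' S)) + 1 = n := by
  have h1 : Submodule.span ℝ (a '' S) ≤ LinearMap.ker l.toLinearMap := by
    rw [Submodule.span_le]
    rintro _ ⟨i, hi, rfl⟩
    exact hS i hi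
  have h2 : Module.finrank ℝ (LinearMap.ker l.toLinearMap) + 1 = n := by
    have := Module.Dual.finrank_ker_add_one_of_ne_zero (f := l.toLinearMap)
      (fun h => hl (ContinuousLinearMap.coe_injective h))
    rwa [Module.finrank_fin_fun] at this
  have h3 : Submodule.span ℝ (range (a ∘ f)) ≤ Submodule.span ℝ (a '' S) :=
    Submodule.span_mono (by rintro _ ⟨j, rfl⟩; exact ⟨f j, hf j, rfl⟩)
  have h4 := Submodule.finrank_mono h1
  have h5 := Submodule.finrank_mono h3
  rw [finrank_span_eq_card hli, Fintype.card_fin] at h5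
  omega

/-- Otherwise S would contain n independent generators and span the whole space. -/
theorem exists_ne_zero_of_finrank {S : Set (Fin k)} {l : StrongDual ℝ (Fin n → ℝ)}
    (hS : S = {i | l (a i) = 0})
    (h : Module.finrank ℝ (Submodule.span ℝ (a '' S)) + 1 = n) (f : Fin n → Fin k)
    (hli : LinearIndependent ℝ (a ∘ f)) : ∃ i, l (a i) ≠ 0 := by
  by_contra! hcon
  have h3 : Submodule.span ℝ (range (a ∘ f)) ≤ Submodule.span ℝ (a '' S) :=
    Submodule.span_mono (by rintro _ ⟨j, rfl⟩; exact ⟨f j, by rw [hS]; exact hcon _, rfl⟩)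
  have h5 := Submodule.finrank_mono h3
  rw [finrank_span_eq_card hli, Fintype.card_fin] at h5
  omega

theorem ncard_facets_hexagon (x : Fin 2 → ℝ) {A b c : ℝ} (hA : 0 < A) (hb : 0 < b) (hc : 0 < c) :
    (facets (zonotope x ![![A, 0], ![b, -b], ![0, c]])).ncard = 6 := by
  set a : Fin 3 → Fin 2 → ℝ := ![![A, 0], ![b, -b], ![0, c]] with ha
  have hval : ∀ v : Fin 2 → ℝ, functional v (a 0) = v 0 * A ∧
      functional v (a 1) = (v 0 - v 1) * b ∧ functional v (a 2) = v 1 * c := by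
    intro v
    simp only [functional_apply, Fin.sum_univ_two, ha]
    refine ⟨?_, ?_, ?_⟩ <;> simp <;> ring
  -- The functional number q vanishes exactly on the generator number q; M records the signs on the
  -- generators.
  set N : Fin 3 → Fin 2 → ℝ := ![![0, 1], ![1, 1], ![1, 0]] with hN
  set M : Fin 3 → Fin 3 → SignType := ![![0, -1, 1], ![1, 0, 1], ![1, 1, 0]] with hM
  have hsign : ∀ q i, SignType.sign (functional (N q) (a i)) = M q i := by
    intro q i
    obtain ⟨e0, e1, e2⟩ := hval (N q)
    fin_cases i <;> simp only [Fin.zero_eta, Fin.mk_one, Fin.reduceFinMk, e0, e1, e2] <;>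
      fin_cases q <;> simp [hN, hM, hA, hb, hc]
  have hne : ∀ q, functional (N q) ≠ 0 := by
    intro q h
    obtain ⟨i, hi⟩ : ∃ i, M q i ≠ 0 := by
      clear h
      revert q
      decide
    rw [← hsign, h] at hi
    simp at hi
  refine ncard_facets_zonotope (m := 3) (fun q => functional (N q)) M hsign (fun q => ?_)
    (fun l hl => ?_) (by decide)
  · refine finrank_span_of_functional (r := 1) rfl (hne q) (S := {i | M q i = 0})
      (fun i hi => by rw [← sign_eq_zero_iff, hsign]; exact hi) (fun _ => q) (fun _ => ?_) ?_
    · fin_cases q <;> rfl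
    · rw [linearIndependent_unique_iff]
      fin_cases q <;> simp [ha, hA.ne', hb.ne', hc.ne']
  · obtain ⟨i, hi⟩ := exists_ne_zero_of_finrank rfl hl ![0, 2] (by
      rw [Fintype.linearIndependent_iff]
      intro t ht
      have h0 := congrFun ht 0
      have h1 := congrFun ht 1
      simp [Fin.sum_univ_two, ha, hA.ne', hc.ne'] at h0 h1
      intro i
      fin_cases i <;> assumption)
    have hz : ∃ j, l (a j) = 0 := by
      by_contra! hcon
      have : {i | l (a i) = 0} = ∅ := eq_empty_of_forall_notMem hcon
      rw [this, image_empty, Submodule.span_empty, finrank_bot] at hl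
      omega
    obtain ⟨j, hj⟩ := hz
    obtain ⟨v, rfl⟩ := exists_functional l
    obtain ⟨e0, e1, e2⟩ := hval v
    have hv : (v 0 = 0) ∨ (v 0 = v 1) ∨ (v 1 = 0) := by
      fin_cases j <;> simp only [Fin.zero_eta, Fin.mk_one, Fin.reduceFinMk, e0, e1, e2,
        mul_eq_zero, hA.ne', hb.ne', hc.ne', or_false, sub_eq_zero] at hj <;> tauto
    have hq : ∃ q, ∃ c : ℝ, v = c • N q := by
      rcases hv with h | h | h
      · exact ⟨0, v 1, by ext i; fin_cases i <;> simp [hN, h]⟩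
      · exact ⟨1, v 1, by ext i; fin_cases i <;> simp [hN, h]⟩
      · exact ⟨2, v 0, by ext i; fin_cases i <;> simp [hN, h]⟩
    obtain ⟨q, c, rfl⟩ := hq
    have hmul : ∀ i, functional (c • N q) (a i) = c * functional (N q) (a i) := by
      intro i
      simp only [functional_apply, Pi.smul_apply, smul_eq_mul, Finset.mul_sum, mul_assoc]
    refine ⟨q, c, ?_, hmul⟩
    rintro rfl
    exact hi (by rw [hmul, zero_mul])

/-- The only coplanar triples among the five generators are {0, 1, 2} and {2, 3, 4}. Hence pairs of
generators span these two planes and those of {0, 3}, {0, 4}, {1, 3}, {1, 4}: six planes, each with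
two opposite facets. -/
theorem ncard_facets_dodecahedron (x : Fin 3 → ℝ) {A b c d f : ℝ} (hA : 0 < A) (hb : 0 < b)
    (hc : 0 < c) (hd : 0 < d) (hf : 0 < f) :
    (facets (zonotope x ![![A, 0, 0], ![b, -b, 0], ![0, -c, 0], ![0, -d, d], ![0, 0, f]])).ncard =
      12 := by
  set a : Fin 5 → Fin 3 → ℝ :=
    ![![A, 0, 0], ![b, -b, 0], ![0, -c, 0], ![0, -d, d], ![0, 0, f]] with ha
  have hval : ∀ v : Fin 3 → ℝ, functional v (a 0) = v 0 * A ∧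
      functional v (a 1) = (v 0 - v 1) * b ∧ functional v (a 2) = -v 1 * c ∧
      functional v (a 3) = (v 2 - v 1) * d ∧ functional v (a 4) = v 2 * f := by
    intro v
    simp only [functional_apply, Fin.sum_univ_three, ha]
    refine ⟨?_, ?_, ?_, ?_, ?_⟩ <;> simp <;> ring
  set N : Fin 6 → Fin 3 → ℝ :=
    ![![0, 0, 1], ![1, 0, 0], ![0, 1, 1], ![0, 1, 0], ![1, 1, 1], ![1, 1, 0]] with hN
  set M : Fin 6 → Fin 5 → SignType :=
    ![![0, 0, 0, 1, 1], ![1, 1, 0, 0, 0], ![0, -1, -1, 0, 1], ![0, -1, -1, -1, 0],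
      ![1, 0, -1, 0, 1], ![1, 0, -1, -1, 0]] with hM
  have hsign : ∀ q i, SignType.sign (functional (N q) (a i)) = M q i := by
    intro q i
    obtain ⟨e0, e1, e2, e3, e4⟩ := hval (N q)
    fin_cases i <;> simp only [Fin.zero_eta, Fin.mk_one, Fin.reduceFinMk, e0, e1, e2, e3, e4] <;>
      fin_cases q <;> simp [hN, hM, hA, hb, hc, hd, hf]
  have hne : ∀ q, functional (N q) ≠ 0 := by
    intro q h
    obtain ⟨i, hi⟩ : ∃ i, M q i ≠ 0 := by
      clear h
      revert q
      decide
    rw [← hsign, h] at hi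
    simp at hi
  set pr : Fin 6 → Fin 2 → Fin 5 := ![![0, 2], ![2, 4], ![0, 3], ![0, 4], ![1, 3], ![1, 4]] with hpr
  refine ncard_facets_zonotope (m := 6) (fun q => functional (N q)) M hsign (fun q => ?_)
    (fun l hl => ?_) (by decide)
  · refine finrank_span_of_functional (r := 2) rfl (hne q) (S := {i | M q i = 0})
      (fun i hi => by rw [← sign_eq_zero_iff, hsign]; exact hi) (pr q) (fun j => ?_) ?_
    · fin_cases q <;> fin_cases j <;> rfl
    · rw [Fintype.linearIndependent_iff]
      intro t ht
      have h0 := congrFun ht 0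
      have h1 := congrFun ht 1
      have h2 := congrFun ht 2
      have : t 0 = 0 ∧ t 1 = 0 := by
        fin_cases q <;>
        simp [Fin.sum_univ_two, ha, hpr, hA.ne', hb.ne', hc.ne', hd.ne', hf.ne'] at h0 h1 h2 <;>
        simp_all
      intro i
      fin_cases i
      · exact this.1
      · exact this.2
  · obtain ⟨i, hi⟩ := exists_ne_zero_of_finrank rfl hl ![0, 2, 4] (by
      rw [Fintype.linearIndependent_iff]
      intro t ht
      have h0 := congrFun ht 0
      have h1 := congrFun ht 1
      have h2 := congrFun ht 2
      simp [Fin.sum_univ_three, ha, hA.ne', hc.ne', hf.ne'] at h0 h1 h2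
      intro i
      fin_cases i <;> assumption)
    have hz : ∃ j j', j < j' ∧ l (a j) = 0 ∧ l (a j') = 0 := by
      by_contra! hcon
      have hs : {i | l (a i) = 0}.Subsingleton := by
        intro j hj j' hj'
        rcases lt_trichotomy j j' with h | h | h
        · exact absurd hj' (hcon j j' h hj)
        · exact h
        · exact absurd hj (hcon j' j h hj')
      rcases hs.eq_empty_or_singleton with h | ⟨i, h⟩
      · rw [h, image_empty, Submodule.span_empty, finrank_bot] at hl
        omega
      · rw [h, image_singleton] at hl
        have : Module.finrank ℝ (Submodule.span ℝ {a i}) ≤ 1 :=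
          (finrank_span_le_card ({a i} : Set (Fin 3 → ℝ))).trans (by simp)
        omega
    obtain ⟨j, j', hjj, hj, hj'⟩ := hz
    obtain ⟨v, rfl⟩ := exists_functional l
    obtain ⟨e0, e1, e2, e3, e4⟩ := hval v
    have hv : (v 0 = 0 ∧ v 1 = 0) ∨ (v 1 = 0 ∧ v 2 = 0) ∨ (v 0 = 0 ∧ v 2 = v 1) ∨
        (v 0 = 0 ∧ v 2 = 0) ∨ (v 0 = v 1 ∧ v 2 = v 1) ∨ (v 0 = v 1 ∧ v 2 = 0) := by
      have key : ∀ j, functional v (a j) = 0 → (j = 0 ∧ v 0 = 0) ∨ (j = 1 ∧ v 0 = v 1) ∨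
          (j = 2 ∧ v 1 = 0) ∨ (j = 3 ∧ v 2 = v 1) ∨ (j = 4 ∧ v 2 = 0) := by
        intro j hj
        fin_cases j <;> simp only [Fin.zero_eta, Fin.mk_one, Fin.reduceFinMk, e0, e1, e2, e3, e4,
          mul_eq_zero, hA.ne', hb.ne', hc.ne', hd.ne', hf.ne', or_false, sub_eq_zero, neg_eq_zero]
          at hj <;> simp [hj]
      rcases key j hj with ⟨rfl, h⟩ | ⟨rfl, h⟩ | ⟨rfl, h⟩ | ⟨rfl, h⟩ | ⟨rfl, h⟩ <;>
        rcases key j' hj' with ⟨rfl, h'⟩ | ⟨rfl, h'⟩ | ⟨rfl, h'⟩ | ⟨rfl, h'⟩ | ⟨rfl, h'⟩ <;>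
        first
          | exact absurd hjj (by decide)
          | simp_all
    have hq : ∃ q, ∃ c : ℝ, v = c • N q := by
      rcases hv with ⟨h, h'⟩ | ⟨h, h'⟩ | ⟨h, h'⟩ | ⟨h, h'⟩ | ⟨h, h'⟩ | ⟨h, h'⟩
      · exact ⟨0, v 2, by ext i; fin_cases i <;> simp [hN, h, h']⟩
      · exact ⟨1, v 0, by ext i; fin_cases i <;> simp [hN, h, h']⟩
      · exact ⟨2, v 1, by ext i; fin_cases i <;> simp [hN, h, h']⟩
      · exact ⟨3, v 1, by ext i; fin_cases i <;> simp [hN, h, h']⟩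
      · exact ⟨4, v 1, by ext i; fin_cases i <;> simp [hN, h, h']⟩
      · exact ⟨5, v 1, by ext i; fin_cases i <;> simp [hN, h, h']⟩
    obtain ⟨q, c, rfl⟩ := hq
    have hmul : ∀ i, functional (c • N q) (a i) = c * functional (N q) (a i) := by
      intro i
      simp only [functional_apply, Pi.smul_apply, smul_eq_mul, Finset.mul_sum, mul_assoc]
    refine ⟨q, c, ?_, hmul⟩
    rintro rfl
    exact hi (by rw [hmul, zero_mul])

end FacetCount

end TropHyper
end

noncomputable section

namespace TropHyper

variable {g : ℕ} {C : ℤ → ℝ}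

/-! ### Initial arcs of the basic cycles -/

/-- The point is not a vertex of the ladder. -/
def NonVertex (g : ℕ) (C : ℤ → ℝ) (P : ℝ × ℝ) : Prop := ∀ k ≤ g, P ≠ v g C k ∧ P ≠ w g C k

theorem nonVertex_pt (hC : IsGeneric g C) (e : Edge g) {t : ℝ} (ht : t ∈ Ioo 0 (e.len C)) :
    NonVertex g C (e.pt C t) := by
  intro k hk
  have ht1 := ht.1
  have ht2 := ht.2
  rcases e with i | i | i
  · rw [pt_vert]
    simp only [Edge.len, p] at ht2
    constructor <;> intro h <;> simp only [v, w, Prod.mk.injEq] at h <;>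
      obtain rfl : (i : ℕ) = k := lam_injective hC (by omega) hk h.1
    · linarith [h.2]
    · linarith [h.2]
  · rw [pt_lower hC i (Ioo_subset_Icc_self ht)]
    simp only [Edge.len] at ht2
    have := ne_lam_of_mem_Ioo hC i.2 (X := lam g C i + t) ⟨by linarith, by linarith⟩ hk
    constructor <;> intro h <;> simp only [v, w, Prod.mk.injEq] at h <;> exact this h.1
  · rw [pt_upper hC i (Ioo_subset_Icc_self ht)]
    simp only [Edge.len] at ht2
    have := ne_lam_of_mem_Ioo hC i.2 (X := lam g C i + t) ⟨by linarith, by linarith⟩ hk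
    constructor <;> intro h <;> simp only [v, w, Prod.mk.injEq] at h <;> exact this h.1

theorem src_tgt_vertex (e : Edge g) :
    (∃ k ≤ g, e.src C = v g C k ∨ e.src C = w g C k) ∧
      ∃ k ≤ g, e.tgt C = v g C k ∨ e.tgt C = w g C k := by
  rcases e with i | i | i
  · exact ⟨⟨i, by omega, .inl rfl⟩, ⟨i, by omega, .inr rfl⟩⟩
  · exact ⟨⟨i, by omega, .inl rfl⟩, ⟨i + 1, by omega, .inl rfl⟩⟩
  · exact ⟨⟨i, by omega, .inr rfl⟩, ⟨i + 1, by omega, .inr rfl⟩⟩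

theorem exists_pt_of_nonVertex (hC : IsGeneric g C) (e : Edge g) {P : ℝ × ℝ} (hP : P ∈ e.seg C)
    (hv : NonVertex g C P) : ∃ t ∈ Ioo 0 (e.len C), e.pt C t = P := by
  rw [e.seg_eq hC] at hP
  obtain ⟨t, ht, rfl⟩ := hP
  obtain ⟨⟨k, hk, h⟩, ⟨k', hk', h'⟩⟩ := src_tgt_vertex (C := C) e
  refine ⟨t, ⟨lt_of_le_of_ne ht.1 ?_, lt_of_le_of_ne ht.2 ?_⟩, rfl⟩
  · rintro rfl
    rw [e.pt_zero] at hv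
    exact h.elim (hv k hk).1 (hv k hk).2
  · rintro rfl
    rw [← e.tgt_eq hC] at hv
    exact h'.elim (hv k' hk').1 (hv k' hk').2

theorem isInitialArc_five {a b c d e : ℝ × ℝ} {γ : List (ℝ × ℝ)} {P : ℝ × ℝ} :
    IsInitialArc [a, b, c, d, e] γ P ↔
      (P ∈ segment ℝ a b ∧ γ = [a, P]) ∨ (P ∈ segment ℝ b c ∧ γ = [a, b, P]) ∨
      (P ∈ segment ℝ c d ∧ γ = [a, b, c, P]) ∨ (P ∈ segment ℝ d e ∧ γ = [a, b, c, d, P]) := by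
  constructor
  · rintro ⟨l₁, x, y, l₂, hL, hP, rfl⟩
    match l₁ with
    | [] =>
      simp only [List.nil_append, List.cons.injEq] at hL
      obtain ⟨rfl, rfl, -⟩ := hL
      exact .inl ⟨hP, rfl⟩
    | [x₁] =>
      simp only [List.cons_append, List.nil_append, List.cons.injEq] at hL
      obtain ⟨rfl, rfl, rfl, -⟩ := hL
      exact .inr (.inl ⟨hP, rfl⟩)
    | [x₁, x₂] =>
      simp only [List.cons_append, List.nil_append, List.cons.injEq] at hL
      obtain ⟨rfl, rfl, rfl, rfl, -⟩ := hL
      exact .inr (.inr (.inl ⟨hP, rfl⟩))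
    | [x₁, x₂, x₃] =>
      simp only [List.cons_append, List.nil_append, List.cons.injEq] at hL
      obtain ⟨rfl, rfl, rfl, rfl, rfl, -⟩ := hL
      exact .inr (.inr (.inr ⟨hP, rfl⟩))
    | x₁ :: x₂ :: x₃ :: x₄ :: l =>
      have := congrArg List.length hL
      simp at this
      omega
  · rintro (⟨h, rfl⟩ | ⟨h, rfl⟩ | ⟨h, rfl⟩ | ⟨h, rfl⟩)
    · exact ⟨[], a, b, [c, d, e], rfl, h, rfl⟩
    · exact ⟨[a], b, c, [d, e], rfl, h, rfl⟩
    · exact ⟨[a, b], c, d, [e], rfl, h, rfl⟩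
    · exact ⟨[a, b, c], d, e, [], rfl, h, rfl⟩

/-! ### The values of `Qvec` on pieces of single edges. -/

section Steps

variable (hC : IsGeneric g C) (i : Fin g) {t : ℝ}
include hC

theorem Qvec_lower (ht : t ∈ Icc 0 (stepLen g C i)) :
    Qvec g C [v g C i, (lower i).pt C t] = t • (lower i).dir := by
  rw [v_eq_lower, Qvec_pt hC _ ⟨le_rfl, ((lower i).len_pos hC).le⟩ ht, sub_zero]

theorem Qvec_right (ht : t ∈ Icc 0 (p g C (i + 1))) :
    Qvec g C [v g C (i + 1), (right i).pt C t] = t • (right i).dir := by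
  rw [v_eq_right, Qvec_pt hC _ ⟨le_rfl, ((right i).len_pos hC).le⟩ ht, sub_zero]

theorem Qvec_upper (ht : t ∈ Icc 0 (stepLen g C i)) :
    Qvec g C [w g C (i + 1), (upper i).pt C (stepLen g C i - t)] = -(t • (upper i).dir) := by
  have hl : (upper i).len C = stepLen g C i := rfl
  rw [w_eq_upper_len hC, Qvec_pt hC _ ⟨((upper i).len_pos hC).le, le_rfl⟩
    ⟨by linarith [ht.2], by rw [hl]; linarith [ht.1]⟩, hl, sub_sub_cancel_left, neg_smul]

theorem Qvec_left (ht : t ∈ Icc 0 (p g C i)) :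
    Qvec g C [w g C i, (left i).pt C (p g C i - t)] = -(t • (left i).dir) := by
  have hl : (left i).len C = p g C i := rfl
  rw [w_eq_left_len hC, Qvec_pt hC _ ⟨((left i).len_pos hC).le, le_rfl⟩
    ⟨by linarith [ht.2], by rw [hl]; linarith [ht.1]⟩, hl, sub_sub_cancel_left, neg_smul]

theorem Qvec_lower_edge : Qvec g C [v g C i, v g C (i + 1)] = stepLen g C i • (lower i).dir := by
  have := Qvec_lower hC i (t := stepLen g C i) ⟨(stepLen_pos hC i).le, le_rfl⟩
  rwa [show (lower i).pt C (stepLen g C i) = v g C (i + 1) from (v_eq_lower_len hC i).symm] at this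

theorem Qvec_right_edge :
    Qvec g C [v g C (i + 1), w g C (i + 1)] = p g C (i + 1) • (right i).dir := by
  have := Qvec_right hC i (t := p g C (i + 1)) ⟨(p_pos hC (i := i + 1) i.2).le, le_rfl⟩
  rwa [show (right i).pt C (p g C (i + 1)) = w g C (i + 1) from (w_eq_right_len hC i).symm] at this

theorem Qvec_upper_edge :
    Qvec g C [w g C (i + 1), w g C i] = -(stepLen g C i • (upper i).dir) := by
  have := Qvec_upper hC i (t := stepLen g C i) ⟨(stepLen_pos hC i).le, le_rfl⟩
  rwa [sub_self, ← w_eq_upper] at this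

theorem Qvec_left_edge : Qvec g C [w g C i, v g C i] = -(p g C i • (left i).dir) := by
  have := Qvec_left hC i (t := p g C i) ⟨(p_pos hC i.2.le).le, le_rfl⟩
  rwa [sub_self, ← v_eq_left] at this

end Steps

/-- The base point of the cycle number `i`, as a point of the universal cover. -/
def basePos (g : ℕ) (C : ℤ → ℝ) (i : Fin g) : ℝ := if (i : ℕ) = 0 then stepLen g C 0 else 0

/-- The positions of the points of the cycle number `i` that are not vertices, in one turn that
starts from the base point. -/
def openPos (g : ℕ) (C : ℤ → ℝ) (i : Fin g) : Set ℝ :=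
  Ioo (basePos g C i) (basePos g C i + cyc g C i) \
    {stepLen g C i, stepLen g C i + p g C (i + 1), 2 * stepLen g C i + p g C (i + 1), cyc g C i}

/-- The lift of the Abel–Jacobi map that vanishes at the base points. -/
def lift (g : ℕ) (C : ℤ → ℝ) (x : Fin g → ℝ) : Fin g → ℝ :=
  ∑ i, (beta g C i (x i) - beta g C i (basePos g C i))

theorem loopPt_turn (hC : IsGeneric g C) (i : Fin g) (x : ℝ) :
    loopPt g C i (cyc g C i + x) = loopPt g C i x := by
  have := loopPt_add_period hC i 1 x
  rwa [Int.cast_one, one_mul, add_comm] at this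

theorem beta_turn (hC : IsGeneric g C) (i : Fin g) (x : ℝ) :
    beta g C i (cyc g C i + x) = beta g C i x + Qvec g C (alpha g C i) := by
  have := beta_add_period hC i 1 x
  rwa [Int.cast_one, one_mul, one_smul, add_comm x] at this

/-- The position `r` and the initial arc `γ` of the based loop number `i` lead to the same point. -/
def ArcAt (g : ℕ) (C : ℤ → ℝ) (i : Fin g) (γ : List (ℝ × ℝ)) (P : ℝ × ℝ) (r : ℝ) : Prop :=
  r ∈ openPos g C i ∧ loopPt g C i r = P ∧ Qvec g C γ = beta g C i r - beta g C i (basePos g C i)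

/-! ### Initial arcs and the increments of `beta`. -/

section Arcs

variable (hC : IsGeneric g C) (i : Fin g) {t : ℝ}
include hC

theorem beta_lower (ht : t ∈ Icc 0 (stepLen g C i)) : beta g C i t = t • (lower i).dir := by
  obtain ⟨e1, e2, e3, e4⟩ := covs_lower hC i ht
  simp only [beta, e1, e2, e3, e4]
  module

theorem beta_right (ht : t ∈ Icc 0 (p g C (i + 1))) : beta g C i (stepLen g C i + t) =
    stepLen g C i • (lower i).dir + t • (right i).dir := by
  obtain ⟨e1, e2, e3, e4⟩ := covs_right hC i ht
  simp only [beta, e1, e2, e3, e4]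
  module

theorem beta_upper (ht : t ∈ Icc 0 (stepLen g C i)) :
    beta g C i (stepLen g C i + p g C (i + 1) + t) =
    stepLen g C i • (lower i).dir + p g C (i + 1) • (right i).dir - t • (upper i).dir := by
  obtain ⟨e1, e2, e3, e4⟩ := covs_upper hC i ht
  simp only [beta, e1, e2, e3, e4]
  module

theorem beta_left (ht : t ∈ Icc 0 (p g C i)) :
    beta g C i (2 * stepLen g C i + p g C (i + 1) + t) =
    stepLen g C i • (lower i).dir + p g C (i + 1) • (right i).dir -
      stepLen g C i • (upper i).dir - t • (left i).dir := by
  obtain ⟨e1, e2, e3, e4⟩ := covs_left hC i ht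
  simp only [beta, e1, e2, e3, e4]

theorem Qvec_alpha_eq : Qvec g C (alpha g C i) = stepLen g C i • (lower i).dir +
    p g C (i + 1) • (right i).dir - stepLen g C i • (upper i).dir - p g C i • (left i).dir :=
  Qvec_alpha hC i

theorem beta_basePos : beta g C i (basePos g C i) = basePos g C i • (lower i).dir := by
  have h1 := stepLen_pos hC i
  refine beta_lower hC i ?_
  unfold basePos
  split_ifs with h
  · rw [h] at h1 ⊢
    exact ⟨h1.le, le_rfl⟩
  · exact ⟨le_rfl, h1.le⟩

/-- The points of the open edges, in the order in which a loop that starts at `v_i` meets them. -/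
theorem arcAt_of_ne (hi : (i : ℕ) ≠ 0) :
    (t ∈ Ioo 0 (stepLen g C i) → ArcAt g C i [v g C i, (lower i).pt C t] ((lower i).pt C t) t) ∧
    (t ∈ Ioo 0 (p g C (i + 1)) → ArcAt g C i [v g C i, v g C (i + 1), (right i).pt C t]
      ((right i).pt C t) (stepLen g C i + t)) ∧
    (t ∈ Ioo 0 (stepLen g C i) → ArcAt g C i
      [v g C i, v g C (i + 1), w g C (i + 1), (upper i).pt C (stepLen g C i - t)]
      ((upper i).pt C (stepLen g C i - t)) (stepLen g C i + p g C (i + 1) + t)) ∧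
    (t ∈ Ioo 0 (p g C i) → ArcAt g C i
      [v g C i, v g C (i + 1), w g C (i + 1), w g C i, (left i).pt C (p g C i - t)]
      ((left i).pt C (p g C i - t)) (2 * stepLen g C i + p g C (i + 1) + t)) := by
  have hp : basePos g C i = 0 := if_neg hi
  have hb : beta g C i (basePos g C i) = 0 := by rw [beta_basePos hC, hp, zero_smul]
  have h1 := stepLen_pos hC i
  have h2 := p_pos hC i.2.le
  have h3 := p_pos hC (i := i + 1) i.2
  have hpos : ∀ r, (0 < r ∧ r < 2 * stepLen g C i + p g C (i + 1) + p g C i) ∧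
      (r ≠ stepLen g C i ∧ r ≠ stepLen g C i + p g C (i + 1) ∧
      r ≠ 2 * stepLen g C i + p g C (i + 1) ∧ r ≠ 2 * stepLen g C i + p g C (i + 1) + p g C i) →
      r ∈ openPos g C i := by
    rintro r ⟨hr, hr'⟩
    refine ⟨by rw [hp, zero_add]; exact hr, ?_⟩
    simp only [mem_insert_iff, mem_singleton_iff, not_or]
    exact hr'
  refine ⟨fun ht => ?_, fun ht => ?_, fun ht => ?_, fun ht => ?_⟩ <;>
    obtain ⟨ht1, ht2⟩ := ht <;> have ht' := Ioo_subset_Icc_self (show t ∈ Ioo _ _ from ⟨ht1, ht2⟩)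
  · refine ⟨hpos _ ⟨⟨?_, ?_⟩, ?_, ?_, ?_, ?_⟩, loopPt_lower hC i ht', ?_⟩
    iterate 2 linarith
    iterate 4 intro h; linarith
    rw [hb, sub_zero, beta_lower hC i ht', Qvec_lower hC i ht']
  · refine ⟨hpos _ ⟨⟨?_, ?_⟩, ?_, ?_, ?_, ?_⟩, loopPt_right hC i ht', ?_⟩
    iterate 2 linarith
    iterate 4 intro h; linarith
    rw [hb, sub_zero, beta_right hC i ht', Qvec_cons_cons hC, Qvec_lower_edge hC,
      Qvec_right hC i ht']
  · refine ⟨hpos _ ⟨⟨?_, ?_⟩, ?_, ?_, ?_, ?_⟩, loopPt_upper hC i ht', ?_⟩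
    iterate 2 linarith
    iterate 4 intro h; linarith
    rw [hb, sub_zero, beta_upper hC i ht', Qvec_cons_cons hC, Qvec_lower_edge hC,
      Qvec_cons_cons hC, Qvec_right_edge hC, Qvec_upper hC i ht']
    abel
  · refine ⟨hpos _ ⟨⟨?_, ?_⟩, ?_, ?_, ?_, ?_⟩, loopPt_left hC i ht', ?_⟩
    iterate 2 linarith
    iterate 4 intro h; linarith
    rw [hb, sub_zero, beta_left hC i ht', Qvec_cons_cons hC, Qvec_lower_edge hC,
      Qvec_cons_cons hC, Qvec_right_edge hC, Qvec_cons_cons hC, Qvec_upper_edge hC,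
      Qvec_left hC i ht']
    abel

/-- The points of the open edges, in the order in which a loop that starts at `v_{i+1}` meets
them. -/
theorem arcAt_of_eq (hi : (i : ℕ) = 0) :
    (t ∈ Ioo 0 (p g C (i + 1)) → ArcAt g C i [v g C (i + 1), (right i).pt C t]
      ((right i).pt C t) (stepLen g C i + t)) ∧
    (t ∈ Ioo 0 (stepLen g C i) → ArcAt g C i
      [v g C (i + 1), w g C (i + 1), (upper i).pt C (stepLen g C i - t)]
      ((upper i).pt C (stepLen g C i - t)) (stepLen g C i + p g C (i + 1) + t)) ∧
    (t ∈ Ioo 0 (p g C i) → ArcAt g C i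
      [v g C (i + 1), w g C (i + 1), w g C i, (left i).pt C (p g C i - t)]
      ((left i).pt C (p g C i - t)) (2 * stepLen g C i + p g C (i + 1) + t)) ∧
    (t ∈ Ioo 0 (stepLen g C i) → ArcAt g C i
      [v g C (i + 1), w g C (i + 1), w g C i, v g C i, (lower i).pt C t]
      ((lower i).pt C t) (cyc g C i + t)) := by
  have hp : basePos g C i = stepLen g C i := by rw [basePos, if_pos hi, hi]
  have hb : beta g C i (basePos g C i) = stepLen g C i • (lower i).dir := by
    rw [beta_basePos hC, hp]
  have h1 := stepLen_pos hC i
  have h2 := p_pos hC i.2.le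
  have h3 := p_pos hC (i := i + 1) i.2
  have hpos : ∀ r, (stepLen g C i < r ∧
      r < stepLen g C i + (2 * stepLen g C i + p g C (i + 1) + p g C i)) ∧
      (r ≠ stepLen g C i ∧ r ≠ stepLen g C i + p g C (i + 1) ∧
      r ≠ 2 * stepLen g C i + p g C (i + 1) ∧ r ≠ 2 * stepLen g C i + p g C (i + 1) + p g C i) →
      r ∈ openPos g C i := by
    rintro r ⟨hr, hr'⟩
    refine ⟨by rw [hp]; exact hr, ?_⟩
    simp only [mem_insert_iff, mem_singleton_iff, not_or]
    exact hr'
  refine ⟨fun ht => ?_, fun ht => ?_, fun ht => ?_, fun ht => ?_⟩ <;>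
    obtain ⟨ht1, ht2⟩ := ht <;> have ht' := Ioo_subset_Icc_self (show t ∈ Ioo _ _ from ⟨ht1, ht2⟩)
  · refine ⟨hpos _ ⟨⟨?_, ?_⟩, ?_, ?_, ?_, ?_⟩, loopPt_right hC i ht', ?_⟩
    iterate 2 linarith
    iterate 4 intro h; linarith
    rw [hb, beta_right hC i ht', Qvec_right hC i ht']
    abel
  · refine ⟨hpos _ ⟨⟨?_, ?_⟩, ?_, ?_, ?_, ?_⟩, loopPt_upper hC i ht', ?_⟩
    iterate 2 linarith
    iterate 4 intro h; linarith
    rw [hb, beta_upper hC i ht', Qvec_cons_cons hC, Qvec_right_edge hC, Qvec_upper hC i ht']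
    abel
  · refine ⟨hpos _ ⟨⟨?_, ?_⟩, ?_, ?_, ?_, ?_⟩, loopPt_left hC i ht', ?_⟩
    iterate 2 linarith
    iterate 4 intro h; linarith
    rw [hb, beta_left hC i ht', Qvec_cons_cons hC, Qvec_right_edge hC, Qvec_cons_cons hC,
      Qvec_upper_edge hC, Qvec_left hC i ht']
    abel
  · refine ⟨hpos _ ?_, (loopPt_turn hC i t).trans (loopPt_lower hC i ht'), ?_⟩
    · unfold cyc
      refine ⟨⟨?_, ?_⟩, ?_, ?_, ?_, ?_⟩
      iterate 2 linarith
      iterate 4 intro h; linarith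
    rw [hb, beta_turn hC, beta_lower hC i ht', Qvec_alpha_eq hC, Qvec_cons_cons hC,
      Qvec_right_edge hC, Qvec_cons_cons hC, Qvec_upper_edge hC, Qvec_cons_cons hC,
      Qvec_left_edge hC, Qvec_lower hC i ht']
    abel

end Arcs

theorem mem_segment_cases (hC : IsGeneric g C) (i : Fin g) {P : ℝ × ℝ} (hv : NonVertex g C P) :
    (P ∈ segment ℝ (v g C i) (v g C (i + 1)) →
      ∃ t ∈ Ioo 0 (stepLen g C i), (lower i).pt C t = P) ∧
    (P ∈ segment ℝ (v g C (i + 1)) (w g C (i + 1)) →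
      ∃ t ∈ Ioo 0 (p g C (i + 1)), (right i).pt C t = P) ∧
    (P ∈ segment ℝ (w g C (i + 1)) (w g C i) →
      ∃ t ∈ Ioo 0 (stepLen g C i), (upper i).pt C (stepLen g C i - t) = P) ∧
    (P ∈ segment ℝ (w g C i) (v g C i) →
      ∃ t ∈ Ioo 0 (p g C i), (left i).pt C (p g C i - t) = P) := by
  have hrev : ∀ {L : ℝ} {f : ℝ → ℝ × ℝ}, (∃ t ∈ Ioo 0 L, f t = P) → ∃ t ∈ Ioo 0 L, f (L - t) = P := by
    rintro L f ⟨t, ht, rfl⟩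
    exact ⟨L - t, ⟨sub_pos.mpr ht.2, sub_lt_self _ ht.1⟩, by rw [sub_sub_cancel]⟩
  refine ⟨fun h => exists_pt_of_nonVertex hC (lower i) h hv,
    fun h => exists_pt_of_nonVertex hC (right i) h hv,
    fun h => hrev ?_, fun h => hrev ?_⟩
  · rw [segment_symm] at h
    exact exists_pt_of_nonVertex hC (upper i) h hv
  · rw [segment_symm] at h
    exact exists_pt_of_nonVertex hC (left i) h hv

/-- An initial arc that ends at a point which is not a vertex has a position. -/
theorem exists_arcAt (hC : IsGeneric g C) (i : Fin g) {γ : List (ℝ × ℝ)} {P : ℝ × ℝ}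
    (h : IsInitialArc (basedLoop g C i) γ P) (hv : NonVertex g C P) :
    ∃ r, ArcAt g C i γ P r := by
  obtain ⟨h1, h2, h3, h4⟩ := mem_segment_cases hC i hv
  by_cases hi : (i : ℕ) = 0
  · have hb : basedLoop g C i = [v g C (i + 1), w g C (i + 1), w g C i, v g C i, v g C (i + 1)] := by
      rw [basedLoop, if_pos hi, hi]
    rw [hb, isInitialArc_five] at h
    rcases h with ⟨hP, rfl⟩ | ⟨hP, rfl⟩ | ⟨hP, rfl⟩ | ⟨hP, rfl⟩
    · obtain ⟨t, ht, rfl⟩ := h2 hP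
      exact ⟨_, (arcAt_of_eq hC i hi).1 ht⟩
    · obtain ⟨t, ht, rfl⟩ := h3 hP
      exact ⟨_, (arcAt_of_eq hC i hi).2.1 ht⟩
    · obtain ⟨t, ht, rfl⟩ := h4 hP
      exact ⟨_, (arcAt_of_eq hC i hi).2.2.1 ht⟩
    · obtain ⟨t, ht, rfl⟩ := h1 hP
      exact ⟨_, (arcAt_of_eq hC i hi).2.2.2 ht⟩
  · rw [basedLoop, if_neg hi, alpha, isInitialArc_five] at h
    rcases h with ⟨hP, rfl⟩ | ⟨hP, rfl⟩ | ⟨hP, rfl⟩ | ⟨hP, rfl⟩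
    · obtain ⟨t, ht, rfl⟩ := h1 hP
      exact ⟨_, (arcAt_of_ne hC i hi).1 ht⟩
    · obtain ⟨t, ht, rfl⟩ := h2 hP
      exact ⟨_, (arcAt_of_ne hC i hi).2.1 ht⟩
    · obtain ⟨t, ht, rfl⟩ := h3 hP
      exact ⟨_, (arcAt_of_ne hC i hi).2.2.1 ht⟩
    · obtain ⟨t, ht, rfl⟩ := h4 hP
      exact ⟨_, (arcAt_of_ne hC i hi).2.2.2 ht⟩

theorem pt_mem_segments (hC : IsGeneric g C) (i : Fin g) {t : ℝ} :
    (t ∈ Ioo 0 (stepLen g C i) → (lower i).pt C t ∈ segment ℝ (v g C i) (v g C (i + 1)) ∧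
      NonVertex g C ((lower i).pt C t)) ∧
    (t ∈ Ioo 0 (p g C (i + 1)) → (right i).pt C t ∈ segment ℝ (v g C (i + 1)) (w g C (i + 1)) ∧
      NonVertex g C ((right i).pt C t)) ∧
    (t ∈ Ioo 0 (stepLen g C i) →
      (upper i).pt C (stepLen g C i - t) ∈ segment ℝ (w g C (i + 1)) (w g C i) ∧
      NonVertex g C ((upper i).pt C (stepLen g C i - t))) ∧
    (t ∈ Ioo 0 (p g C i) → (left i).pt C (p g C i - t) ∈ segment ℝ (w g C i) (v g C i) ∧
      NonVertex g C ((left i).pt C (p g C i - t))) := by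
  have key : ∀ (e : Edge g) (s : ℝ), s ∈ Ioo 0 (e.len C) →
      e.pt C s ∈ segment ℝ (e.src C) (e.tgt C) ∧ NonVertex g C (e.pt C s) := fun e s hs =>
    ⟨e.pt_mem_seg hC (Ioo_subset_Icc_self hs), nonVertex_pt hC e hs⟩
  refine ⟨fun h => key (lower i) _ h, fun h => key (right i) _ h, fun h => ?_, fun h => ?_⟩
  · rw [segment_symm]
    exact key (upper i) _ ⟨sub_pos.mpr h.2, sub_lt_self _ h.1⟩
  · rw [segment_symm]
    exact key (left i) _ ⟨sub_pos.mpr h.2, sub_lt_self _ h.1⟩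

/-- Each admissible position belongs to an initial arc. -/
theorem exists_initialArc (hC : IsGeneric g C) (i : Fin g) {r : ℝ} (hr : r ∈ openPos g C i) :
    ∃ γ, IsInitialArc (basedLoop g C i) γ (loopPt g C i r) ∧ NonVertex g C (loopPt g C i r) ∧
      Qvec g C γ = beta g C i r - beta g C i (basePos g C i) := by
  obtain ⟨⟨hr1, hr2⟩, hr3⟩ := hr
  simp only [mem_insert_iff, mem_singleton_iff, not_or] at hr3
  obtain ⟨n1, n2, n3, n4⟩ := hr3
  have fin : ∀ {γ : List (ℝ × ℝ)} {P : ℝ × ℝ} {r' : ℝ}, ArcAt g C i γ P r' → r' = r →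
      IsInitialArc (basedLoop g C i) γ P → NonVertex g C P → ∃ γ,
      IsInitialArc (basedLoop g C i) γ (loopPt g C i r) ∧ NonVertex g C (loopPt g C i r) ∧
      Qvec g C γ = beta g C i r - beta g C i (basePos g C i) := by
    rintro γ P r' ⟨-, rfl, hQ⟩ rfl ha hv
    exact ⟨γ, ha, hv, hQ⟩
  have hcyc : cyc g C i = 2 * stepLen g C i + p g C (i + 1) + p g C i := rfl
  have hright : stepLen g C i < r → r < stepLen g C i + p g C (i + 1) →
      r - stepLen g C i ∈ Ioo 0 (p g C (i + 1)) := fun h h' => ⟨by linarith, by linarith⟩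
  have hupper : stepLen g C i + p g C (i + 1) < r → r < 2 * stepLen g C i + p g C (i + 1) →
      r - (stepLen g C i + p g C (i + 1)) ∈ Ioo 0 (stepLen g C i) :=
    fun h h' => ⟨by linarith, by linarith⟩
  have hleft : 2 * stepLen g C i + p g C (i + 1) < r → r < cyc g C i →
      r - (2 * stepLen g C i + p g C (i + 1)) ∈ Ioo 0 (p g C i) :=
    fun h h' => ⟨by linarith, by linarith⟩
  by_cases hi : (i : ℕ) = 0
  · have hb : basedLoop g C i = [v g C (i + 1), w g C (i + 1), w g C i, v g C i, v g C (i + 1)] := by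
      rw [basedLoop, if_pos hi, hi]
    have hp : basePos g C i = stepLen g C i := by rw [basePos, if_pos hi, hi]
    rw [hp] at hr1 hr2
    rcases lt_or_gt_of_ne n2 with a2 | a2
    · have ht := hright hr1 a2
      obtain ⟨s1, s2⟩ := (pt_mem_segments hC i).2.1 ht
      refine fin ((arcAt_of_eq hC i hi).1 ht) (by ring) ?_ s2
      rw [hb, isInitialArc_five]
      exact .inl ⟨s1, rfl⟩
    rcases lt_or_gt_of_ne n3 with a3 | a3
    · have ht := hupper a2 a3
      obtain ⟨s1, s2⟩ := (pt_mem_segments hC i).2.2.1 ht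
      refine fin ((arcAt_of_eq hC i hi).2.1 ht) (by ring) ?_ s2
      rw [hb, isInitialArc_five]
      exact .inr (.inl ⟨s1, rfl⟩)
    rcases lt_or_gt_of_ne n4 with a4 | a4
    · have ht := hleft a3 a4
      obtain ⟨s1, s2⟩ := (pt_mem_segments hC i).2.2.2 ht
      refine fin ((arcAt_of_eq hC i hi).2.2.1 ht) (by ring) ?_ s2
      rw [hb, isInitialArc_five]
      exact .inr (.inr (.inl ⟨s1, rfl⟩))
    · have ht : r - cyc g C i ∈ Ioo 0 (stepLen g C i) := ⟨by linarith, by linarith⟩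
      obtain ⟨s1, s2⟩ := (pt_mem_segments hC i).1 ht
      refine fin ((arcAt_of_eq hC i hi).2.2.2 ht) (by ring) ?_ s2
      rw [hb, isInitialArc_five]
      exact .inr (.inr (.inr ⟨s1, rfl⟩))
  · have hb : basedLoop g C i = [v g C i, v g C (i + 1), w g C (i + 1), w g C i, v g C i] := by
      rw [basedLoop, if_neg hi, alpha]
    have hp : basePos g C i = 0 := if_neg hi
    rw [hp] at hr1 hr2
    rcases lt_or_gt_of_ne n1 with a1 | a1
    · have ht : r ∈ Ioo 0 (stepLen g C i) := ⟨hr1, a1⟩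
      obtain ⟨s1, s2⟩ := (pt_mem_segments hC i).1 ht
      refine fin ((arcAt_of_ne hC i hi).1 ht) rfl ?_ s2
      rw [hb, isInitialArc_five]
      exact .inl ⟨s1, rfl⟩
    rcases lt_or_gt_of_ne n2 with a2 | a2
    · have ht := hright a1 a2
      obtain ⟨s1, s2⟩ := (pt_mem_segments hC i).2.1 ht
      refine fin ((arcAt_of_ne hC i hi).2.1 ht) (by ring) ?_ s2
      rw [hb, isInitialArc_five]
      exact .inr (.inl ⟨s1, rfl⟩)
    rcases lt_or_gt_of_ne n3 with a3 | a3
    · have ht := hupper a2 a3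
      obtain ⟨s1, s2⟩ := (pt_mem_segments hC i).2.2.1 ht
      refine fin ((arcAt_of_ne hC i hi).2.2.1 ht) (by ring) ?_ s2
      rw [hb, isInitialArc_five]
      exact .inr (.inr (.inl ⟨s1, rfl⟩))
    · have ht := hleft a3 (by linarith)
      obtain ⟨s1, s2⟩ := (pt_mem_segments hC i).2.2.2 ht
      refine fin ((arcAt_of_ne hC i hi).2.2.2 ht) (by ring) ?_ s2
      rw [hb, isInitialArc_five]
      exact .inr (.inr (.inr ⟨s1, rfl⟩))

/-- The admissible positions of the divisors in `𝓓^g(Γ)` without vertices. -/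
def openDiv (g : ℕ) (C : ℤ → ℝ) : Set (Fin g → ℝ) :=
  {r | (∀ i, r i ∈ openPos g C i) ∧ loopDiv g C r ∈ DSet g C}

/-- Away from the vertices, initial arcs of the based loops correspond to positions in one open
turn, and the vector of such an arc is the increment of `beta` from the base point. -/
theorem liftedImage_eq (hC : IsGeneric g C) :
    liftedImage g C = closure (lift g C '' openDiv g C) := by
  unfold liftedImage
  congr 1
  ext z
  constructor
  · rintro ⟨P, γ, hD, ha, hv, rfl⟩
    choose r hr using fun i => exists_arcAt hC i (ha i) (hv i)
    refine ⟨r, ⟨fun i => (hr i).1, ?_⟩, ?_⟩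
    · simp only [loopDiv, (hr _).2.1]
      exact hD
    · exact Finset.sum_congr rfl fun i _ => (hr i).2.2.symm
  · rintro ⟨r, ⟨hr, hD⟩, rfl⟩
    choose γ hγ hv hQ using fun i => exists_initialArc hC i (hr i)
    exact ⟨fun i => loopPt g C i (r i), γ, hD, hγ, hv, Finset.sum_congr rfl fun i _ => (hQ i).symm⟩

end TropHyper
end

noncomputable section

namespace TropHyper

variable {g m : ℕ} {C : ℤ → ℝ}

/-! ### Decompositions into cells on which the lift is affine -/

theorem int_eq_zero_of_abs_lt {L : ℝ} (hL : 0 < L) {n : ℤ} (h1 : -L < n * L) (h2 : n * L < L) :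
    n = 0 := by
  have a : (-1 : ℝ) < n := by
    by_contra h
    nlinarith
  have b : (n : ℝ) < 1 := by
    by_contra h
    nlinarith
  have a' : (-1 : ℤ) < n := by exact_mod_cast a
  have b' : n < (1 : ℤ) := by exact_mod_cast b
  omega

/-- One turn on the universal cover of the cycle number `i`, starting from the base point. -/
def turn (g : ℕ) (C : ℤ → ℝ) (i : Fin g) : Set ℝ :=
  -- For the first cycle the base point begins the shared right edge, for the others it ends the
  -- shared left edge. The half-open interval is chosen so that in both cases this vertex is counted
  -- with the lower edge.
  if (i : ℕ) = 0 then Ioc (basePos g C i) (basePos g C i + cyc g C i)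
  else Ico (basePos g C i) (basePos g C i + cyc g C i)

theorem exists_turn (hC : IsGeneric g C) (i : Fin g) (x : ℝ) :
    ∃ n : ℤ, x - n * cyc g C i ∈ turn g C i := by
  obtain ⟨n, r, hr, h⟩ := exists_int_mul_add (cyc_pos hC i) (x - basePos g C i)
  unfold turn
  split_ifs with hi
  · rcases hr.1.eq_or_lt with h0 | h0
    · refine ⟨n - 1, ?_, ?_⟩ <;> push_cast <;> linarith [cyc_pos hC i]
    · exact ⟨n, by linarith, by linarith [hr.2]⟩
  · exact ⟨n, by linarith [hr.1], by linarith [hr.2]⟩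

theorem openPos_subset_turn (i : Fin g) : openPos g C i ⊆ turn g C i := by
  rintro r ⟨hr, -⟩
  unfold turn
  split_ifs
  · exact Ioo_subset_Ioc_self hr
  · exact Ioo_subset_Ico_self hr

/-- A divisor in `𝓓^g(Γ)` none of whose points is at the beginning of a common edge of two
cycles. -/
def Regular (g : ℕ) (C : ℤ → ℝ) (x : Fin g → ℝ) : Prop :=
  loopDiv g C x ∈ DSet g C ∧ ∀ i j : Fin g, (j : ℕ) = i + 1 → ∀ n : ℤ,
    x i ≠ n * cyc g C i + stepLen g C i ∧
    x j ≠ n * cyc g C j + (2 * stepLen g C j + p g C (j + 1))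

theorem Regular.add_period (hC : IsGeneric g C) {x : Fin g → ℝ} (h : Regular g C x)
    (n : Fin g → ℤ) : Regular g C fun i => x i + n i * cyc g C i := by
  refine ⟨by rw [loopDiv_add_period hC]; exact h.1, fun i j hij k => ⟨fun he => ?_, fun he => ?_⟩⟩
  · refine (h.2 i j hij (k - n i)).1 ?_
    push_cast
    linarith
  · refine (h.2 i j hij (k - n j)).2 ?_
    push_cast
    linarith

theorem lift_eq (x : Fin g → ℝ) : lift g C x = sumBeta g C x - sumBeta g C (basePos g C) := by
  simp only [lift, sumBeta, Finset.sum_sub_distrib]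

/-- Boxes on which the lift of the Abel–Jacobi map is affine and injective, and which make up
`𝓓^g(Γ)`. -/
structure IsCellDecomp (g : ℕ) (C : ℤ → ℝ) (lo hi x : Fin m → Fin g → ℝ)
    (a : Fin m → Fin g → Fin g → ℝ) : Prop where
  lt : ∀ k i, lo k i < hi k i
  le_lo : ∀ k i, basePos g C i ≤ lo k i
  hi_le : ∀ k i, hi k i ≤ basePos g C i + cyc g C i
  indep : ∀ k, LinearIndependent ℝ (a k)
  affine : ∀ k (r : Fin g → ℝ), (∀ i, r i ∈ Icc (lo k i) (hi k i)) →
    lift g C r = x k + ∑ i, (r i - lo k i) • a k i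
  cover : ∀ r : Fin g → ℝ, (∀ i, r i ∈ turn g C i) → loopDiv g C r ∈ DSet g C →
    ∃ k, ∀ i, r i ∈ Icc (lo k i) (hi k i)
  disjoint : ∀ k k' (r : Fin g → ℝ), (∀ i, r i ∈ Ioo (lo k i) (hi k i)) →
    (∀ i, r i ∈ Ioo (lo k' i) (hi k' i)) → k = k'
  regular : ∀ k (r : Fin g → ℝ), (∀ i, r i ∈ Ioo (lo k i) (hi k i)) → Regular g C r

/-- The parallelotope that is the image of a cell. -/
def tile (lo hi x : Fin m → Fin g → ℝ) (a : Fin m → Fin g → Fin g → ℝ) (k : Fin m) :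
    Set (Fin g → ℝ) := zonotope (x k) fun i => (hi k i - lo k i) • a k i

namespace IsCellDecomp

variable {lo hi x : Fin m → Fin g → ℝ} {a : Fin m → Fin g → Fin g → ℝ}
  (h : IsCellDecomp g C lo hi x a)
include h

theorem indep_smul (k : Fin m) :
    LinearIndependent ℝ fun i => (hi k i - lo k i) • a k i := by
  have := (h.indep k).units_smul fun i => Units.mk0 (hi k i - lo k i) (sub_pos.mpr (h.lt k i)).ne'
  exact this

theorem lift_eq_para {k : Fin m} {t : Fin g → ℝ} (ht : ∀ i, t i ∈ Icc (0 : ℝ) 1) :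
    lift g C (fun i => lo k i + t i * (hi k i - lo k i)) =
      x k + ∑ i, t i • ((hi k i - lo k i) • a k i) := by
  rw [h.affine k]
  · simp only [add_sub_cancel_left, mul_smul]
  · intro i
    have := sub_pos.mpr (h.lt k i)
    obtain ⟨h1, h2⟩ := ht i
    constructor <;> nlinarith

theorem exists_param {k : Fin m} {r : Fin g → ℝ} :
    ∃ t : Fin g → ℝ, (r = fun i => lo k i + t i * (hi k i - lo k i)) ∧
      ∀ i, (r i ∈ Icc (lo k i) (hi k i) → t i ∈ Icc (0 : ℝ) 1) ∧
        (r i ∈ Ioo (lo k i) (hi k i) ↔ t i ∈ Ioo (0 : ℝ) 1) := by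
  refine ⟨fun i => (r i - lo k i) / (hi k i - lo k i), ?_, fun i => ?_⟩
  · ext i
    have := sub_pos.mpr (h.lt k i)
    field_simp
    ring
  · have := sub_pos.mpr (h.lt k i)
    simp only [mem_Icc, mem_Ioo, le_div_iff₀ this, div_le_iff₀ this, lt_div_iff₀ this,
      div_lt_iff₀ this]
    refine ⟨fun h => ⟨by linarith [h.1], by linarith [h.2]⟩, ⟨fun h => ?_, fun h => ?_⟩⟩ <;>
      exact ⟨by linarith [h.1], by linarith [h.2]⟩

theorem lift_mem_tile {k : Fin m} {r : Fin g → ℝ} (hr : ∀ i, r i ∈ Icc (lo k i) (hi k i)) :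
    lift g C r ∈ tile lo hi x a k := by
  obtain ⟨t, rfl, ht⟩ := h.exists_param (k := k) (r := r)
  exact ⟨t, fun i => (ht i).1 (hr i), h.lift_eq_para fun i => (ht i).1 (hr i)⟩

theorem exists_of_mem_interior {k : Fin m} {z : Fin g → ℝ} (hz : z ∈ interior (tile lo hi x a k)) :
    ∃ r, (∀ i, r i ∈ Ioo (lo k i) (hi k i)) ∧ lift g C r = z := by
  rw [tile, interior_zonotope _ (h.indep_smul k)] at hz
  obtain ⟨t, ht, rfl⟩ := hz
  refine ⟨_, fun i => ?_, h.lift_eq_para fun i => Ioo_subset_Icc_self (ht i)⟩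
  have := sub_pos.mpr (h.lt k i)
  obtain ⟨h1, h2⟩ := ht i
  constructor <;> nlinarith

/-- The images of the cells tile the space. -/
theorem isTiling (hC : IsGeneric g C)
    (huniq : ∀ x x', Regular g C x → Regular g C x' → sumBeta g C x = sumBeta g C x' → x = x')
    (hsurj : ∀ z, ∃ x, sumBeta g C x = z ∧ loopDiv g C x ∈ DSet g C) :
    IsTiling (lattice g C) (tile lo hi x a) where
  para k := ⟨_, _, h.indep_smul k, rfl⟩
  cover z := by
    obtain ⟨y, hy, hD⟩ := hsurj (z + sumBeta g C (basePos g C))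
    choose n hn using fun i => exists_turn hC i (y i)
    have hy' : y = fun i => (y i - n i * cyc g C i) + n i * cyc g C i := by
      ext i
      ring
    rw [hy', loopDiv_add_period hC] at hD
    obtain ⟨k, hk⟩ := h.cover _ hn hD
    refine ⟨∑ i, (n i : ℝ) • Qvec g C (alpha g C i), (mem_lattice_iff _).mpr ⟨n, rfl⟩, k, _,
      h.lift_mem_tile hk, ?_⟩
    rw [hy', sumBeta_add_period hC] at hy
    rw [lift_eq, eq_sub_of_add_eq hy.symm]
    abel
  disjoint k k' z hz z' hz' hd := by
    obtain ⟨r, hr, rfl⟩ := h.exists_of_mem_interior hz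
    obtain ⟨r', hr', rfl⟩ := h.exists_of_mem_interior hz'
    obtain ⟨n, hn⟩ := (mem_lattice_iff _).mp hd
    -- Regular positions are determined by their image, so points that differ by a lattice vector
    -- come from positions that differ by full turns; inside one turn they coincide.
    have he : r' = fun i => r i + n i * cyc g C i := by
      refine huniq _ _ (h.regular k' r' hr') ((h.regular k r hr).add_period hC n) ?_
      rw [sumBeta_add_period hC, ← hn, lift_eq, lift_eq]
      abel
    have hrr : r' = r := by
      ext i
      have hi' := congrFun he i
      have h1 := hr i
      have h2 := hr' i
      have : n i = 0 := int_eq_zero_of_abs_lt (cyc_pos hC i)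
        (by linarith [h1.2, h2.1, h.le_lo k' i, h.hi_le k i])
        (by linarith [h1.1, h2.2, h.le_lo k i, h.hi_le k' i])
      rw [hi', this]
      simp
    subst hrr
    exact ⟨rfl, h.disjoint k k' r' hr hr'⟩

/-- The lifted image is the union of the images of the cells. -/
theorem iUnion_tile (hC : IsGeneric g C) : ⋃ k, tile lo hi x a k = liftedImage g C := by
  rw [liftedImage_eq hC]
  apply subset_antisymm
  · refine iUnion_subset fun k => ?_
    -- The parameters at which a point is a vertex. They form a countable set, so leaving them out
    -- does not change the closure.
    set N : Fin g → Set ℝ := fun i => {t | lo k i + t * (hi k i - lo k i) ∈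
      ({stepLen g C i, stepLen g C i + p g C (i + 1), 2 * stepLen g C i + p g C (i + 1), cyc g C i} :
        Set ℝ)} with hN
    have hdense : ∀ i, closure (Ioo (0 : ℝ) 1 ∩ (N i)ᶜ) = Icc 0 1 := by
      intro i
      have hne : hi k i - lo k i ≠ 0 := (sub_pos.mpr (h.lt k i)).ne'
      have hc : (N i).Countable := by
        refine Countable.preimage_of_injOn (Set.toFinite _).countable ?_
        intro s _ t _ hst
        exact mul_right_cancel₀ hne (add_left_cancel hst)
      rw [← closure_Ioo (zero_ne_one' ℝ)]
      exact subset_antisymm (closure_mono inter_subset_left)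
        (closure_minimal ((hc.dense_compl ℝ).open_subset_closure_inter isOpen_Ioo) isClosed_closure)
    have : tile lo hi x a k = closure (paraSet (x k) (fun i => (hi k i - lo k i) • a k i)
        fun i => Ioo (0 : ℝ) 1 ∩ (N i)ᶜ) := by
      rw [closure_paraSet _ (h.indep_smul k), tile, zonotope_eq_paraSet]
      simp only [hdense]
    rw [this]
    refine closure_mono ?_
    rintro _ ⟨t, ht, rfl⟩
    refine ⟨fun i => lo k i + t i * (hi k i - lo k i), ⟨fun i => ⟨?_, (ht i).2⟩, ?_⟩,
      h.lift_eq_para fun i => Ioo_subset_Icc_self (ht i).1⟩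
    · have := sub_pos.mpr (h.lt k i)
      obtain ⟨h1, h2⟩ := (ht i).1
      have := h.le_lo k i
      have := h.hi_le k i
      constructor <;> nlinarith
    · refine (h.regular k _ fun i => ?_).1
      have := sub_pos.mpr (h.lt k i)
      obtain ⟨h1, h2⟩ := (ht i).1
      constructor <;> nlinarith
  · refine closure_minimal ?_ (isClosed_iUnion_of_finite fun k =>
      IsParallelotope.isClosed ⟨_, _, h.indep_smul k, rfl⟩)
    rintro _ ⟨r, ⟨hr, hD⟩, rfl⟩
    obtain ⟨k, hk⟩ := h.cover r (fun i => openPos_subset_turn i (hr i)) hD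
    exact mem_iUnion.mpr ⟨k, h.lift_mem_tile hk⟩

end IsCellDecomp

/-! ### Positions within one turn -/

section Turn

variable (hC : IsGeneric g C) (i : Fin g)
include hC

theorem basePos_mem : basePos g C i ∈ Icc 0 (stepLen g C i) := by
  have h1 := stepLen_pos hC i
  unfold basePos
  split_ifs with h
  · rw [h] at h1 ⊢
    exact ⟨h1.le, le_rfl⟩
  · exact ⟨le_rfl, h1.le⟩

variable {r : ℝ} (h1 : basePos g C i < r) (h2 : r < basePos g C i + cyc g C i)
include h1 h2

theorem right_of_mem_openVert (h : loopPt g C i r ∈ openVert g C (i + 1)) :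
    r ∈ Ioo (stepLen g C i) (stepLen g C i + p g C (i + 1)) := by
  have hb := basePos_mem hC i
  have ha := isArc_R hC i
  obtain ⟨n, t, ht, rfl⟩ := loopPt_mem_openVert_right hC i h
  have : n = 0 := int_eq_zero_of_abs_lt (cyc_pos hC i)
    (by linarith [ht.2, hb.1, ha.le]) (by linarith [ht.1, hb.2])
  subst this
  simp only [Int.cast_zero, zero_mul, add_zero]
  exact ⟨by linarith [ht.1], by linarith [ht.2]⟩

theorem left_of_mem_openVert (hi : (i : ℕ) ≠ 0) (h : loopPt g C i r ∈ openVert g C i) :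
    r ∈ Ioo (2 * stepLen g C i + p g C (i + 1)) (cyc g C i) := by
  have hb : basePos g C i = 0 := if_neg hi
  have ha := isArc_L hC i
  obtain ⟨n, t, ht, rfl⟩ := loopPt_mem_openVert_left hC i h
  have hc := cyc_eq (g := g) (C := C) i
  have : n = 0 := int_eq_zero_of_abs_lt (cyc_pos hC i)
    (by linarith [ht.2]) (by linarith [ht.1, ha.nonneg])
  subst this
  simp only [Int.cast_zero, zero_mul, add_zero]
  exact ⟨by linarith [ht.1], by linarith [ht.2]⟩

end Turn

/-! ### Regular positions and their uniqueness. -/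

theorem regular_of_turn (hC : IsGeneric g C) {r : Fin g → ℝ} (h1 : ∀ i, basePos g C i < r i)
    (h2 : ∀ i, r i < basePos g C i + cyc g C i)
    (h : ∀ i j : Fin g, (j : ℕ) = i + 1 →
      r i ≠ stepLen g C i ∧ r j ≠ 2 * stepLen g C j + p g C (j + 1) ∧
      ¬ (r i < stepLen g C i + p g C (i + 1) ∧ stepLen g C i < r i ∧
        2 * stepLen g C j + p g C (j + 1) < r j)) : Regular g C r := by
  refine ⟨(loopDiv_mem_iff hC _).mpr fun i j hij hm => ?_, fun i j hij n => ⟨fun he => ?_, fun he => ?_⟩⟩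
  · obtain ⟨-, -, h3⟩ := h i j hij
    have hr := right_of_mem_openVert hC i (h1 i) (h2 i) (by rw [← hij]; exact hm.1)
    have hl := left_of_mem_openVert hC j (h1 j) (h2 j) (by omega) hm.2
    exact h3 ⟨hr.2, hr.1, hl.1⟩
  · have hb := basePos_mem hC i
    have ha := isArc_R hC i
    have : n = 0 := int_eq_zero_of_abs_lt (cyc_pos hC i)
      (by linarith [h1 i, hb.1, ha.le, ha.pos]) (by linarith [h2 i, hb.2])
    subst this
    exact (h i j hij).1 (by simpa using he)
  · have hb : basePos g C j = 0 := if_neg (by omega)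
    have ha := isArc_L hC j
    have : n = 0 := int_eq_zero_of_abs_lt (cyc_pos hC j)
      (by linarith [h1 j, ha.le, ha.pos]) (by linarith [h2 j, ha.nonneg])
    subst this
    exact (h i j hij).2.1 (by simpa using he)

theorem mem_openVert_of_right (hC : IsGeneric g C) (i : Fin g) (n : ℤ) {r : ℝ}
    (h1 : n * cyc g C i + stepLen g C i < r)
    (h2 : r < n * cyc g C i + (stepLen g C i + p g C (i + 1))) :
    loopPt g C i r ∈ openVert g C (i + 1) := by
  obtain ⟨t, rfl⟩ : ∃ t, r = stepLen g C i + t + n * cyc g C i :=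
    ⟨r - stepLen g C i - n * cyc g C i, by ring⟩
  rw [loopPt_add_period hC, loopPt_right hC i ⟨by linarith, by linarith⟩]
  exact pt_mem_openVert (k := i.succ) ⟨by linarith, by simp only [Fin.val_succ]; linarith⟩

theorem mem_openVert_of_left (hC : IsGeneric g C) (i : Fin g) (n : ℤ) {r : ℝ}
    (h1 : n * cyc g C i + (2 * stepLen g C i + p g C (i + 1)) < r)
    (h2 : r < n * cyc g C i + cyc g C i) : loopPt g C i r ∈ openVert g C i := by
  obtain ⟨t, rfl⟩ : ∃ t, r = 2 * stepLen g C i + p g C (i + 1) + t + n * cyc g C i :=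
    ⟨r - (2 * stepLen g C i + p g C (i + 1)) - n * cyc g C i, by ring⟩
  have hc := cyc_eq (g := g) (C := C) i
  rw [loopPt_add_period hC, loopPt_left hC i ⟨by linarith, by linarith⟩]
  exact pt_mem_openVert (k := i.castSucc)
    ⟨by linarith, by simp only [Fin.val_castSucc]; linarith⟩

/-- A pair of positions on a common edge that can be moved simultaneously is not regular. -/
theorem Regular.not_advance (hC : IsGeneric g C) {x x' : Fin g → ℝ} (h : Regular g C x)
    {i j : Fin g} (hij : (j : ℕ) = i + 1) (hi : x i < x' i) (hj : x j < x' j) {n k : ℤ}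
    (h1 : n * cyc g C i + stepLen g C i ≤ x i)
    (h2 : x' i ≤ n * cyc g C i + (stepLen g C i + p g C (i + 1)))
    (h3 : k * cyc g C j + (2 * stepLen g C j + p g C (j + 1)) ≤ x j)
    (h4 : x' j ≤ k * cyc g C j + cyc g C j) : False := by
  refine (loopDiv_mem_iff hC _).mp h.1 i j hij ⟨?_, ?_⟩
  · rw [hij]
    exact mem_openVert_of_right hC i n (lt_of_le_of_ne h1 ((h.2 i j hij n).1).symm) (by linarith)
  · exact mem_openVert_of_left hC j k (lt_of_le_of_ne h3 ((h.2 i j hij k).2).symm) (by linarith)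

/-- Injectivity on regular positions follows from the case of comparable coordinates. -/
theorem eq_of_not_lt (k : Fin g) (heq : ∀ x x', sumBeta g C x = sumBeta g C x' → x k = x' k → x = x')
    (hlt : ∀ x x', Regular g C x → sumBeta g C x = sumBeta g C x' → ¬ x k < x' k)
    (x x' : Fin g → ℝ) (hx : Regular g C x) (hx' : Regular g C x')
    (h : sumBeta g C x = sumBeta g C x') : x = x' :=
  heq x x' h (le_antisymm (not_lt.mp (hlt x' x hx' h.symm)) (not_lt.mp (hlt x x' hx h)))

/-- A second position with the same image would, by rigidity, arise by moving two points
simultaneously over a common edge. At a regular position this is impossible, because both points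
would already be inside that edge. -/
theorem regular_unique_two (hC : IsGeneric 2 C) (x x' : Fin 2 → ℝ) (hx : Regular 2 C x)
    (hx' : Regular 2 C x') (h : sumBeta 2 C x = sumBeta 2 C x') : x = x' := by
  refine eq_of_not_lt 1 (fun x x' h hk => ?_) (fun x x' hx h hlt => ?_) x x' hx hx' h
  · rw [sumBeta_two hC, sumBeta_two hC] at h
    have e0 := congrFun h 0
    simp only [Matrix.cons_val_zero, hk, sub_left_inj] at e0
    ext j
    fin_cases j
    · exact e0
    · exact hk
  · obtain ⟨e, ⟨n, a1, a2⟩, ⟨k, b1, b2⟩⟩ := rigidity_two hC h hlt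
    exact hx.not_advance hC (i := 0) (j := 1) rfl (by linarith) hlt b1 b2 a1 a2

theorem regular_unique_three (hC : IsGeneric 3 C) (x x' : Fin 3 → ℝ) (hx : Regular 3 C x)
    (hx' : Regular 3 C x') (h : sumBeta 3 C x = sumBeta 3 C x') : x = x' := by
  refine eq_of_not_lt 1 (fun x x' h hk => ?_) (fun x x' hx h hlt => ?_) x x' hx hx' h
  · rw [sumBeta_three hC, sumBeta_three hC] at h
    have e0 := congrFun h 0
    have e2 := congrFun h 2
    simp only [Matrix.cons_val_zero, Matrix.cons_val, hk, sub_left_inj] at e0 e2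
    ext j
    fin_cases j
    · exact e0
    · exact hk
    · exact e2
  · rcases rigidity_three hC h hlt with
      ⟨e, -, ⟨n, a1, a2⟩, ⟨k, b1, b2⟩⟩ | ⟨e, -, ⟨n, a1, a2⟩, ⟨k, b1, b2⟩⟩
    · exact hx.not_advance hC (i := 0) (j := 1) rfl (by linarith) hlt b1 b2 a1 a2
    · exact hx.not_advance hC (i := 1) (j := 2) rfl hlt (by linarith) a1 a2 b1 b2

end TropHyper
end

noncomputable section

namespace TropHyper

variable {C : ℤ → ℝ}

/-! ### The cells in genus three -/

section GenusThree

/-- The arcs on which the three points of a divisor lie: the first two arcs of the first cycle, the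
four edges of the second cycle, and the two arcs of the third cycle between its trivalent
vertices. -/
def arcs : Fin 12 → Fin 2 × Fin 4 × Fin 2 :=
  ![(0, 0, 0), (0, 0, 1), (0, 1, 0), (0, 2, 0), (0, 2, 1), (1, 0, 0), (1, 0, 1), (1, 1, 0),
    (1, 2, 0), (1, 2, 1), (1, 3, 0), (1, 3, 1)]

/-- The beginning of an arc of the first cycle, measured from its base point. -/
def start₀ (C : ℤ → ℝ) : Fin 2 → ℝ := ![0, p 3 C 1]

/-- The length of an arc of the first cycle. -/
def len₀ (C : ℤ → ℝ) : Fin 2 → ℝ := ![p 3 C 1, C (-1) + 2 * lam 3 C 1]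

/-- The slope of `covR` on an arc of the first cycle. -/
def slope₀ : Fin 2 → ℝ := ![1, 0]

/-- The beginning of an edge of the second cycle. -/
def start₁ (C : ℤ → ℝ) : Fin 4 → ℝ :=
  ![0, stepLen 3 C 1, stepLen 3 C 1 + p 3 C 2, 2 * stepLen 3 C 1 + p 3 C 2]

/-- The length of an edge of the second cycle. -/
def len₁ (C : ℤ → ℝ) : Fin 4 → ℝ := ![stepLen 3 C 1, p 3 C 2, stepLen 3 C 1, p 3 C 1]

/-- The slope of `covL` on an edge of the second cycle. -/
def slopeL₁ : Fin 4 → ℝ := ![0, 0, 0, 1]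

/-- The slope of `covR` on an edge of the second cycle. -/
def slopeR₁ : Fin 4 → ℝ := ![0, 1, 0, 0]

/-- The value of `covR` at the beginning of an edge of the second cycle. -/
def valR₁ (C : ℤ → ℝ) : Fin 4 → ℝ := ![0, 0, p 3 C 2, p 3 C 2]

/-- The beginning of an arc of the third cycle. -/
def start₂ (C : ℤ → ℝ) : Fin 2 → ℝ := ![0, p 3 C 2]

/-- The slope of `covL` on an arc of the third cycle. -/
def slope₂ : Fin 2 → ℝ := ![0, 1]

/-- The beginnings of the arcs of a cell. -/
def cellStart (C : ℤ → ℝ) (k : Fin 12) : Fin 3 → ℝ :=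
  ![stepLen 3 C 0 + start₀ C (arcs k).1, start₁ C (arcs k).2.1, start₂ C (arcs k).2.2]

/-- The lengths of the arcs of a cell. -/
def cellLen (C : ℤ → ℝ) (k : Fin 12) : Fin 3 → ℝ :=
  ![len₀ C (arcs k).1, len₁ C (arcs k).2.1, p 3 C 2]

/-- The image of the beginning of a cell. -/
def cellBase (C : ℤ → ℝ) (k : Fin 12) : Fin 3 → ℝ :=
  ![start₀ C (arcs k).1, start₁ C (arcs k).2.1 - start₀ C (arcs k).1,
    start₂ C (arcs k).2.2 - valR₁ C (arcs k).2.1]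

/-- The directions of the edges of the image of a cell. -/
def cellDir (k : Fin 12) : Fin 3 → Fin 3 → ℝ :=
  ![![1, -slope₀ (arcs k).1, 0], ![-slopeL₁ (arcs k).2.1, 1, -slopeR₁ (arcs k).2.1],
    ![0, -slope₂ (arcs k).2.2, 1]]

theorem arcs_admissible (k : Fin 12) :
    ¬ ((arcs k).1 = 0 ∧ (arcs k).2.1 = 3) ∧ ¬ ((arcs k).2.1 = 1 ∧ (arcs k).2.2 = 1) := by
  revert k
  decide

theorem exists_arcs (q : Fin 2 × Fin 4 × Fin 2) (h1 : ¬ (q.1 = 0 ∧ q.2.1 = 3))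
    (h2 : ¬ (q.2.1 = 1 ∧ q.2.2 = 1)) : ∃ k, arcs k = q := by
  revert q
  decide

theorem arcs_injective : Function.Injective arcs := by decide

theorem height_zero (g : ℕ) (hC : IsGeneric g C) : height g C 0 = 0 := by
  refine Finset.sum_eq_zero fun j hj => ?_
  rw [Finset.mem_Icc] at hj
  exact min_eq_left (lam_nonneg hC hj.2)

/-- The part of the first cycle outside its right edge consists of the two horizontal edges, of
length λ_1 each, and the left edge, of length p_0 = C_{-1}. -/
theorem cyc_first {g : ℕ} (hC : IsGeneric g C) :
    cyc g C 0 = p g C 1 + (C (-1) + 2 * lam g C 1) := by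
  simp only [cyc, stepLen, p, height_zero g hC, lam]
  ring

/-- The last lower edge has slope 1, so the way around the outer end of the ladder is as long as the
last shared vertical edge. -/
theorem p_pred_last {g : ℕ} (hC : IsGeneric g C) {i : ℕ} (hi : i + 1 = g) :
    2 * stepLen g C i + p g C (i + 1) = p g C i := by
  have := height_succ hC (i := i) (by omega)
  have e : (g : ℝ) - i = 1 := by
    rw [← hi]
    push_cast
    ring
  rw [e] at this
  simp only [stepLen, p, this]
  ring

theorem outer_pos {g : ℕ} (hC : IsGeneric g C) (hg : 0 < g) : 0 < C (-1) + 2 * lam g C 1 := by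
  have h1 := p_pos hC (i := 0) (Nat.zero_le _)
  have h2 := lam_nonneg hC (i := 1) hg
  simp only [p, height_zero g hC] at h1
  linarith

theorem covR_first {g : ℕ} (hC : IsGeneric g C) (hg : 0 < g) {r : ℝ} :
    (r ∈ Icc (stepLen g C 0) (stepLen g C 0 + p g C 1) → covR g C 0 r = r - stepLen g C 0) ∧
    (r ∈ Icc (stepLen g C 0 + p g C 1) (stepLen g C 0 + cyc g C 0) →
      covR g C 0 r = p g C 1) := by
  have ha : IsArc (cyc g C 0) (stepLen g C 0) (p g C 1) := isArc_R hC ⟨0, hg⟩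
  refine ⟨(cov_zero_turn ha r).2.1, fun hr => ?_⟩
  rcases le_total r (cyc g C 0) with h | h
  · exact (cov_zero_turn ha r).2.2 ⟨hr.1, h⟩
  · have := cov_before ha 1 (r := r - cyc g C 0) ⟨by linarith, by linarith [hr.2]⟩
    simpa [covR] using this

theorem eq_zero_of_arc₀ {q : Fin 2} {r : ℝ} (h1 : stepLen 3 C 0 + start₀ C q < r)
    (h2 : r < stepLen 3 C 0 + p 3 C 1) : q = 0 := by
  fin_cases q <;> simp [start₀] at h1 ⊢
  linarith

theorem arc₂_spec {q : Fin 2} {r : ℝ} (h1 : start₂ C q < r) (h2 : r < start₂ C q + p 3 C 2) :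
    r ≠ p 3 C 2 ∧ (p 3 C 2 < r → q = 1) := by
  fin_cases q <;> simp [start₂] at h1 h2 ⊢
  · exact ⟨h2.ne, h2.le⟩
  · exact h1.ne'

theorem arc₀_unique {q q' : Fin 2} {r : ℝ} (h1 : start₀ C q < r) (h2 : r < start₀ C q + len₀ C q)
    (h1' : start₀ C q' < r) (h2' : r < start₀ C q' + len₀ C q') : q = q' := by
  fin_cases q <;> fin_cases q' <;> simp [start₀, len₀] at * <;> linarith

theorem arc₂_unique {q q' : Fin 2} {r : ℝ} (h1 : start₂ C q < r) (h2 : r < start₂ C q + p 3 C 2)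
    (h1' : start₂ C q' < r) (h2' : r < start₂ C q' + p 3 C 2) : q = q' := by
  fin_cases q <;> fin_cases q' <;> simp [start₂] at * <;> linarith

variable (hC : IsGeneric 3 C)
include hC

/-- The number `start₀` also serves as the value of `covR` at the beginning of the arc: the first
arc is the right edge itself, after which covR has the value p_1. -/
theorem covR_arc₀ (q : Fin 2) {r : ℝ} (h1 : stepLen 3 C 0 + start₀ C q ≤ r)
    (h2 : r ≤ stepLen 3 C 0 + start₀ C q + len₀ C q) :
    covR 3 C 0 r = start₀ C q + slope₀ q * (r - (stepLen 3 C 0 + start₀ C q)) := by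
  have hc := cyc_first hC
  fin_cases q <;> simp [start₀, len₀, slope₀] at h1 h2 ⊢
  · exact (covR_first hC (by norm_num)).1 ⟨h1, h2⟩
  · exact (covR_first hC (by norm_num)).2 ⟨h1, by linarith⟩

theorem covs_arc₁ (q : Fin 4) {r : ℝ} (h1 : start₁ C q ≤ r) (h2 : r ≤ start₁ C q + len₁ C q) :
    covL 3 C 1 r = slopeL₁ q * (r - start₁ C q) ∧
      covR 3 C 1 r = valR₁ C q + slopeR₁ q * (r - start₁ C q) := by
  have hR : IsArc (cyc 3 C 1) (stepLen 3 C 1) (p 3 C 2) := isArc_R hC 1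
  have hL : IsArc (cyc 3 C 1) (2 * stepLen 3 C 1 + p 3 C 2) (p 3 C 1) := isArc_L hC 1
  have hc : cyc 3 C 1 = 2 * stepLen 3 C 1 + p 3 C 2 + p 3 C 1 := rfl
  have hs := stepLen_pos hC 1
  have hp1 := hL.pos
  have hp2 := hR.pos
  simp only [Fin.val_one] at hs
  obtain ⟨r1, r2, r3⟩ := cov_zero_turn hR r
  obtain ⟨l1, l2, l3⟩ := cov_zero_turn hL r
  fin_cases q <;> simp [start₁, len₁, slopeL₁, slopeR₁, valR₁] at h1 h2 ⊢
  · exact ⟨l1 ⟨h1, by linarith⟩, r1 ⟨h1, h2⟩⟩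
  · exact ⟨l1 ⟨by linarith, by linarith⟩, r2 ⟨h1, h2⟩⟩
  · exact ⟨l1 ⟨by linarith, by linarith⟩, r3 ⟨h1, by linarith⟩⟩
  · exact ⟨l2 ⟨h1, by linarith⟩, r3 ⟨by linarith, by linarith⟩⟩

theorem covL_arc₂ (q : Fin 2) {r : ℝ} (h1 : start₂ C q ≤ r) (h2 : r ≤ start₂ C q + p 3 C 2) :
    covL 3 C 2 r = slope₂ q * (r - start₂ C q) := by
  have hf : 2 * stepLen 3 C 2 + p 3 C 3 = p 3 C 2 := p_pred_last hC rfl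
  have hL : IsArc (cyc 3 C 2) (2 * stepLen 3 C 2 + p 3 C 3) (p 3 C 2) := isArc_L hC 2
  obtain ⟨l1, l2, l3⟩ := cov_zero_turn hL r
  fin_cases q <;> simp [start₂, slope₂] at h1 h2 ⊢
  · exact l1 ⟨h1, by linarith⟩
  · exact (l2 ⟨by linarith, by linarith⟩).trans (by rw [hf])

theorem lift_three (r : Fin 3 → ℝ) : lift 3 C r = ![r 0 - stepLen 3 C 0 - covL 3 C 1 (r 1),
    r 1 - covR 3 C 0 (r 0) - covL 3 C 2 (r 2), r 2 - covR 3 C 1 (r 1)] := by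
  have b0 : basePos 3 C 0 = stepLen 3 C 0 := rfl
  have b1 : basePos 3 C 1 = 0 := rfl
  have b2 : basePos 3 C 2 = 0 := rfl
  have h1 : covL 3 C 1 0 = 0 ∧ covR 3 C 1 0 = 0 := by
    have := covs_lower hC 1 (t := 0) ⟨le_rfl, (stepLen_pos hC 1).le⟩
    exact ⟨this.2.2.2, this.2.1⟩
  have h2 : covL 3 C 2 0 = 0 := (covs_lower hC 2 ⟨le_rfl, (stepLen_pos hC 2).le⟩).2.2.2
  have h0 : covR 3 C 0 (stepLen 3 C 0) = 0 :=
    (covs_lower hC 0 ⟨(stepLen_pos hC 0).le, le_rfl⟩).2.1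
  rw [lift_eq, sumBeta_three hC, sumBeta_three hC, b0, b1, b2, h1.1, h1.2, h2, h0]
  ext j
  fin_cases j <;> simp
  ring

theorem bounds_arc₀ (q : Fin 2) :
    0 ≤ start₀ C q ∧ 0 < len₀ C q ∧ start₀ C q + len₀ C q ≤ cyc 3 C 0 := by
  have h1 := p_pos hC (i := 1) (by norm_num)
  have h2 := outer_pos hC (by norm_num)
  rw [cyc_first hC]
  fin_cases q <;> simp [start₀, len₀] <;> constructorm* _ ∧ _ <;> linarith

theorem bounds_arc₁ (q : Fin 4) :
    0 ≤ start₁ C q ∧ 0 < len₁ C q ∧ start₁ C q + len₁ C q ≤ cyc 3 C 1 := by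
  have h1 := p_pos hC (i := 1) (by norm_num)
  have h2 := p_pos hC (i := 2) (by norm_num)
  have h3 := stepLen_pos hC 1
  simp only [Fin.val_one] at h3
  have hc : cyc 3 C 1 = 2 * stepLen 3 C 1 + p 3 C 2 + p 3 C 1 := rfl
  fin_cases q <;> simp [start₁, len₁] <;> constructorm* _ ∧ _ <;> linarith

theorem cyc_last : cyc 3 C 2 = p 3 C 2 + p 3 C 2 := by
  have hf : 2 * stepLen 3 C 2 + p 3 C 3 = p 3 C 2 := p_pred_last hC rfl
  rw [cyc, hf]

theorem bounds_arc₂ (q : Fin 2) : 0 ≤ start₂ C q ∧ start₂ C q + p 3 C 2 ≤ cyc 3 C 2 := by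
  have h2 := p_pos hC (i := 2) (by norm_num)
  rw [cyc_last hC]
  fin_cases q <;> simp [start₂] <;> linarith

theorem arc₁_spec {q : Fin 4} {r : ℝ} (h1 : start₁ C q < r) (h2 : r < start₁ C q + len₁ C q) :
    r ≠ stepLen 3 C 1 ∧ r ≠ 2 * stepLen 3 C 1 + p 3 C 2 ∧
    (2 * stepLen 3 C 1 + p 3 C 2 < r → q = 3) ∧
    (stepLen 3 C 1 < r → r < stepLen 3 C 1 + p 3 C 2 → q = 1) := by
  have p1 := p_pos hC (i := 1) (by norm_num)
  have p2 := p_pos hC (i := 2) (by norm_num)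
  have h3 := stepLen_pos hC 1
  simp only [Fin.val_one] at h3
  fin_cases q <;> simp [start₁, len₁] at h1 h2 ⊢
  · refine ⟨h2.ne, ?_, ?_, ?_⟩ <;> intros <;> linarith
  · refine ⟨h1.ne', ?_, ?_⟩
    · intro h
      linarith
    · linarith
  · refine ⟨?_, ?_, ?_, ?_⟩ <;> intros <;> linarith
  · refine ⟨?_, h1.ne', ?_⟩ <;> intros <;> linarith

theorem arc₁_unique {q q' : Fin 4} {r : ℝ} (h1 : start₁ C q < r) (h2 : r < start₁ C q + len₁ C q)
    (h1' : start₁ C q' < r) (h2' : r < start₁ C q' + len₁ C q') : q = q' := by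
  have p2 := p_pos hC (i := 2) (by norm_num)
  have h3 := stepLen_pos hC 1
  simp only [Fin.val_one] at h3
  fin_cases q <;> fin_cases q' <;> simp [start₁, len₁] at * <;> linarith

/-- Vertices are assigned to the outer arc, so that a position assigned to the first arc really lies
inside the shared edge. The analogous choices are made on the other two cycles. -/
theorem exists_arc₀ {r : ℝ} (h1 : stepLen 3 C 0 < r) (h2 : r ≤ stepLen 3 C 0 + cyc 3 C 0) :
    ∃ q, stepLen 3 C 0 + start₀ C q ≤ r ∧ r ≤ stepLen 3 C 0 + start₀ C q + len₀ C q ∧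
      (q = 0 → loopPt 3 C 0 r ∈ openVert 3 C 1) := by
  rw [cyc_first hC] at h2
  rcases lt_or_ge r (stepLen 3 C 0 + p 3 C 1) with h | h
  · refine ⟨0, by simpa [start₀] using h1.le, by simpa [start₀, len₀] using h.le, fun _ => ?_⟩
    exact mem_openVert_of_right hC 0 0 (by simpa using h1) (by simpa using h)
  · exact ⟨1, by simpa [start₀] using h, by simp [start₀, len₀]; linarith, by simp⟩

theorem exists_arc₁ {r : ℝ} (h1 : 0 ≤ r) (h2 : r < cyc 3 C 1) :
    ∃ q, start₁ C q ≤ r ∧ r ≤ start₁ C q + len₁ C q ∧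
      (q = 3 → loopPt 3 C 1 r ∈ openVert 3 C 1) ∧ (q = 1 → loopPt 3 C 1 r ∈ openVert 3 C 2) := by
  rcases le_or_gt r (stepLen 3 C 1) with h | h
  · exact ⟨0, by simpa [start₁] using h1, by simpa [start₁, len₁] using h, by simp, by simp⟩
  rcases lt_or_ge r (stepLen 3 C 1 + p 3 C 2) with h' | h'
  · refine ⟨1, by simpa [start₁] using h.le, by simpa [start₁, len₁] using h'.le, by simp,
      fun _ => ?_⟩
    exact mem_openVert_of_right hC 1 0 (by simpa using h) (by simpa using h')
  rcases le_or_gt r (2 * stepLen 3 C 1 + p 3 C 2) with h'' | h''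
  · exact ⟨2, by simpa [start₁] using h', by simp [start₁, len₁]; linarith, by simp, by simp⟩
  · refine ⟨3, by simpa [start₁] using h''.le, by
        simpa [start₁, len₁] using show r ≤ 2 * stepLen 3 C 1 + p 3 C 2 + p 3 C 1 from h2.le,
      fun _ => ?_, by simp⟩
    exact mem_openVert_of_left hC 1 0 (by simpa using h'') (by simpa using h2)

theorem exists_arc₂ {r : ℝ} (h1 : 0 ≤ r) (h2 : r < cyc 3 C 2) :
    ∃ q, start₂ C q ≤ r ∧ r ≤ start₂ C q + p 3 C 2 ∧
      (q = 1 → loopPt 3 C 2 r ∈ openVert 3 C 2) := by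
  have hf : 2 * stepLen 3 C 2 + p 3 C 3 = p 3 C 2 := p_pred_last hC rfl
  rcases le_or_gt r (p 3 C 2) with h | h
  · exact ⟨0, by simpa [start₂] using h1, by simpa [start₂] using h, by simp⟩
  · refine ⟨1, by simpa [start₂] using h.le, ?_, fun _ => ?_⟩
    · have := cyc_last hC
      simp [start₂]
      linarith
    · refine mem_openVert_of_left hC 2 0 ?_ (by simpa using h2)
      simp only [Int.cast_zero, zero_mul, zero_add]
      exact hf.trans_lt h

/-- A cell is a choice of an arc on each cycle. Of the 2 · 4 · 2 choices, two are excluded by the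
edge common to the first two cycles and two by the edge common to the last two; twelve remain. -/
theorem isCellDecomp_three : IsCellDecomp 3 C (cellStart C) (fun k => cellStart C k + cellLen C k)
    (cellBase C) cellDir where
  lt k i := by
    have h0 := (bounds_arc₀ hC (arcs k).1).2.1
    have h1 := (bounds_arc₁ hC (arcs k).2.1).2.1
    have h2 := p_pos hC (i := 2) (by norm_num)
    rw [Pi.add_apply, lt_add_iff_pos_right]
    fin_cases i
    exacts [h0, h1, h2]
  le_lo k i := by
    fin_cases i
    · exact le_add_of_nonneg_right (bounds_arc₀ hC (arcs k).1).1
    · exact (bounds_arc₁ hC (arcs k).2.1).1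
    · exact (bounds_arc₂ hC (arcs k).2.2).1
  hi_le k i := by
    fin_cases i
    · change stepLen 3 C 0 + start₀ C (arcs k).1 + len₀ C (arcs k).1 ≤ stepLen 3 C 0 + cyc 3 C 0
      linarith [(bounds_arc₀ hC (arcs k).1).2.2]
    · change start₁ C (arcs k).2.1 + len₁ C (arcs k).2.1 ≤ 0 + cyc 3 C 1
      linarith [(bounds_arc₁ hC (arcs k).2.1).2.2]
    · change start₂ C (arcs k).2.2 + p 3 C 2 ≤ 0 + cyc 3 C 2
      linarith [(bounds_arc₂ hC (arcs k).2.2).2]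
  indep k := by
    refine Matrix.linearIndependent_rows_of_det_ne_zero (A := Matrix.of (cellDir k)) ?_
    obtain ⟨h1, h2⟩ := arcs_admissible k
    -- The determinant is 1 - slope₀ slopeL₁ - slopeR₁ slope₂. Both products vanish on admissible
    -- cells, so it is 1.
    rw [Matrix.det_fin_three]
    simp only [Matrix.of_apply, cellDir]
    generalize (arcs k).1 = q₀ at *
    generalize (arcs k).2.1 = q₁ at *
    generalize (arcs k).2.2 = q₂ at *
    fin_cases q₀ <;> fin_cases q₁ <;> fin_cases q₂ <;>
      simp [slope₀, slopeL₁, slopeR₁, slope₂] at h1 h2 ⊢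
  affine k r hr := by
    have e0 := covR_arc₀ hC (arcs k).1 (hr 0).1 (hr 0).2
    obtain ⟨e1, e1'⟩ := covs_arc₁ hC (arcs k).2.1 (hr 1).1 (hr 1).2
    have e2 := covL_arc₂ hC (arcs k).2.2 (hr 2).1 (hr 2).2
    rw [lift_three hC, e0, e1, e1', e2, Fin.sum_univ_three]
    ext j
    fin_cases j <;> simp [cellBase, cellDir, cellStart] <;> ring
  cover r hr hD := by
    rw [loopDiv_mem_iff hC] at hD
    have t0 : r 0 ∈ Ioc (stepLen 3 C 0) (stepLen 3 C 0 + cyc 3 C 0) := hr 0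
    have t1 : r 1 ∈ Ico 0 (0 + cyc 3 C 1) := hr 1
    have t2 : r 2 ∈ Ico 0 (0 + cyc 3 C 2) := hr 2
    rw [zero_add] at t1 t2
    obtain ⟨q₀, a1, a2, a3⟩ := exists_arc₀ hC t0.1 t0.2
    obtain ⟨q₁, b1, b2, b3, b4⟩ := exists_arc₁ hC t1.1 t1.2
    obtain ⟨q₂, c1, c2, c3⟩ := exists_arc₂ hC t2.1 t2.2
    obtain ⟨k, hk⟩ := exists_arcs (q₀, q₁, q₂) (fun h => hD 0 1 rfl ⟨a3 h.1, b3 h.2⟩)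
      (fun h => hD 1 2 rfl ⟨b4 h.1, c3 h.2⟩)
    refine ⟨k, fun i => ?_⟩
    simp only [Pi.add_apply, cellStart, cellLen, hk]
    fin_cases i
    exacts [⟨a1, a2⟩, ⟨b1, b2⟩, ⟨c1, c2⟩]
  disjoint k k' r h h' := by
    apply arcs_injective
    have a : ∀ k, (∀ i, r i ∈ Ioo (cellStart C k i) ((cellStart C k + cellLen C k) i)) →
        (start₀ C (arcs k).1 < r 0 - stepLen 3 C 0 ∧
          r 0 - stepLen 3 C 0 < start₀ C (arcs k).1 + len₀ C (arcs k).1) ∧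
        (start₁ C (arcs k).2.1 < r 1 ∧ r 1 < start₁ C (arcs k).2.1 + len₁ C (arcs k).2.1) ∧
        (start₂ C (arcs k).2.2 < r 2 ∧ r 2 < start₂ C (arcs k).2.2 + p 3 C 2) := by
      intro k h
      refine ⟨?_, h 1, h 2⟩
      have : stepLen 3 C 0 + start₀ C (arcs k).1 < r 0 ∧
        r 0 < stepLen 3 C 0 + start₀ C (arcs k).1 + len₀ C (arcs k).1 := h 0
      exact ⟨by linarith [this.1], by linarith [this.2]⟩
    obtain ⟨a0, a1, a2⟩ := a k h
    obtain ⟨b0, b1, b2⟩ := a k' h'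
    exact Prod.ext (arc₀_unique a0.1 a0.2 b0.1 b0.2)
      (Prod.ext (arc₁_unique hC a1.1 a1.2 b1.1 b1.2) (arc₂_unique a2.1 a2.2 b2.1 b2.2))
  regular k r hr := by
    have hf : 2 * stepLen 3 C 2 + p 3 C 3 = p 3 C 2 := p_pred_last hC rfl
    obtain ⟨ha1, ha2⟩ := arcs_admissible k
    have h0 : stepLen 3 C 0 + start₀ C (arcs k).1 < r 0 ∧
      r 0 < stepLen 3 C 0 + start₀ C (arcs k).1 + len₀ C (arcs k).1 := hr 0
    obtain ⟨s1, s2, s3, s4⟩ := arc₁_spec hC (hr 1).1 (hr 1).2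
    obtain ⟨u1, u2⟩ := arc₂_spec (hr 2).1 (hr 2).2
    have b0 := bounds_arc₀ hC (arcs k).1
    have b1 := bounds_arc₁ hC (arcs k).2.1
    have b2 := bounds_arc₂ hC (arcs k).2.2
    refine regular_of_turn hC (fun i => ?_) (fun i => ?_) fun i j hij => ?_
    · fin_cases i
      · exact lt_of_le_of_lt (le_add_of_nonneg_right b0.1) h0.1
      · exact b1.1.trans_lt (hr 1).1
      · exact b2.1.trans_lt (hr 2).1
    · fin_cases i
      · change r 0 < stepLen 3 C 0 + cyc 3 C 0
        linarith [h0.2, b0.2.2]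
      · change r 1 < 0 + cyc 3 C 1
        rw [zero_add]
        exact (hr 1).2.trans_le b1.2.2
      · change r 2 < 0 + cyc 3 C 2
        rw [zero_add]
        exact (hr 2).2.trans_le b2.2
    · fin_cases i <;> fin_cases j <;> simp at hij
      · refine ⟨?_, s2, fun h => ha1 ⟨eq_zero_of_arc₀ h0.1 h.1, s3 h.2.2⟩⟩
        change r 0 ≠ stepLen 3 C 0
        linarith [h0.1, b0.1]
      · refine ⟨s1, fun h => u1 (h.trans hf), fun h => ha2 ⟨s4 h.2.1 h.1, u2 ?_⟩⟩
        exact hf.symm.trans_lt h.2.2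

end GenusThree

end TropHyper
end

noncomputable section

namespace TropHyper

variable {C : ℤ → ℝ}

/-! ### Assembling the dodecahedron -/

section Dodecahedron

/-- The lattice vector by which the image of a cell is translated. -/
def cellShift (C : ℤ → ℝ) (k : Fin 12) : Fin 3 → ℝ :=
  -- After the common shift the last coordinate lies in [0, 2 p_2], except when the second point is
  -- on the lower edge and the third on its left edge; there it lies in [2 p_2, 3 p_2], and the
  -- vector of the third cycle brings it back.
  -Qvec 3 C (alpha 3 C 1) - if (arcs k).2 = (0, 1) then Qvec 3 C (alpha 3 C 2) else 0

theorem cellShift_mem_lattice (k : Fin 12) : cellShift C k ∈ lattice 3 C := by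
  unfold cellShift
  refine sub_mem (neg_mem (Qvec_alpha_mem_lattice 1)) ?_
  split_ifs
  · exact Qvec_alpha_mem_lattice 2
  · exact zero_mem _

theorem Qvec_alpha_three (hC : IsGeneric 3 C) :
    Qvec 3 C (alpha 3 C 1) =
      ![-p 3 C 1, 2 * stepLen 3 C 1 + p 3 C 2 + p 3 C 1, -p 3 C 2] ∧
    Qvec 3 C (alpha 3 C 2) = ![0, -p 3 C 2, 2 * p 3 C 2] := by
  have hf : 2 * stepLen 3 C 2 + p 3 C 3 = p 3 C 2 := p_pred_last hC rfl
  constructor <;> rw [Qvec_alpha_eq hC] <;> ext j <;> fin_cases j <;>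
    simp [Edge.dir, Fin.ext_iff] <;> linarith

theorem mem_translate_zonotope {n k : ℕ} {l x z : Fin n → ℝ} {c : Fin k → ℝ} (hc : ∀ i, 0 < c i)
    {a : Fin k → Fin n → ℝ} : z ∈ (fun y => l + y) '' zonotope x (fun i => c i • a i) ↔
      ∃ u : Fin k → ℝ, (∀ i, u i ∈ Icc 0 (c i)) ∧ z = l + (x + ∑ i, u i • a i) := by
  constructor
  · rintro ⟨_, ⟨t, ht, rfl⟩, rfl⟩
    refine ⟨fun i => t i * c i, fun i => ⟨?_, ?_⟩, by simp only [mul_smul]⟩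
    · exact mul_nonneg (ht i).1 (hc i).le
    · exact mul_le_of_le_one_left (hc i).le (ht i).2
  · rintro ⟨u, hu, rfl⟩
    refine ⟨_, ⟨fun i => u i / c i, fun i => ⟨?_, ?_⟩, rfl⟩, ?_⟩
    · exact div_nonneg (hu i).1 (hc i).le
    · exact (div_le_one (hc i)).mpr (hu i).2
    · simp only [smul_smul, div_mul_cancel₀ _ (hc _).ne']

theorem mem_dodecahedron_iff (hC : IsGeneric 3 C) (z : Fin 3 → ℝ) :
    z ∈ dodecahedron C ↔ ∃ α ∈ Icc 0 (C (-1) + 2 * lam 3 C 1), ∃ β ∈ Icc 0 (p 3 C 1),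
      ∃ κ ∈ Icc 0 (2 * stepLen 3 C 1), ∃ δ ∈ Icc 0 (p 3 C 2), ∃ φ ∈ Icc 0 (p 3 C 2),
      z 0 - p 3 C 1 = α + β ∧ z 1 + p 3 C 1 = -β - κ - δ ∧ z 2 = δ + φ := by
  have h1 := p_pos hC (i := 1) (by norm_num)
  have h2 := p_pos hC (i := 2) (by norm_num)
  have h3 := stepLen_pos hC 1
  have h4 := outer_pos hC (by norm_num)
  simp only [Fin.val_one] at h3
  have hc : ∀ i, 0 < (![C (-1) + 2 * lam 3 C 1, p 3 C 1, 2 * stepLen 3 C 1, p 3 C 2, p 3 C 2] :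
      Fin 5 → ℝ) i := by
    intro i
    fin_cases i <;> simp <;> linarith
  have he : dodecahedron C = (fun y => 0 + y) '' zonotope ![p 3 C 1, -p 3 C 1, 0] (fun i =>
      (![C (-1) + 2 * lam 3 C 1, p 3 C 1, 2 * stepLen 3 C 1, p 3 C 2, p 3 C 2] : Fin 5 → ℝ) i •
      (![![1, 0, 0], ![1, -1, 0], ![0, -1, 0], ![0, -1, 1], ![0, 0, 1]] :
        Fin 5 → Fin 3 → ℝ) i) := by
    simp only [zero_add, image_id', dodecahedron]
    congr 1
    ext i j
    fin_cases i <;> fin_cases j <;> simp [stepLen]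
  rw [he, mem_translate_zonotope hc]
  constructor
  · rintro ⟨u, hu, rfl⟩
    refine ⟨u 0, hu 0, u 1, hu 1, u 2, hu 2, u 3, hu 3, u 4, hu 4, ?_⟩
    simp [Fin.sum_univ_five]
    ring
  · rintro ⟨α, hα, β, hβ, κ, hκ, δ, hδ, φ, hφ, e0, e1, e2⟩
    refine ⟨![α, β, κ, δ, φ], fun i => ?_, ?_⟩
    · fin_cases i
      exacts [hα, hβ, hκ, hδ, hφ]
    · ext j
      fin_cases j <;> simp [Fin.sum_univ_five] <;> linarith

theorem mem_shifted_tile_iff (hC : IsGeneric 3 C) (k : Fin 12) (z : Fin 3 → ℝ) :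
    z ∈ (fun y => cellShift C k + y) '' tile (cellStart C) (fun k => cellStart C k + cellLen C k)
      (cellBase C) cellDir k ↔ ∃ s ∈ Icc 0 (len₀ C (arcs k).1), ∃ t ∈ Icc 0 (len₁ C (arcs k).2.1),
      ∃ u ∈ Icc 0 (p 3 C 2),
      z 0 = cellShift C k 0 + start₀ C (arcs k).1 + s - slopeL₁ (arcs k).2.1 * t ∧
      z 1 = cellShift C k 1 + (start₁ C (arcs k).2.1 - start₀ C (arcs k).1) -
        slope₀ (arcs k).1 * s + t - slope₂ (arcs k).2.2 * u ∧
      z 2 = cellShift C k 2 + (start₂ C (arcs k).2.2 - valR₁ C (arcs k).2.1) -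
        slopeR₁ (arcs k).2.1 * t + u := by
  unfold tile
  simp only [Pi.add_apply, add_sub_cancel_left]
  rw [mem_translate_zonotope]
  · constructor
    · rintro ⟨u, hu, rfl⟩
      refine ⟨u 0, hu 0, u 1, hu 1, u 2, hu 2, ?_⟩
      simp [Fin.sum_univ_three, cellBase, cellDir]
      refine ⟨?_, ?_, ?_⟩ <;> ring
    · rintro ⟨s, hs, t, ht, u, hu, e0, e1, e2⟩
      refine ⟨![s, t, u], fun i => ?_, ?_⟩
      · fin_cases i
        exacts [hs, ht, hu]
      · ext j
        fin_cases j <;> simp [Fin.sum_univ_three, cellBase, cellDir, e0, e1, e2] <;> ring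
  · intro i
    have := (isCellDecomp_three hC).lt k i
    simpa using this

theorem shifted_tile_subset (hC : IsGeneric 3 C) (k : Fin 12) :
    (fun y => cellShift C k + y) '' tile (cellStart C) (fun k => cellStart C k + cellLen C k)
      (cellBase C) cellDir k ⊆ dodecahedron C := by
  intro z hz
  rw [mem_shifted_tile_iff hC] at hz
  rw [mem_dodecahedron_iff hC]
  have h1 := p_pos hC (i := 1) (by norm_num)
  have h2 := p_pos hC (i := 2) (by norm_num)
  have h3 := stepLen_pos hC 1
  have h4 := outer_pos hC (by norm_num)
  simp only [Fin.val_one] at h3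
  obtain ⟨s, hs, t, ht, u, hu, e0, e1, e2⟩ := hz
  obtain ⟨q1, q2⟩ := Qvec_alpha_three hC
  simp only [cellShift, q1, q2] at e0 e1 e2
  have key : ∀ α β κ δ φ, (0 ≤ α ∧ α ≤ C (-1) + 2 * lam 3 C 1 ∧ 0 ≤ β ∧ β ≤ p 3 C 1 ∧
      0 ≤ κ ∧ κ ≤ 2 * stepLen 3 C 1 ∧ 0 ≤ δ ∧ δ ≤ p 3 C 2 ∧ 0 ≤ φ ∧ φ ≤ p 3 C 2 ∧
      z 0 - p 3 C 1 = α + β ∧ z 1 + p 3 C 1 = -β - κ - δ ∧ z 2 = δ + φ) →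
      ∃ α ∈ Icc 0 (C (-1) + 2 * lam 3 C 1), ∃ β ∈ Icc 0 (p 3 C 1),
      ∃ κ ∈ Icc 0 (2 * stepLen 3 C 1), ∃ δ ∈ Icc 0 (p 3 C 2), ∃ φ ∈ Icc 0 (p 3 C 2),
      z 0 - p 3 C 1 = α + β ∧ z 1 + p 3 C 1 = -β - κ - δ ∧ z 2 = δ + φ := by
    rintro α β κ δ φ ⟨a1, a2, b1, b2, c1, c2, d1, d2, f1, f2, e⟩
    exact ⟨α, ⟨a1, a2⟩, β, ⟨b1, b2⟩, κ, ⟨c1, c2⟩, δ, ⟨d1, d2⟩, φ, ⟨f1, f2⟩, e⟩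
  fin_cases k <;> simp [arcs, len₀, len₁, start₀, start₁, start₂, slope₀, slopeL₁, slopeR₁, slope₂,
    valR₁] at hs ht e0 e1 e2
  -- On each tile two of the five parameters of the zonotope are constant, and the other three are
  -- s, t, u up to order, reversal and a shift. The value κ = `stepLen 3 C 1` or a half range of κ
  -- appears because the lower and the upper edge of the middle cycle share the generator of length
  -- twice `stepLen 3 C 1`.
  on_goal 1 => refine key 0 s (2 * stepLen 3 C 1 - t) (p 3 C 2) u ?_
  on_goal 2 => refine key 0 s (2 * stepLen 3 C 1 - t) u 0 ?_
  on_goal 3 => refine key 0 s (stepLen 3 C 1) (p 3 C 2 - t) u ?_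
  on_goal 4 => refine key 0 s (stepLen 3 C 1 - t) 0 u ?_
  on_goal 5 => refine key 0 s (stepLen 3 C 1 - t) u (p 3 C 2) ?_
  on_goal 6 => refine key s (p 3 C 1) (2 * stepLen 3 C 1 - t) (p 3 C 2) u ?_
  on_goal 7 => refine key s (p 3 C 1) (2 * stepLen 3 C 1 - t) u 0 ?_
  on_goal 8 => refine key s (p 3 C 1) (stepLen 3 C 1) (p 3 C 2 - t) u ?_
  on_goal 9 => refine key s (p 3 C 1) (stepLen 3 C 1 - t) 0 u ?_
  on_goal 10 => refine key s (p 3 C 1) (stepLen 3 C 1 - t) u (p 3 C 2) ?_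
  on_goal 11 => refine key s (p 3 C 1 - t) 0 0 u ?_
  on_goal 12 => refine key s (p 3 C 1 - t) 0 u (p 3 C 2) ?_
  all_goals
    refine ⟨?_, ?_, ?_, ?_, ?_, ?_, ?_, ?_, ?_, ?_, ?_, ?_, ?_⟩ <;>
      linarith [hs.1, hs.2, ht.1, ht.2, hu.1, hu.2]

theorem exists_min_three {a b c : ℝ} (ha : 0 ≤ a) (hb : 0 ≤ b) (hc : 0 ≤ c) :
    ∃ r, 0 ≤ r ∧ r ≤ a ∧ r ≤ b ∧ r ≤ c ∧ (r = a ∨ r = b ∨ r = c) := by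
  rcases le_total a b with h | h <;> rcases le_total (min a b) c with h' | h'
  · exact ⟨a, ha, le_rfl, h, by rwa [min_eq_left h] at h', .inl rfl⟩
  · exact ⟨c, hc, by rwa [min_eq_left h] at h', (by rwa [min_eq_left h] at h' : c ≤ a).trans h,
      le_rfl, .inr (.inr rfl)⟩
  · exact ⟨b, hb, h, le_rfl, by rwa [min_eq_right h] at h', .inr (.inl rfl)⟩
  · exact ⟨c, hc, (by rwa [min_eq_right h] at h' : c ≤ b).trans h, by rwa [min_eq_right h] at h',
      le_rfl, .inr (.inr rfl)⟩

/-- The parameters of a point of the dodecahedron can be chosen in such a way that the point is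
seen to lie on one of the tiles. -/
theorem exists_normal_form {A b ℓ d α β κ δ φ : ℝ} (hℓ : 0 ≤ ℓ) (hα : α ∈ Icc 0 A)
    (hβ : β ∈ Icc 0 b) (hκ : κ ∈ Icc 0 (2 * ℓ)) (hδ : δ ∈ Icc 0 d) (hφ : φ ∈ Icc 0 d) :
    ∃ α' ∈ Icc 0 A, ∃ β' ∈ Icc 0 b, ∃ κ' ∈ Icc 0 (2 * ℓ), ∃ δ' ∈ Icc 0 d, ∃ φ' ∈ Icc 0 d,
      α' + β' = α + β ∧ -β' - κ' - δ' = -β - κ - δ ∧ δ' + φ' = δ + φ ∧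
      (((α' = 0 ∨ β' = b) ∧ (ℓ ≤ κ' ∧ δ' = d ∨ ℓ ≤ κ' ∧ φ' = 0 ∨ κ' = ℓ ∨ κ' ≤ ℓ ∧ δ' = 0 ∨
        κ' ≤ ℓ ∧ φ' = d)) ∨ κ' = 0 ∧ (δ' = 0 ∨ φ' = d)) := by
  -- With directions denoted by their parameters, κ + φ = δ. Moving κ towards ℓ along this relation
  -- stops when κ = ℓ or when δ or φ reaches an end.
  have key : ∀ α ∈ Icc 0 A, ∀ β ∈ Icc 0 b, ∀ κ ∈ Icc 0 (2 * ℓ), ∀ δ ∈ Icc 0 d, ∀ φ ∈ Icc 0 d,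
      (α = 0 ∨ β = b) → ∃ κ' ∈ Icc 0 (2 * ℓ), ∃ δ' ∈ Icc 0 d, ∃ φ' ∈ Icc 0 d,
      -β - κ' - δ' = -β - κ - δ ∧ δ' + φ' = δ + φ ∧
      (ℓ ≤ κ' ∧ δ' = d ∨ ℓ ≤ κ' ∧ φ' = 0 ∨ κ' = ℓ ∨ κ' ≤ ℓ ∧ δ' = 0 ∨ κ' ≤ ℓ ∧ φ' = d) := by
    rintro α - β - κ hκ δ hδ φ hφ -
    obtain ⟨k1, k2⟩ := hκ
    obtain ⟨d1, d2⟩ := hδ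
    obtain ⟨f1, f2⟩ := hφ
    rcases le_total ℓ κ with h | h
    · obtain ⟨r, r0, r1, r2, r3, hr⟩ : ∃ r, 0 ≤ r ∧ r ≤ κ - ℓ ∧ r ≤ d - δ ∧ r ≤ φ ∧
          (r = κ - ℓ ∨ r = d - δ ∨ r = φ) := exists_min_three (by linarith) (by linarith) f1
      refine ⟨κ - r, ⟨by linarith, by linarith⟩, δ + r, ⟨by linarith, by linarith⟩, φ - r,
        ⟨by linarith, by linarith⟩, by ring, by ring, ?_⟩
      rcases hr with hr | hr | hr
      · exact .inr (.inr (.inl (by linarith)))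
      · exact .inl ⟨by linarith, by linarith⟩
      · exact .inr (.inl ⟨by linarith, by linarith⟩)
    · obtain ⟨r, r0, r1, r2, r3, hr⟩ : ∃ r, 0 ≤ r ∧ r ≤ ℓ - κ ∧ r ≤ δ ∧ r ≤ d - φ ∧
          (r = ℓ - κ ∨ r = δ ∨ r = d - φ) := exists_min_three (by linarith) d1 (by linarith)
      refine ⟨κ + r, ⟨by linarith, by linarith⟩, δ - r, ⟨by linarith, by linarith⟩, φ + r,
        ⟨by linarith, by linarith⟩, by ring, by ring, ?_⟩
      rcases hr with hr | hr | hr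
      · exact .inr (.inr (.inl (by linarith)))
      · exact .inr (.inr (.inr (.inl ⟨by linarith, by linarith⟩)))
      · exact .inr (.inr (.inr (.inr ⟨by linarith, by linarith⟩)))
  have finish : ∀ α₁ ∈ Icc 0 A, ∀ β₁ ∈ Icc 0 b, ∀ κ₁ ∈ Icc 0 (2 * ℓ), ∀ δ₁ ∈ Icc 0 d,
      ∀ φ₁ ∈ Icc 0 d, (α₁ = 0 ∨ β₁ = b) → α₁ + β₁ = α + β → -β₁ - κ₁ - δ₁ = -β - κ - δ →
      δ₁ + φ₁ = δ + φ →
      ∃ α' ∈ Icc 0 A, ∃ β' ∈ Icc 0 b, ∃ κ' ∈ Icc 0 (2 * ℓ), ∃ δ' ∈ Icc 0 d, ∃ φ' ∈ Icc 0 d,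
      α' + β' = α + β ∧ -β' - κ' - δ' = -β - κ - δ ∧ δ' + φ' = δ + φ ∧
      (((α' = 0 ∨ β' = b) ∧ (ℓ ≤ κ' ∧ δ' = d ∨ ℓ ≤ κ' ∧ φ' = 0 ∨ κ' = ℓ ∨ κ' ≤ ℓ ∧ δ' = 0 ∨
        κ' ≤ ℓ ∧ φ' = d)) ∨ κ' = 0 ∧ (δ' = 0 ∨ φ' = d)) := by
    intro α₁ hα₁ β₁ hβ₁ κ₁ hκ₁ δ₁ hδ₁ φ₁ hφ₁ h e1 e2 e3
    obtain ⟨κ', hκ', δ', hδ', φ', hφ', e4, e5, h'⟩ := key α₁ hα₁ β₁ hβ₁ κ₁ hκ₁ δ₁ hδ₁ φ₁ hφ₁ h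
    exact ⟨α₁, hα₁, β₁, hβ₁, κ', hκ', δ', hδ', φ', hφ', e1, e4.trans e2, e5.trans e3, .inl ⟨h, h'⟩⟩
  obtain ⟨a1, a2⟩ := hα
  obtain ⟨b1, b2⟩ := hβ
  obtain ⟨k1, k2⟩ := hκ
  obtain ⟨d1, d2⟩ := hδ
  obtain ⟨f1, f2⟩ := hφ
  -- The relation α + κ = β lowers α and κ and raises β, until α = 0, β = b or κ = 0.
  obtain ⟨r, r0, r1, r2, r3, hr⟩ : ∃ r, 0 ≤ r ∧ r ≤ α ∧ r ≤ b - β ∧ r ≤ κ ∧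
      (r = α ∨ r = b - β ∨ r = κ) := exists_min_three a1 (by linarith) k1
  have step : (r = α ∨ r = b - β) → _ := fun h =>
    finish (α - r) ⟨by linarith, by linarith⟩ (β + r) ⟨by linarith, by linarith⟩ (κ - r)
      ⟨by linarith, by linarith⟩ δ ⟨d1, d2⟩ φ ⟨f1, f2⟩
      (h.imp (fun h => by linarith) fun h => by linarith) (by ring) (by ring) rfl
  rcases hr with hr | hr | hr
  · exact step (.inl hr)
  · exact step (.inr hr)
  -- With κ = 0 the combined relation α + δ = β + φ is still available. Either it finishes α or β,
  -- or it brings δ or φ to an end, which is the case of the last two tiles.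
  · obtain ⟨s, s0, s1, s2, s3, hs⟩ : ∃ s, 0 ≤ s ∧ s ≤ min (α - r) (b - (β + r)) ∧ s ≤ δ ∧
        s ≤ d - φ ∧ (s = min (α - r) (b - (β + r)) ∨ s = δ ∨ s = d - φ) :=
      exists_min_three (le_min (by linarith) (by linarith)) d1 (by linarith)
    have s4 := s1.trans (min_le_left _ _)
    have s5 := s1.trans (min_le_right _ _)
    rcases hs with hs | hs
    · refine finish (α - r - s) ⟨by linarith, by linarith⟩ (β + r + s) ⟨by linarith, by linarith⟩ 0
        ⟨le_rfl, by linarith⟩ (δ - s) ⟨by linarith, by linarith⟩ (φ + s)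
        ⟨by linarith, by linarith⟩ ?_ (by ring) (by linarith) (by ring)
      rcases min_choice (α - r) (b - (β + r)) with h | h
      · exact .inl (by linarith)
      · exact .inr (by linarith)
    · exact ⟨α - r - s, ⟨by linarith, by linarith⟩, β + r + s, ⟨by linarith, by linarith⟩, 0,
        ⟨le_rfl, by linarith⟩, δ - s, ⟨by linarith, by linarith⟩, φ + s,
        ⟨by linarith, by linarith⟩, by ring, by linarith, by ring,
        .inr ⟨rfl, hs.imp (fun h => by linarith) fun h => by linarith⟩⟩

/-- The alternatives of the normal form, two times five and two more, are the twelve tiles; the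
remaining free parameters are the coordinates on the tile. -/
theorem dodecahedron_subset (hC : IsGeneric 3 C) :
    dodecahedron C ⊆ ⋃ k, (fun y => cellShift C k + y) '' tile (cellStart C)
      (fun k => cellStart C k + cellLen C k) (cellBase C) cellDir k := by
  intro z hz
  rw [mem_dodecahedron_iff hC] at hz
  obtain ⟨α, hα, β, hβ, κ, hκ, δ, hδ, φ, hφ, e0, e1, e2⟩ := hz
  have h3 := stepLen_pos hC 1
  simp only [Fin.val_one] at h3
  obtain ⟨q1, q2⟩ := Qvec_alpha_three hC
  obtain ⟨α, ⟨a1, a2⟩, β, ⟨b1, b2⟩, κ, ⟨k1, k2⟩, δ, ⟨d1, d2⟩, φ, ⟨f1, f2⟩, e3, e4, e5, h⟩ :=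
    exists_normal_form h3.le hα hβ hκ hδ hφ
  rw [← e3] at e0
  rw [← e4] at e1
  rw [← e5] at e2
  clear hα hβ hκ hδ hφ e3 e4 e5
  have key : ∀ (k : Fin 12) (s t u : ℝ), (0 ≤ s ∧ s ≤ len₀ C (arcs k).1 ∧ 0 ≤ t ∧
      t ≤ len₁ C (arcs k).2.1 ∧ 0 ≤ u ∧ u ≤ p 3 C 2 ∧
      z 0 = cellShift C k 0 + start₀ C (arcs k).1 + s - slopeL₁ (arcs k).2.1 * t ∧
      z 1 = cellShift C k 1 + (start₁ C (arcs k).2.1 - start₀ C (arcs k).1) -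
        slope₀ (arcs k).1 * s + t - slope₂ (arcs k).2.2 * u ∧
      z 2 = cellShift C k 2 + (start₂ C (arcs k).2.2 - valR₁ C (arcs k).2.1) -
        slopeR₁ (arcs k).2.1 * t + u) → z ∈ ⋃ k, (fun y => cellShift C k + y) ''
          tile (cellStart C) (fun k => cellStart C k + cellLen C k) (cellBase C) cellDir k := by
    rintro k s t u ⟨s1, s2, t1, t2, u1, u2, e⟩
    exact mem_iUnion.mpr ⟨k, (mem_shifted_tile_iff hC k z).mpr
      ⟨s, ⟨s1, s2⟩, t, ⟨t1, t2⟩, u, ⟨u1, u2⟩, e⟩⟩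
  rcases h with ⟨h | h, ⟨h₁, h₂⟩ | ⟨h₁, h₂⟩ | h₁ | ⟨h₁, h₂⟩ | ⟨h₁, h₂⟩⟩ | ⟨h, h₁ | h₁⟩
  on_goal 1 => refine key 0 β (2 * stepLen 3 C 1 - κ) φ ?_
  on_goal 2 => refine key 1 β (2 * stepLen 3 C 1 - κ) δ ?_
  on_goal 3 => refine key 2 β (p 3 C 2 - δ) φ ?_
  on_goal 4 => refine key 3 β (stepLen 3 C 1 - κ) φ ?_
  on_goal 5 => refine key 4 β (stepLen 3 C 1 - κ) δ ?_
  on_goal 6 => refine key 5 α (2 * stepLen 3 C 1 - κ) φ ?_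
  on_goal 7 => refine key 6 α (2 * stepLen 3 C 1 - κ) δ ?_
  on_goal 8 => refine key 7 α (p 3 C 2 - δ) φ ?_
  on_goal 9 => refine key 8 α (stepLen 3 C 1 - κ) φ ?_
  on_goal 10 => refine key 9 α (stepLen 3 C 1 - κ) δ ?_
  on_goal 11 => refine key 10 α (p 3 C 1 - β) φ ?_
  on_goal 12 => refine key 11 α (p 3 C 1 - β) δ ?_
  all_goals
    refine ⟨?_, ?_, ?_, ?_, ?_, ?_, ?_, ?_, ?_⟩ <;> (try simp [cellShift, q1, q2, arcs, len₀, len₁,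
      start₀, start₁, start₂, slope₀, slopeL₁, slopeR₁, slope₂, valR₁]) <;> linarith

theorem iUnion_shifted_tile (hC : IsGeneric 3 C) :
    ⋃ k, (fun y => cellShift C k + y) '' tile (cellStart C)
      (fun k => cellStart C k + cellLen C k) (cellBase C) cellDir k = dodecahedron C :=
  subset_antisymm (iUnion_subset (shifted_tile_subset hC)) (dodecahedron_subset hC)

end Dodecahedron

end TropHyper
end

noncomputable section

namespace TropHyper

variable {C : ℤ → ℝ}

/-! ### The cells in genus two, and the hexagon -/

section Hexagon

/-- The beginnings of the arcs of a cell. -/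
def planeStart (C : ℤ → ℝ) : Fin 3 → Fin 2 → ℝ :=
  ![![stepLen 2 C 0, 0], ![stepLen 2 C 0 + p 2 C 1, 0], ![stepLen 2 C 0 + p 2 C 1, p 2 C 1]]

/-- The lengths of the arcs of a cell. -/
def planeLen (C : ℤ → ℝ) : Fin 3 → Fin 2 → ℝ :=
  ![![p 2 C 1, p 2 C 1], ![C (-1) + 2 * lam 2 C 1, p 2 C 1], ![C (-1) + 2 * lam 2 C 1, p 2 C 1]]

/-- The image of the beginning of a cell. -/
def planeBase (C : ℤ → ℝ) : Fin 3 → Fin 2 → ℝ :=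
  ![![0, 0], ![p 2 C 1, -p 2 C 1], ![p 2 C 1, 0]]

/-- The directions of the edges of the image of a cell. -/
def planeDir : Fin 3 → Fin 2 → Fin 2 → ℝ :=
  ![![![1, -1], ![0, 1]], ![![1, 0], ![0, 1]], ![![1, 0], ![-1, 1]]]

variable (hC : IsGeneric 2 C)
include hC

theorem lift_two (r : Fin 2 → ℝ) : lift 2 C r =
    ![r 0 - stepLen 2 C 0 - covL 2 C 1 (r 1), r 1 - covR 2 C 0 (r 0)] := by
  have b0 : basePos 2 C 0 = stepLen 2 C 0 := rfl
  have b1 : basePos 2 C 1 = 0 := rfl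
  have h1 : covL 2 C 1 0 = 0 := (covs_lower hC 1 ⟨le_rfl, (stepLen_pos hC 1).le⟩).2.2.2
  have h0 : covR 2 C 0 (stepLen 2 C 0) = 0 :=
    (covs_lower hC 0 ⟨(stepLen_pos hC 0).le, le_rfl⟩).2.1
  rw [lift_eq, sumBeta_two hC, sumBeta_two hC, b0, b1, h1, h0]
  ext j
  fin_cases j <;> simp
  ring

theorem covL_last_two (r : ℝ) : (r ∈ Icc 0 (p 2 C 1) → covL 2 C 1 r = 0) ∧
    (r ∈ Icc (p 2 C 1) (p 2 C 1 + p 2 C 1) → covL 2 C 1 r = r - p 2 C 1) := by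
  have hf : 2 * stepLen 2 C 1 + p 2 C 2 = p 2 C 1 := p_pred_last hC rfl
  have hL : IsArc (cyc 2 C 1) (2 * stepLen 2 C 1 + p 2 C 2) (p 2 C 1) := isArc_L hC 1
  obtain ⟨l1, l2, -⟩ := cov_zero_turn hL r
  exact ⟨fun h => l1 ⟨h.1, by linarith [h.2]⟩,
    fun h => (l2 ⟨by linarith [h.1], by linarith [h.2]⟩).trans (by rw [hf])⟩

theorem cyc_last_two : cyc 2 C 1 = p 2 C 1 + p 2 C 1 := by
  have hf : 2 * stepLen 2 C 1 + p 2 C 2 = p 2 C 1 := p_pred_last hC rfl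
  rw [cyc, hf]

theorem planeLen_pos (k : Fin 3) (i : Fin 2) : 0 < planeLen C k i := by
  have h1 := p_pos hC (i := 1) (by norm_num)
  have h2 := outer_pos hC (by norm_num)
  fin_cases k <;> fin_cases i <;> simpa [planeLen]

/-- Each cycle consists of the shared edge and an outer arc. Of the four pairs of arcs only the one
with both points on the shared edge is excluded. -/
theorem isCellDecomp_two : IsCellDecomp 2 C (planeStart C)
    (fun k => planeStart C k + planeLen C k) (planeBase C) planeDir := by
  have h1 := p_pos hC (i := 1) (by norm_num)
  have h2 := outer_pos hC (by norm_num)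
  have b0 : basePos 2 C 0 = stepLen 2 C 0 := rfl
  have b1 : basePos 2 C 1 = 0 := rfl
  have c0 := cyc_first hC
  have c1 := cyc_last_two hC
  have hf : 2 * stepLen 2 C 1 + p 2 C 2 = p 2 C 1 := p_pred_last hC rfl
  have hlo : ∀ k i, basePos 2 C i ≤ planeStart C k i := by
    intro k i
    fin_cases k <;> fin_cases i <;> simp [planeStart, b0, b1, h1.le]
  have hhi : ∀ k i, (planeStart C k + planeLen C k) i ≤ basePos 2 C i + cyc 2 C i := by
    intro k i
    fin_cases k <;> fin_cases i <;> simp [planeStart, planeLen, b0, b1, c0, c1] <;> linarith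
  refine ⟨fun k i => ?_, hlo, hhi, fun k => ?_, fun k r hr => ?_, fun r hr hD => ?_,
    fun k k' r h h' => ?_, fun k r hr => ?_⟩
  · simpa using planeLen_pos hC k i
  · refine Matrix.linearIndependent_rows_of_det_ne_zero (A := Matrix.of (planeDir k)) ?_
    rw [Matrix.det_fin_two]
    fin_cases k <;> simp [planeDir]
  · have r0 := hr 0
    have r1 := hr 1
    rw [lift_two hC, Fin.sum_univ_two]
    fin_cases k <;> simp [planeStart, planeLen] at r0 r1
    · rw [(covR_first hC (by norm_num)).1 r0, (covL_last_two hC _).1 r1]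
      ext j
      fin_cases j <;> simp [planeBase, planeDir, planeStart] <;> ring
    · rw [(covR_first hC (by norm_num)).2 ⟨r0.1, by linarith [r0.2]⟩, (covL_last_two hC _).1 r1]
      ext j
      fin_cases j <;> simp [planeBase, planeDir, planeStart] <;> ring
    · rw [(covR_first hC (by norm_num)).2 ⟨r0.1, by linarith [r0.2]⟩, (covL_last_two hC _).2 r1]
      ext j
      fin_cases j <;> simp [planeBase, planeDir, planeStart] <;> ring
  · rw [loopDiv_mem_iff hC] at hD
    have t0 : r 0 ∈ Ioc (stepLen 2 C 0) (stepLen 2 C 0 + cyc 2 C 0) := hr 0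
    have t1 : r 1 ∈ Ico 0 (0 + cyc 2 C 1) := hr 1
    obtain ⟨t3, t4⟩ := t1
    obtain ⟨t1, t2⟩ := t0
    have build : ∀ k, r 0 ∈ Icc (planeStart C k 0) (planeStart C k 0 + planeLen C k 0) →
        r 1 ∈ Icc (planeStart C k 1) (planeStart C k 1 + planeLen C k 1) →
        ∃ k, ∀ i, r i ∈ Icc (planeStart C k i) ((planeStart C k + planeLen C k) i) :=
      fun k h h' => ⟨k, Fin.forall_fin_two.mpr ⟨h, h'⟩⟩
    rcases le_or_gt (r 1) (p 2 C 1) with h | h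
    · rcases le_total (r 0) (stepLen 2 C 0 + p 2 C 1) with h' | h'
      · refine build 0 ?_ ?_ <;> simp [planeStart, planeLen] <;> constructor <;> linarith
      · refine build 1 ?_ ?_ <;> simp [planeStart, planeLen] <;> constructor <;> linarith
    · rcases lt_or_ge (r 0) (stepLen 2 C 0 + p 2 C 1) with h' | h'
      · refine absurd ⟨?_, ?_⟩ (hD 0 1 rfl)
        · exact mem_openVert_of_right hC 0 0 (by simpa using t1) (by simpa using h')
        · refine mem_openVert_of_left hC 1 0 ?_ (by simpa using t4)
          simp only [Int.cast_zero, zero_mul, zero_add]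
          exact hf.trans_lt h
      · refine build 2 ?_ ?_ <;> simp [planeStart, planeLen] <;> constructor <;> linarith
  · have r0 := h 0
    have r1 := h 1
    have r0' := h' 0
    have r1' := h' 1
    fin_cases k <;> fin_cases k' <;> simp [planeStart, planeLen] at r0 r1 r0' r1' ⊢ <;> linarith
  · refine regular_of_turn hC (fun i => (hlo k i).trans_lt (hr i).1)
      (fun i => (hr i).2.trans_le (hhi k i)) fun i j hij => ?_
    have r0 := hr 0
    have r1 := hr 1
    fin_cases i <;> fin_cases j <;> simp at hij
    change r 0 ≠ stepLen 2 C 0 ∧ r 1 ≠ 2 * stepLen 2 C 1 + p 2 C 2 ∧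
      ¬ (r 0 < stepLen 2 C 0 + p 2 C 1 ∧ stepLen 2 C 0 < r 0 ∧
        2 * stepLen 2 C 1 + p 2 C 2 < r 1)
    rw [hf]
    refine ⟨((hlo k 0).trans_lt (hr 0).1).ne', ?_, ?_⟩
    · intro he
      fin_cases k <;> simp [planeStart, planeLen] at r0 r1 <;> linarith
    · rintro ⟨e1, e2, e3⟩
      fin_cases k <;> simp [planeStart, planeLen] at r0 r1 <;> linarith

theorem Qvec_alpha_two : Qvec 2 C (alpha 2 C 1) = ![-p 2 C 1, 2 * p 2 C 1] := by
  have hf : 2 * stepLen 2 C 1 + p 2 C 2 = p 2 C 1 := p_pred_last hC rfl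
  rw [Qvec_alpha_eq hC]
  ext j
  fin_cases j <;> simp [Edge.dir]
  linarith

theorem mem_hexagon_iff (z : Fin 2 → ℝ) :
    z ∈ hexagon C ↔ ∃ α ∈ Icc 0 (C (-1) + 2 * lam 2 C 1), ∃ β ∈ Icc 0 (p 2 C 1),
      ∃ γ ∈ Icc 0 (p 2 C 1), z 0 - p 2 C 1 = α + β ∧ z 1 + 2 * p 2 C 1 = -β + γ := by
  have h1 := p_pos hC (i := 1) (by norm_num)
  have h4 := outer_pos hC (by norm_num)
  have hc : ∀ i, 0 < (![C (-1) + 2 * lam 2 C 1, p 2 C 1, p 2 C 1] : Fin 3 → ℝ) i := by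
    intro i
    fin_cases i <;> simpa
  have he : hexagon C = (fun y => 0 + y) '' zonotope ![p 2 C 1, -2 * p 2 C 1] (fun i =>
      (![C (-1) + 2 * lam 2 C 1, p 2 C 1, p 2 C 1] : Fin 3 → ℝ) i •
      (![![1, 0], ![1, -1], ![0, 1]] : Fin 3 → Fin 2 → ℝ) i) := by
    simp only [zero_add, image_id', hexagon]
    congr 1
    ext i j
    fin_cases i <;> fin_cases j <;> simp
  rw [he, mem_translate_zonotope hc]
  constructor
  · rintro ⟨u, hu, rfl⟩
    refine ⟨u 0, hu 0, u 1, hu 1, u 2, hu 2, ?_⟩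
    simp [Fin.sum_univ_three]
  · rintro ⟨α, hα, β, hβ, γ, hγ, e0, e1⟩
    refine ⟨![α, β, γ], fun i => ?_, ?_⟩
    · fin_cases i
      exacts [hα, hβ, hγ]
    · ext j
      fin_cases j <;> simp [Fin.sum_univ_three] <;> linarith

theorem mem_shifted_plane_tile_iff (k : Fin 3) (z : Fin 2 → ℝ) :
    z ∈ (fun y => -![-p 2 C 1, 2 * p 2 C 1] + y) '' tile (planeStart C)
      (fun k => planeStart C k + planeLen C k) (planeBase C) planeDir k ↔
    ∃ s ∈ Icc 0 (planeLen C k 0), ∃ t ∈ Icc 0 (planeLen C k 1),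
      z 0 - p 2 C 1 = planeBase C k 0 + (s * planeDir k 0 0 + t * planeDir k 1 0) ∧
      z 1 + 2 * p 2 C 1 = planeBase C k 1 + (s * planeDir k 0 1 + t * planeDir k 1 1) := by
  unfold tile
  simp only [Pi.add_apply, add_sub_cancel_left]
  rw [mem_translate_zonotope (planeLen_pos hC k)]
  constructor
  · rintro ⟨u, hu, rfl⟩
    refine ⟨u 0, hu 0, u 1, hu 1, ?_⟩
    simp [Fin.sum_univ_two]
  · rintro ⟨s, hs, t, ht, e0, e1⟩
    refine ⟨![s, t], Fin.forall_fin_two.mpr ⟨hs, ht⟩, ?_⟩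
    ext j
    fin_cases j <;> simp [Fin.sum_univ_two] <;> linarith

/-- The directions satisfy α = β + γ. Exchanging α for β and γ until one of the three reaches its
end puts a point of the hexagon on one of the tiles α = 0, β = p_1, γ = p_1. -/
theorem iUnion_shifted_plane_tile :
    ⋃ k, (fun y => -![-p 2 C 1, 2 * p 2 C 1] + y) '' tile (planeStart C)
      (fun k => planeStart C k + planeLen C k) (planeBase C) planeDir k = hexagon C := by
  have h1 := p_pos hC (i := 1) (by norm_num)
  have h4 := outer_pos hC (by norm_num)
  ext z
  simp only [mem_iUnion, mem_shifted_plane_tile_iff hC, mem_hexagon_iff hC]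
  constructor
  · rintro ⟨k, s, hs, t, ht, e0, e1⟩
    fin_cases k <;> simp [planeLen, planeBase, planeDir] at hs ht e0 e1
    · exact ⟨0, ⟨le_rfl, h4.le⟩, s, hs, t, ht, by linarith, by linarith⟩
    · exact ⟨s, hs, p 2 C 1, ⟨h1.le, le_rfl⟩, t, ht, by linarith, by linarith⟩
    · exact ⟨s, hs, p 2 C 1 - t, ⟨by linarith, by linarith⟩, p 2 C 1, ⟨h1.le, le_rfl⟩,
        by linarith, by linarith⟩
  · rintro ⟨α, ⟨a1, a2⟩, β, ⟨b1, b2⟩, γ, ⟨c1, c2⟩, e0, e1⟩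
    obtain ⟨r, r0, r1, r2, r3, hr⟩ : ∃ r, 0 ≤ r ∧ r ≤ α ∧ r ≤ p 2 C 1 - β ∧ r ≤ p 2 C 1 - γ ∧
        (r = α ∨ r = p 2 C 1 - β ∨ r = p 2 C 1 - γ) :=
      exists_min_three a1 (by linarith) (by linarith)
    rcases hr with hr | hr | hr
    · refine ⟨0, β + r, ?_, γ + r, ?_, ?_, ?_⟩ <;> simp [planeLen, planeBase, planeDir] <;>
        (try constructor) <;> linarith
    · refine ⟨1, α - r, ?_, γ + r, ?_, ?_, ?_⟩ <;> simp [planeLen, planeBase, planeDir] <;>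
        (try constructor) <;> linarith
    · refine ⟨2, α - r, ?_, p 2 C 1 - (β + r), ?_, ?_, ?_⟩ <;>
        simp [planeLen, planeBase, planeDir] <;> (try constructor) <;> linarith

end Hexagon

/-! ### The main theorem -/

theorem ncard_facets_hexagon_eq (hC : IsGeneric 2 C) : (facets (hexagon C)).ncard = 6 :=
  ncard_facets_hexagon _ (outer_pos hC (by norm_num)) (p_pos hC (by norm_num))
    (p_pos hC (by norm_num))

theorem ncard_facets_dodecahedron_eq (hC : IsGeneric 3 C) :
    (facets (dodecahedron C)).ncard = 12 := by
  have h := stepLen_pos hC 1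
  have hc : 0 < 2 * (lam 3 C 2 - lam 3 C 1) := mul_pos two_pos h
  have := ncard_facets_dodecahedron ![p 3 C 1, -p 3 C 1, 0] (outer_pos hC (by norm_num))
    (p_pos hC (i := 1) (by norm_num)) hc (p_pos hC (i := 2) (by norm_num))
    (p_pos hC (i := 2) (by norm_num))
  rwa [← neg_mul] at this

theorem abelJacobi_spec {g : ℕ} (hC : IsGeneric g C) (hg : 0 < g) {P₀ P : ℝ × ℝ}
    (h₀ : P₀ ∈ Gam g C) (h : P ∈ Gam g C) : (∃ γ, IsPath g C γ P₀ P) ∧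
      ∀ γ, IsPath g C γ P₀ P → abelJacobiPt g C P₀ P = (Qvec g C γ : Jac g C) :=
  ⟨exists_isPath hC h₀ h, fun γ hγ => by
    rw [abelJacobiPt_eq hC hg h₀ h, Qvec_path hC hg γ hγ]⟩

end TropHyper
end

open TropHyper in
theorem mainTheorem3 :
    -- the Abel–Jacobi map is well defined, and its restriction is bijective
    (∀ (g : ℕ) (C : ℤ → ℝ), (g = 2 ∨ g = 3) → IsGeneric g C → ∀ P₀ ∈ Gam g C,
      (∀ P ∈ Gam g C, (∃ γ, IsPath g C γ P₀ P) ∧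
        ∀ γ, IsPath g C γ P₀ P → abelJacobiPt g C P₀ P = (Qvec g C γ : Jac g C)) ∧
      Set.BijOn (eta g C P₀) (DSet g C) Set.univ) ∧
    -- genus two: the lifted image is a hexagon
    (∀ C : ℤ → ℝ, IsGeneric 2 C →
      (fun z => -(![-p 2 C 1, 2 * p 2 C 1] : Fin 2 → ℝ) + z) '' liftedImage 2 C = hexagon C ∧
      (∃ R : Fin 3 → Set (Fin 2 → ℝ), (∀ k, IsParallelotope (R k)) ∧
        IsNonoverlappingUnion R (hexagon C)) ∧
      (facets (hexagon C)).ncard = 6 ∧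
      IsFundDomain (lattice 2 C) (hexagon C)) ∧
    -- genus three: twelve parallelepipeds, which lattice translations assemble to a dodecahedron
    (∀ C : ℤ → ℝ, IsGeneric 3 C →
      (∃ R : Fin 12 → Set (Fin 3 → ℝ), (∀ k, IsParallelotope (R k)) ∧
        IsNonoverlappingUnion R (liftedImage 3 C) ∧
        ∃ l : Fin 12 → Fin 3 → ℝ, (∀ k, l k ∈ lattice 3 C) ∧
          IsNonoverlappingUnion (fun k => (fun z => l k + z) '' R k) (dodecahedron C)) ∧
      (facets (dodecahedron C)).ncard = 12 ∧
      IsFundDomain (lattice 3 C) (dodecahedron C)) := by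
  refine ⟨fun g C hg hC P₀ h₀ => ?_, fun C hC => ?_, fun C hC => ?_⟩
  · refine ⟨fun P hP => abelJacobi_spec hC (by omega) h₀ hP, ?_⟩
    rcases hg with rfl | rfl
    · exact bijOn_eta hC (by norm_num) (injective_two hC) (surjective_two hC) h₀
    · exact bijOn_eta hC (by norm_num) (injective_three hC) (surjective_three hC) h₀
  · have hcell := isCellDecomp_two hC
    have htile := hcell.isTiling hC (regular_unique_two hC) (surjective_two hC)
    have hV := iUnion_shifted_plane_tile hC
    have hl : ∀ _ : Fin 3, -(![-p 2 C 1, 2 * p 2 C 1] : Fin 2 → ℝ) ∈ lattice 2 C := fun _ => by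
      rw [← Qvec_alpha_two hC]
      exact neg_mem (Qvec_alpha_mem_lattice 1)
    refine ⟨?_, ⟨_, fun k => (htile.para k).translate _, htile.isNonoverlappingUnion hl hV⟩,
      ncard_facets_hexagon_eq hC, htile.isFundDomain hl hV⟩
    -- In genus two all tiles are shifted by the same vector, so the hexagon is a translate of the
    -- lifted image itself.
    rw [← hcell.iUnion_tile hC, Set.image_iUnion, hV]
  · have hcell := isCellDecomp_three hC
    have htile := hcell.isTiling hC (regular_unique_three hC) (surjective_three hC)
    have hV := iUnion_shifted_tile hC
    refine ⟨⟨_, htile.para, ?_, _, cellShift_mem_lattice,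
      htile.isNonoverlappingUnion cellShift_mem_lattice hV⟩,
      ncard_facets_dodecahedron_eq hC, htile.isFundDomain cellShift_mem_lattice hV⟩
    -- Zero shifts give the decomposition of the lifted image itself.
    have := htile.isNonoverlappingUnion (l := fun _ => 0) (fun _ => zero_mem _) rfl
    simp only [zero_add, Set.image_id'] at this
    rwa [hcell.iUnion_tile hC] at this
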